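/- **Setting.** Fix $\alpha\in(0,1)$ and a compactly supported $\alpha$-Hölder path $\Gamma=(\Gamma(1),\dots,\Gamma(d)):\mathbb R\to\mathbb R^d$. Put $(\mathcal Ff)(\xi)=(2\pi)^{-1/2}\int f(x)e^{-ix\xi}dx$ and $D(m)f=\mathcal F^{-1}(m\,\mathcal Ff)$. Let $(\phi_k)_{k\in\mathbb Z}$ be a smooth dyadic partition of unity of $\mathbb R$ with values in $[0,1]$: $\phi_0=1$ on $[-1,1]$, $\mathrm{supp}\,\phi_0\subset[-2,2]$, $\mathrm{supp}\,\phi_{1}\subset[1,5]$, $\mathrm{supp}\,\phi_{-1}\subset[-5,-1]$, $\phi_k(\xi)=\phi_{\mathrm{sgn}(k)}(2^{1-|k|}\xi)$ for $|k|\ge2$, $\sum_k\phi_k=1$. Let $\tilde\phi_0={\bf 1}_{[-1,1]}$, $\tilde\phi_k={\bf 1}_{[2^{k-1},2^k]}$ and $\tilde\phi_{-k}={\bf 1}_{[-2^k,-2^{k-1}]}$ for $k\ge1$. **Forests.** All forests $\mathbb T$ are finite, rooted, decorated by $\ell:V(\mathbb T)\to\{1,\dots,d\}$, and carry a total ordering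 of $V(\mathbb T)=\{1<\dots<n\}$ compatible with the tree order ($v\twoheadrightarrow w$, i.e. $w$ lies strictly below $v$ on the way to the root, implies $v>w$); subforests carry the induced ordering and decoration, and are identified when they correspond under an increasing renumbering of the vertices. An admissible cut $\vec v\models V(\mathbb T)$ of a tree is a non-empty set of non-root vertices, no two of which are comparable for $\twoheadrightarrow$; $Lea_{\vec v}\mathbb T$ is the subforest of the vertices in or above $\vec v$, and $Roo_{\vec v}\mathbb T$ is the subtree of the other vertices. For functions $f_v$ put $$[\mathrm{SkI}_{\mathbb T}(\otimes_v f_v)]_t=(2\pi)^{-n/2}\int_{\mathbb R^n}\Big(\prod_v i\xi_v\,\mathcal Ff_v(\xi_v)\Big)\frac{e^{it\sum_v\xi_v}}{\prod_v i\big(\xi_v+\sum_{w\twoheadrightarrow v}\xi_w\big)}\,d\xi .$$ **Regularization.** For every tree $\mathbb T$ choose a set $\mathbb Z^{\mathbb T}_{reg}\subset\mathbb Z^{V(\mathbb T)}$ (for instance contained in $\mathbb Z^{\mathbb T}_+=\{k: v\twoheadrightarrow w\Rightarrow|k_v|\ge|k_w|\}$; it may depend on the ordering and on the decoration), with $\mathbb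 Z^{\mathbb T}_{reg}=\mathbb Z$ if $|V(\mathbb T)|=1$. For $\kappa,k\in\mathbb Z^n$ and a tree $\mathbb T$ let $$\mathcal S^t_{\kappa,k}(\mathbb T)={\bf 1}_{k\in\mathbb Z^{\mathbb T}_{reg}}\big[\mathrm{SkI}_{\mathbb T}\big(\otimes_vD(\phi_{k_v})D(\tilde\phi_{\kappa_v})\Gamma(\ell(v))\big)\big]_t ,$$ and define $\mathcal S^t_{\kappa,k}$ on forests as the product over the tree components. Define $\mathcal I^{ts}_{\kappa,k}$ recursively on trees by $$\mathcal I^{ts}_{\kappa,k}(\mathbb T)=\mathcal S^t_{\kappa,k}(\mathbb T)-\mathcal S^s_{\kappa,k}(\mathbb T)-\sum_{\vec v\models V(\mathbb T)}\mathcal I^{ts}_{\kappa,k}(Roo_{\vec v}\mathbb T)\,\mathcal S^s_{\kappa,k}(Lea_{\vec v}\mathbb T)$$ (with $\kappa,k$ restricted to the relevant vertices), and on forests as the product over the tree components. Finally let $$[\mathcal RI_{\mathbb T}(\tilde{\mathcal P}^+\Gamma)]_{ts}=\sum_{\kappa\in\mathbb Z^n,\ |\kappa_1|\le\dots\le|\kappa_n|}\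 \sum_{k\in\mathbb Z^n}\frac1{|\Sigma_\kappa|}\,\mathcal I^{ts}_{\kappa,k}(\mathbb T),$$ where $\Sigma_\kappa$ is the set of permutations $\tau\in\Sigma_n$ with $|\kappa_{\tau(j)}|=|\kappa_j|$ for all $j$. For $\sigma\in\Sigma_n$, integrate over $t>x_1>\dots>x_n>s$ in the order $x_{\sigma(1)},\dots,x_{\sigma(n)}$ (outermost first): $x_{\sigma(j)}$ ranges over $[s_j,t_j]$ with $s_j\in\{s\}\cup\{x_{\sigma(i)}\}_{i<j}$, $t_j\in\{t\}\cup\{x_{\sigma(i)}\}_{i<j}$. Writing $\int_{s_j}^{t_j}=\int_s^{t_j}-\int_s^{s_j}$ whenever $s_j\ne s$ and expanding gives a signed sum $\mathbb T^\sigma=\sum_jg(\sigma,j)\mathbb T^\sigma_j$, $g(\sigma,j)=\pm1$, of forests on $\{1,\dots,n\}$, in which the parent of $m$ is the $i$ such that $x_{\sigma(i)}$ is the selected upper limit of $x_{\sigma(m)}$ ($m$ is a root if that limit is $t$), with decoration $\ell\circ\sigma$. Set $$[\mathcal R{\bf\Gamma}^n(\ell(1),\dots,\ell(n))]_{ts}=\sum_{\sigma\in\Sigma_n}\sum_jg(\sigma,j)\,[\mathcal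 RI_{\mathbb T^\sigma_j}(\tilde{\mathcal P}^+\Gamma)]_{ts}\in\mathbb C .$$ **Theorem.** Assume that, for every tree $\mathbb T$ and every $t\in\mathbb R$, the Fourier integrals defining $[\mathrm{SkI}_{\mathbb T}(\otimes_vD(\phi_{k_v})\Gamma(\ell(v)))]_t$, $k\in\mathbb Z^{\mathbb T}_{reg}$, converge absolutely, and that the series $\sum_{|\kappa_1|\le\dots\le|\kappa_n|}\sum_{k\in\mathbb Z^{\mathbb T}_{reg}}\mathcal S^t_{\kappa,k}(\mathbb T)$ converges absolutely. Then all the series $[\mathcal RI_{\mathbb T}(\tilde{\mathcal P}^+\Gamma)]_{ts}$ ($\mathbb T$ a forest) converge absolutely, so that $\mathcal R{\bf\Gamma}$ is well-defined, and for all $t,u,s\in\mathbb R$: 1. (Chen property) for $n\ge1$ and $1\le i_1,\dots,i_n\le d$, $$[\mathcal R{\bf\Gamma}^n(i_1,\dots,i_n)]_{ts}-[\mathcal R{\bf\Gamma}^n(i_1,\dots,i_n)]_{tu}-[\mathcal R{\bf\Gamma}^n(i_1,\dots,i_n)]_{us}=\sum_{j=1}^{n-1}[\mathcal R{\bf\Gamma}^j(i_1,\dots,i_j)]_{tu}\,[\mathcal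 R{\bf\Gamma}^{n-j}(i_{j+1},\dots,i_n)]_{us};$$ 2. (shuffle property) for $n_1,n_2\ge1$ and all indices, $$[\mathcal R{\bf\Gamma}^{n_1}(i_1,\dots,i_{n_1})]_{ts}\,[\mathcal R{\bf\Gamma}^{n_2}(j_1,\dots,j_{n_2})]_{ts}=\sum_{\vec k\in \mathrm{Sh}(\vec i,\vec j)}[\mathcal R{\bf\Gamma}^{n_1+n_2}(k_1,\dots,k_{n_1+n_2})]_{ts},$$ the sum being over the $\binom{n_1+n_2}{n_1}$ shuffles of $\vec i$ and $\vec j$ (with multiplicity). -/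

import Mathlib

open MeasureTheory

namespace FourierNormalOrdering

noncomputable section

/-! ### Heap-ordered rooted forests and permutation graphs -/

/-- A rooted forest with vertex set `Fin n`, whose numbering is a total ordering compatible with the
tree partial ordering: `parent v = some w` means that `v` connects directly to `w` (`w = v⁻`), and
`parent v = none` means that `v` is a root. -/
structure Forest (n : ℕ) where
  parent : Fin n → Option (Fin n)
  parent_lt : ∀ v w, parent v = some w → w < v

namespace Forest

variable {n : ℕ}

/-- `F.Conn S v w`: `v ↠ w` in the sub-forest of `F` with vertex set `S`. -/
def Conn (F : Forest n) (S : Finset (Fin n)) (v w : Fin n) : Prop :=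
  Relation.TransGen (fun a b => a ∈ S ∧ b ∈ S ∧ F.parent a = some b) v w

/-- A tree is a forest with exactly one root. -/
def IsTree (F : Forest n) : Prop := ∃! r, F.parent r = none

/-- The sub-forest with vertex set `S`, renumbered increasingly by `Fin S.card`. -/
def restrict (F : Forest n) (S : Finset (Fin n)) : Forest S.card where
  parent i := (F.parent (S.orderEmbOfFin rfl i)).bind fun w =>
    if h : w ∈ S then some ((S.orderIsoOfFin rfl).symm ⟨w, h⟩) else none
  parent_lt := by
    intro v w hw
    rw [Option.bind_eq_some_iff] at hw
    obtain ⟨a, ha, hw⟩ := hw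
    split_ifs at hw with h
    rw [Option.some.injEq] at hw
    subst hw
    have h1 := F.parent_lt _ _ ha
    rw [OrderIso.symm_apply_lt]
    exact h1

open Classical in
/-- The roots of the sub-forest with vertex set `S`. -/
def roots (F : Forest n) (S : Finset (Fin n)) : Finset (Fin n) :=
  S.filter fun v => ∀ w ∈ S, F.parent v ≠ some w

open Classical in
/-- The vertex set of the tree component with root `r` of the sub-forest with vertex set `S`. -/
def comp (F : Forest n) (S : Finset (Fin n)) (r : Fin n) : Finset (Fin n) :=
  S.filter fun v => v = r ∨ F.Conn S v r

open Classical in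
/-- The admissible cuts of the tree with vertex set `S`: the non-empty, totally disconnected sets of
vertices other than the root. -/
def cuts (F : Forest n) (S : Finset (Fin n)) : Finset (Finset (Fin n)) :=
  (S \ F.roots S).powerset.filter fun c => c.Nonempty ∧ ∀ v ∈ c, ∀ w ∈ c, ¬ F.Conn S v w

open Classical in
/-- The vertex set of `Lea_c` of the tree with vertex set `S`. -/
def lea (F : Forest n) (S c : Finset (Fin n)) : Finset (Fin n) :=
  S.filter fun v => v ∈ c ∨ ∃ w ∈ c, F.Conn S v w

/-- The vertex set of `Roo_c` of the tree with vertex set `S`. -/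
def roo (F : Forest n) (S c : Finset (Fin n)) : Finset (Fin n) := S \ F.lea S c

theorem card_roo_lt (F : Forest n) {S c : Finset (Fin n)} (hc : c ∈ F.cuts S) :
    (F.roo S c).card < S.card := by
  classical
  simp only [cuts, Finset.mem_filter, Finset.mem_powerset] at hc
  obtain ⟨hsub, ⟨v, hv⟩, -⟩ := hc
  have hvS : v ∈ S := (Finset.mem_sdiff.1 (hsub hv)).1
  refine Finset.card_lt_card ((Finset.ssubset_iff_of_subset Finset.sdiff_subset).2 ⟨v, hvS, ?_⟩)
  simp [lea, hvS, hv]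

end Forest

/-- The ranks `i < j` such that the variable `x_{σ(i)}` lies to the left of `x_{σ(j)}` in
`t > x_1 > ⋯ > x_n > s`, i.e. `σ(i) < σ(j)`. -/
def leftRanks {n : ℕ} (σ : Equiv.Perm (Fin n)) (j : Fin n) : Finset (Fin n) :=
  Finset.univ.filter fun i => i < j ∧ σ i < σ j

/-- The ranks `i < j` with `σ(j) < σ(i)`. -/
def rightRanks {n : ℕ} (σ : Equiv.Perm (Fin n)) (j : Fin n) : Finset (Fin n) :=
  Finset.univ.filter fun i => i < j ∧ σ j < σ i

/-- When the variables `x_{σ(1)}, x_{σ(2)}, …` are integrated in this order (outermost first) over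
the simplex, `x_{σ(j)}` ranges over `[s_j, t_j]`. `upperBound σ j` is the rank `i` such that
`t_j = x_{σ(i)}`, or `none` if `t_j = t`. -/
def upperBound {n : ℕ} (σ : Equiv.Perm (Fin n)) (j : Fin n) : Option (Fin n) :=
  if h : ((leftRanks σ j).image σ).Nonempty then
    some (σ.symm (((leftRanks σ j).image σ).max' h)) else none

/-- The rank `i` such that `s_j = x_{σ(i)}`, or `none` if `s_j = s`. -/
def lowerBound {n : ℕ} (σ : Equiv.Perm (Fin n)) (j : Fin n) : Option (Fin n) :=
  if h : ((rightRanks σ j).image σ).Nonempty then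
    some (σ.symm (((rightRanks σ j).image σ).min' h)) else none

/-- The ranks `j` with `s_j ≠ s`, for which `∫_{s_j}^{t_j}` has to be written
`∫_s^{t_j} - ∫_s^{s_j}`. -/
def splitRanks {n : ℕ} (σ : Equiv.Perm (Fin n)) : Finset (Fin n) :=
  Finset.univ.filter fun j => (lowerBound σ j).isSome

theorem upperBound_lt {n : ℕ} (σ : Equiv.Perm (Fin n)) (v w : Fin n)
    (h : upperBound σ v = some w) : w < v := by
  unfold upperBound at h
  split_ifs at h with hne
  have h1 := Finset.max'_mem _ hne
  simp only [Option.some.injEq] at h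
  simp only [← h]
  rw [Finset.mem_image] at h1
  obtain ⟨a, ha, ha'⟩ := h1
  rw [← ha', Equiv.symm_apply_apply]
  exact ((Finset.mem_filter.1 ha).2).1

theorem lowerBound_lt {n : ℕ} (σ : Equiv.Perm (Fin n)) (v w : Fin n)
    (h : lowerBound σ v = some w) : w < v := by
  unfold lowerBound at h
  split_ifs at h with hne
  have h1 := Finset.min'_mem _ hne
  simp only [Option.some.injEq] at h
  simp only [← h]
  rw [Finset.mem_image] at h1
  obtain ⟨a, ha, ha'⟩ := h1
  rw [← ha', Equiv.symm_apply_apply]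
  exact ((Finset.mem_filter.1 ha).2).1

/-- The permutation graph of `σ` is `∑_c (-1)^{|c|} permForest σ c`, over the subsets `c` of
`splitRanks σ`: `c` is the set of ranks at which `-∫_s^{s_j}` is selected, instead of
`∫_s^{t_j}`. The vertex `j` of the forest carries the decoration `ℓ(σ(j))`. -/
def permForest {n : ℕ} (σ : Equiv.Perm (Fin n)) (c : Finset (Fin n)) : Forest n where
  parent j := if j ∈ c then lowerBound σ j else upperBound σ j
  parent_lt := by
    intro v w h
    split_ifs at h
    · exact lowerBound_lt σ v w h
    · exact upperBound_lt σ v w h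

/-! ### Fourier multipliers and skeleton integrals -/

/-- A smooth dyadic partition of unity `(φ_k)_{k ∈ ℤ}` of the real line. -/
structure DyadicPartition where
  φ : ℤ → ℝ → ℝ
  smooth : ∀ k, ContDiff ℝ (⊤ : ℕ∞) (φ k)
  mem_Icc : ∀ k ξ, φ k ξ ∈ Set.Icc (0 : ℝ) 1
  eq_one : ∀ ξ ∈ Set.Icc (-1 : ℝ) 1, φ 0 ξ = 1
  support_zero : Function.support (φ 0) ⊆ Set.Icc (-2) 2
  support_one : Function.support (φ 1) ⊆ Set.Icc 1 5
  support_neg_one : Function.support (φ (-1)) ⊆ Set.Icc (-5) (-1)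
  dilation : ∀ k : ℤ, 2 ≤ |k| → ∀ ξ, φ k ξ = φ k.sign ((2 : ℝ) ^ (1 - |k|) * ξ)
  sum_eq_one : ∀ ξ, HasSum (fun k => φ k ξ) 1

/-- The interval on which the sharp multiplier `φ̃_k` is equal to `1`: `[-1,1]` if `k = 0`,
`[2^{k-1}, 2^k]` if `k ≥ 1`, and `[-2^{|k|}, -2^{|k|-1}]` if `k ≤ -1`. -/
def sharpBlock (k : ℤ) : Set ℝ :=
  if k = 0 then Set.Icc (-1) 1
  else if 0 < k then Set.Icc ((2 : ℝ) ^ (k - 1)) ((2 : ℝ) ^ k)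
  else Set.Icc (-(2 : ℝ) ^ (-k)) (-(2 : ℝ) ^ (-k - 1))

/-- The Fourier transform `(2π)^{-1/2} ∫ f(x) e^{-ixξ} dx`. -/
def fourierTransform (f : ℝ → ℝ) (ξ : ℝ) : ℂ :=
  ((Real.sqrt (2 * Real.pi) : ℝ) : ℂ)⁻¹ *
    ∫ x : ℝ, (f x : ℂ) * Complex.exp (-(Complex.I * (x : ℂ) * (ξ : ℂ)))

/-- The Fourier transform of the derivative of `D(φ_k) f`. -/
def smoothBlockHat (P : DyadicPartition) (f : ℝ → ℝ) (k : ℤ) (ξ : ℝ) : ℂ :=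
  (P.φ k ξ : ℂ) * (Complex.I * (ξ : ℂ) * fourierTransform f ξ)

/-- The Fourier transform of the derivative of `D(φ_k) D(φ̃_κ) f`. -/
def sharpBlockHat (P : DyadicPartition) (f : ℝ → ℝ) (κ k : ℤ) (ξ : ℝ) : ℂ :=
  (sharpBlock κ).indicator (smoothBlockHat P f k) ξ

/-- The skeleton integral at `t` along `F` of `(x_v) ↦ e^{i ∑_v x_v ξ_v}`, obtained by iterating
the formal integral `∫^t e^{ixη} dx = e^{itη} / (iη)` from the leaves down to the roots; it is equal
to `e^{it ∑_v ξ_v} / ∏_v i(ξ_v + ∑_{w ↠ v} ξ_w)`. -/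
def skeletonKernel {n : ℕ} (F : Forest n) (t : ℝ) (ξ : Fin n → ℝ) : ℂ :=
  open Classical in
  Complex.exp (Complex.I * (t : ℂ) * ∑ v, (ξ v : ℂ)) *
    ∏ v, (Complex.I * ((ξ v : ℂ) +
      ∑ w ∈ Finset.univ.filter (fun w => F.Conn Finset.univ w v), (ξ w : ℂ)))⁻¹

/-- The integrand, on the Fourier side, of the skeleton integral at `t` along `F` of a tensor
measure `⊗_v dγ_v`, where `g v` is the Fourier transform of `γ_v'`. -/
def skeletonIntegrand {n : ℕ} (F : Forest n) (g : Fin n → ℝ → ℂ) (t : ℝ) (ξ : Fin n → ℝ) : ℂ :=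
  (∏ v, g v (ξ v)) * skeletonKernel F t ξ

/-- The skeleton integral `[SkI_F(⊗_v dγ_v)]_t`, where `g v` is the Fourier transform of `γ_v'`. -/
def skeletonIntegral {n : ℕ} (F : Forest n) (g : Fin n → ℝ → ℂ) (t : ℝ) : ℂ :=
  (((Real.sqrt (2 * Real.pi) : ℝ) : ℂ)⁻¹) ^ n * ∫ ξ : Fin n → ℝ, skeletonIntegrand F g t ξ

/-! ### The regularization algorithm -/

/-- The choice of a set `ℤ^T_reg ⊆ ℤ^{V(T)}` for every tree `T` decorated by `{1, …, d}` and
equipped with a compatible total ordering of its vertices (the values of `dom` at forests that are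
not trees are never used), with no restriction for the tree with one vertex. -/
structure RegDomains (d : ℕ) where
  dom : ∀ {n : ℕ}, Forest n → (Fin n → Fin d) → Set (Fin n → ℤ)
  dom_one : ∀ (T : Forest 1) (ℓ : Fin 1 → Fin d), dom T ℓ = Set.univ

open Classical in
/-- The projected regularized skeleton integral
`[ℛ^{k} SkI_T(⊗_v D(φ̃_{κ_v}) Γ(ℓ(v)))]_t` along a tree `T`. -/
def regSkeleton {d : ℕ} (P : DyadicPartition) (Z : RegDomains d) (Γ : Fin d → ℝ → ℝ) {n : ℕ}
    (T : Forest n) (ℓ : Fin n → Fin d) (κ k : Fin n → ℤ) (t : ℝ) : ℂ :=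
  if k ∈ Z.dom T ℓ then
    skeletonIntegral T (fun v => sharpBlockHat P (Γ (ℓ v)) (κ v) (k v)) t
  else 0

/-- The same quantity along the subtree of `F` with vertex set `S`. -/
def regSkeletonTree {d : ℕ} (P : DyadicPartition) (Z : RegDomains d) (Γ : Fin d → ℝ → ℝ) {n : ℕ}
    (F : Forest n) (ℓ : Fin n → Fin d) (κ k : Fin n → ℤ) (S : Finset (Fin n)) (t : ℝ) : ℂ :=
  regSkeleton P Z Γ (F.restrict S) (fun v => ℓ (S.orderEmbOfFin rfl v))
    (fun v => κ (S.orderEmbOfFin rfl v)) (fun v => k (S.orderEmbOfFin rfl v)) t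

/-- The same quantity along the sub-forest of `F` with vertex set `S`: the product over its tree
components. -/
def regSkeletonForest {d : ℕ} (P : DyadicPartition) (Z : RegDomains d) (Γ : Fin d → ℝ → ℝ) {n : ℕ}
    (F : Forest n) (ℓ : Fin n → Fin d) (κ k : Fin n → ℤ) (S : Finset (Fin n)) (t : ℝ) : ℂ :=
  ∏ r ∈ F.roots S, regSkeletonTree P Z Γ F ℓ κ k (F.comp S r) t

/-- The regularized projected tree integral `[ℛ^{k} I_T(⊗_v D(φ̃_{κ_v}) Γ(ℓ(v)))]_{ts}`, for the
subtree `T` of `F` with vertex set `S`, by recursion over admissible cuts. -/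
def regTreeIntegral {d : ℕ} (P : DyadicPartition) (Z : RegDomains d) (Γ : Fin d → ℝ → ℝ) {n : ℕ}
    (F : Forest n) (ℓ : Fin n → Fin d) (κ k : Fin n → ℤ) (t s : ℝ) (S : Finset (Fin n)) : ℂ :=
  regSkeletonTree P Z Γ F ℓ κ k S t - regSkeletonTree P Z Γ F ℓ κ k S s -
    ∑ c ∈ (F.cuts S).attach,
      regTreeIntegral P Z Γ F ℓ κ k t s (F.roo S c) *
        regSkeletonForest P Z Γ F ℓ κ k (F.lea S c) s
termination_by S.card
decreasing_by exact F.card_roo_lt c.2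

/-- Extension of the previous definition to the forest `F`, by multiplicativity. -/
def regForestIntegral {d : ℕ} (P : DyadicPartition) (Z : RegDomains d) (Γ : Fin d → ℝ → ℝ) {n : ℕ}
    (F : Forest n) (ℓ : Fin n → Fin d) (κ k : Fin n → ℤ) (t s : ℝ) : ℂ :=
  ∏ r ∈ F.roots Finset.univ, regTreeIntegral P Z Γ F ℓ κ k t s (F.comp Finset.univ r)

/-- `κ ∈ U_>` for the total ordering of `Fin n`. -/
def FourierOrdered {n : ℕ} (κ : Fin n → ℤ) : Prop := ∀ v w, v < w → |κ v| ≤ |κ w|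

/-- The number `|Σ_κ|` of permutations `τ` such that `|κ_{τ(j)}| = |κ_j|` for all `j`. -/
def symCount {n : ℕ} (κ : Fin n → ℤ) : ℕ :=
  Nat.card {τ : Equiv.Perm (Fin n) // ∀ j, |κ (τ j)| = |κ j|}

open Classical in
/-- The term of index `(κ, k)` of the series `[ℛ I_F(𝒫̃⁺Γ)]_{ts}`. -/
def regIntegralTerm {d : ℕ} (P : DyadicPartition) (Z : RegDomains d) (Γ : Fin d → ℝ → ℝ) {n : ℕ}
    (F : Forest n) (ℓ : Fin n → Fin d) (t s : ℝ) (p : (Fin n → ℤ) × (Fin n → ℤ)) : ℂ :=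
  if FourierOrdered p.1 then
    ((symCount p.1 : ℕ) : ℂ)⁻¹ * regForestIntegral P Z Γ F ℓ p.1 p.2 t s
  else 0

/-- `[ℛ I_F(𝒫̃⁺ ⊗_v Γ(ℓ(v)))]_{ts}`. -/
def regIntegral {d : ℕ} (P : DyadicPartition) (Z : RegDomains d) (Γ : Fin d → ℝ → ℝ) {n : ℕ}
    (F : Forest n) (ℓ : Fin n → Fin d) (t s : ℝ) : ℂ :=
  ∑' p : (Fin n → ℤ) × (Fin n → ℤ), regIntegralTerm P Z Γ F ℓ t s p

/-- The regularized rough path `[ℛ𝚪^n(i_1, …, i_n)]_{ts}`, where `w = [i_1, …, i_n]`. -/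
def regRoughPath {d : ℕ} (P : DyadicPartition) (Z : RegDomains d) (Γ : Fin d → ℝ → ℝ)
    (w : List (Fin d)) (t s : ℝ) : ℂ :=
  ∑ σ : Equiv.Perm (Fin w.length), ∑ c ∈ (splitRanks σ).powerset,
    (-1) ^ c.card * regIntegral P Z Γ (permForest σ c) (fun j => w.get (σ j)) t s

open Classical in
/-- The absolute convergence condition on the domains, for the path `Γ`: for every tree `T`, the
Fourier integrals `[SkI_T(𝒫^{k}Γ)]_t`, `k ∈ ℤ^T_reg`, converge absolutely, and the
series `[ℛ SkI_T(𝒫̃⁺Γ)]_t` of projected regularized skeleton integrals converges absolutely. -/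
def AbsConvergence {d : ℕ} (P : DyadicPartition) (Z : RegDomains d) (Γ : Fin d → ℝ → ℝ) : Prop :=
  ∀ (n : ℕ) (T : Forest n) (ℓ : Fin n → Fin d) (t : ℝ), T.IsTree →
    (∀ k ∈ Z.dom T ℓ,
      Integrable (skeletonIntegrand T (fun v => smoothBlockHat P (Γ (ℓ v)) (k v)) t)) ∧
    Summable fun p : (Fin n → ℤ) × (Fin n → ℤ) =>
      if FourierOrdered p.1 then regSkeleton P Z Γ T ℓ p.1 p.2 t else 0

end

/-- The shuffles of two words, listed with multiplicity. -/
def shuffles {A : Type*} : List A → List A → List (List A)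
  | [], v => [v]
  | a :: u, [] => [a :: u]
  | a :: u, b :: v =>
      (shuffles u (b :: v)).map (List.cons a) ++ (shuffles (a :: u) v).map (List.cons b)
termination_by u v => u.length + v.length

end FourierNormalOrdering

open FourierNormalOrdering

/-! The argument is purely algebraic once absolute convergence is known, and it rests on three
independent facts.

Chen for one forest. On functions of sub-forests, let convolution be the sum over all ways to cut a
sub-forest into a lower part and its complement. The recursive definition of the regularized
integral, moved to one side, says that I^{ts} * S^s = S^t, where S is the regularized skeleton
integral (`conv_regSubforestIntegral`). Convolution is associative, and S can be cancelled on the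
right because it equals 1 on the empty set. Hence I^{ts} = I^{tu} * I^{us}
(`regSubforestIntegral_chen`), whatever the values of S on trees are. This is why the regularization
domains are arbitrary.

Combinatorics of permutation graphs. Read σ as the word σ⁻¹(1) ... σ⁻¹(n) of ranks. The parent of a
letter in a forest of the graph is its nearest smaller letter, to the left with sign + or to the
right with sign - (`sum_permForest`). The largest letter is invisible to the others, and its parent
is its left neighbour minus its right neighbour (`permSum_append_cons`). By induction on the largest
letter, shuffling words corresponds to taking the disjoint union of forests (`sum_shuffles_permSum`,
a telescoping sum), and cutting forests corresponds to deconcatenating words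
(`permSum_sum_lowerSets`).

Sums over frequencies. In the definition each σ has its own sum over ordered κ. After relabelling, a
fixed unordered κ collects exactly the σ that order it, with weight 1/|Σ_κ|. There are |Σ_κ| of
them, so the contribution of κ is a uniform average (`hasSum_roughPathTerm`). The orderings induced
on two complementary sets of positions are independent and uniform (`average_mul`), so a product of
two such series is again a series of averages over orderings of all the positions. Both properties
are then checked for fixed κ, k and σ, where they reduce to the first two facts.

Absolute convergence on trees passes to forests by products, and to I by solving I^{ts} * S^s = S^t
for its top term. -/

namespace FourierNormalOrdering

/-! ### Signed sums of forests attached to words -/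

section Words

variable {V : Type*} [LinearOrder V]

/-- The nearest letter to the left of `v` in the word `L` that is smaller than `v`. -/
def leftParent (L : List V) (v : V) : Option V :=
  (L.takeWhile (fun x => decide (x ≠ v))).reverse.find? (fun x => decide (x < v))

/-- The nearest letter to the right of `v` in the word `L` that is smaller than `v`. -/
def rightParent (L : List V) (v : V) : Option V :=
  (L.dropWhile (fun x => decide (x ≠ v))).find? (fun x => decide (x < v))

/-- The parent function equal to `rightParent` on `c`, to `leftParent` at the other letters of `L`,
and to `p` outside of `L`. -/
def wordParent (L : List V) (c : Finset V) (p : V → Option V) (v : V) : Option V :=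
  if v ∈ L then if v ∈ c then rightParent L v else leftParent L v else p v

/-- The letters of `L` with a smaller letter to their right. -/
def splitLetters (L : List V) : Finset V :=
  L.toFinset.filter fun v => (rightParent L v).isSome

/-- The signed sum of the values of `f` on the forests attached to the word `L`. -/
def permSum (L : List V) (f : (V → Option V) → ℂ) (p : V → Option V) : ℂ :=
  ∑ c ∈ (splitLetters L).powerset, (-1) ^ c.card * f (wordParent L c p)

/-- Attach the vertex `v` to `o₁`, minus attach it to `o₂` if `o₂` is a vertex. -/
def attach (v : V) (o₁ o₂ : Option V) (f : (V → Option V) → ℂ) (p : V → Option V) : ℂ :=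
  f (Function.update p v o₁) - o₂.elim 0 fun y => f (Function.update p v (some y))

/-- The search for a letter smaller than `u` skips `v`, which exceeds every other letter. -/
theorem leftParent_append_cons_of_mem {A B : List V} {v u : V}
    (hv : ∀ x ∈ A ++ B, x < v) (hu : u ∈ A ++ B) :
    leftParent (A ++ v :: B) u = leftParent (A ++ B) u := by
  unfold leftParent
  by_cases hA : u ∈ A
  · obtain ⟨X, Y, rfl⟩ := List.append_of_mem hA
    simp only [List.append_assoc, List.cons_append, List.takeWhile_append]
    split_ifs <;> simp
  · have hlt := hv u hu
    have h1 : ∀ a ∈ A, decide (a ≠ u) = true := by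
      intro a ha
      simp only [decide_eq_true_eq]
      rintro rfl
      exact hA ha
    rw [List.takeWhile_append_of_pos h1, List.takeWhile_append_of_pos h1,
      List.takeWhile_cons_of_pos (by simpa using hlt.ne')]
    simp [List.find?_append, hlt.le]

theorem rightParent_append_cons_of_mem {A B : List V} {v u : V} (hnd : (A ++ B).Nodup)
    (hv : ∀ x ∈ A ++ B, x < v) (hu : u ∈ A ++ B) :
    rightParent (A ++ v :: B) u = rightParent (A ++ B) u := by
  unfold rightParent
  have hlt := hv u hu
  by_cases hA : u ∈ A
  · obtain ⟨X, Y, rfl⟩ := List.append_of_mem hA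
    have hX : ∀ a ∈ X, decide (a ≠ u) = true := by
      intro a ha
      simp only [decide_eq_true_eq]
      rintro rfl
      simp only [List.append_assoc, List.cons_append, List.nodup_append] at hnd
      exact hnd.2.2 a ha a (by simp) rfl
    simp only [List.append_assoc, List.cons_append]
    rw [List.dropWhile_append_of_pos hX, List.dropWhile_append_of_pos hX,
      List.dropWhile_cons_of_neg (by simp), List.dropWhile_cons_of_neg (by simp)]
    simp [List.find?_append, not_lt.2 hlt.le]
  · have h1 : ∀ a ∈ A, decide (a ≠ u) = true := by
      intro a ha
      simp only [decide_eq_true_eq]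
      rintro rfl
      exact hA ha
    rw [List.dropWhile_append_of_pos h1, List.dropWhile_append_of_pos h1,
      List.dropWhile_cons_of_pos (by simpa using hlt.ne')]

/-- Every other letter is smaller than `v`, so the search stops at the adjacent letter, if there is
one. -/
theorem leftParent_append_cons_self {A B : List V} {v : V} (hv : ∀ x ∈ A ++ B, x < v) :
    leftParent (A ++ v :: B) v = A.getLast? := by
  unfold leftParent
  have h1 : ∀ a ∈ A, decide (a ≠ v) = true := by
    intro a ha
    simpa using (hv a (by simp [ha])).ne
  rw [List.takeWhile_append_of_pos h1, List.takeWhile_cons_of_neg (by simp), List.append_nil]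
  rcases List.eq_nil_or_concat A with rfl | ⟨X, y, rfl⟩
  · rfl
  · have : y < v := hv y (by simp)
    simp [this]

theorem rightParent_append_cons_self {A B : List V} {v : V} (hv : ∀ x ∈ A ++ B, x < v) :
    rightParent (A ++ v :: B) v = B.head? := by
  unfold rightParent
  have h1 : ∀ a ∈ A, decide (a ≠ v) = true := by
    intro a ha
    simpa using (hv a (by simp [ha])).ne
  rw [List.dropWhile_append_of_pos h1, List.dropWhile_cons_of_neg (by simp),
    List.find?_cons_of_neg (by simp)]
  rcases B with _ | ⟨y, X⟩
  · rfl
  · have : y < v := hv y (by simp)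
    simp [this]

theorem leftParent_spec {L : List V} {v w : V} (h : leftParent L v = some w) : w ∈ L ∧ w < v := by
  unfold leftParent at h
  have h1 := List.mem_of_find?_eq_some h
  have h2 := List.find?_some h
  rw [List.mem_reverse] at h1
  exact ⟨(List.takeWhile_sublist _).subset h1, by simpa using h2⟩

theorem rightParent_spec {L : List V} {v w : V} (h : rightParent L v = some w) :
    w ∈ L ∧ w < v := by
  unfold rightParent at h
  have h1 := List.mem_of_find?_eq_some h
  have h2 := List.find?_some h
  exact ⟨(List.dropWhile_sublist _).subset h1, by simpa using h2⟩

theorem wordParent_of_not_mem {L : List V} {v : V} (h : v ∉ L) (c : Finset V)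
    (p : V → Option V) : wordParent L c p v = p v := if_neg h

theorem wordParent_spec {L : List V} {v w : V} (hv : v ∈ L) {c : Finset V} {p : V → Option V}
    (h : wordParent L c p v = some w) : w ∈ L ∧ w < v := by
  simp only [wordParent, hv, if_true] at h
  split_ifs at h
  · exact rightParent_spec h
  · exact leftParent_spec h

theorem permSum_nil (f : (V → Option V) → ℂ) (p : V → Option V) : permSum [] f p = f p := by
  have : wordParent [] ∅ p = p := funext fun v => wordParent_of_not_mem (by simp) _ _
  simp [permSum, splitLetters, this]

theorem permSum_congr {L : List V} {f g : (V → Option V) → ℂ} {p : V → Option V}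
    (h : ∀ c, f (wordParent L c p) = g (wordParent L c p)) : permSum L f p = permSum L g p :=
  Finset.sum_congr rfl fun c _ => by rw [h c]

/-- This recursion drives all inductions on words. The largest letter leaves the other parents
unchanged and hangs from one of its two neighbours. It can be split, with a minus sign, exactly when
it has a right neighbour. Without a left neighbour it becomes a root. -/
theorem permSum_append_cons {A B : List V} {v : V} (hnd : (A ++ B).Nodup)
    (hv : ∀ x ∈ A ++ B, x < v) (f : (V → Option V) → ℂ) (p : V → Option V) :
    permSum (A ++ v :: B) f p = permSum (A ++ B) (attach v A.getLast? B.head? f) p := by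
  have hvn : v ∉ A ++ B := fun h => (hv v h).false
  have hmem : ∀ u, u ∈ A ++ v :: B ↔ u = v ∨ u ∈ A ++ B := by
    intro u; simp only [List.mem_append, List.mem_cons]; tauto
  have hvs : v ∉ splitLetters (A ++ B) := by
    simp only [splitLetters, Finset.mem_filter, List.mem_toFinset]
    exact fun h => hvn h.1
  have key1 : ∀ c : Finset V, v ∉ c → wordParent (A ++ v :: B) c p =
      Function.update (wordParent (A ++ B) c p) v A.getLast? := by
    intro c hc
    funext u
    by_cases huv : u = v
    · subst huv
      simp [wordParent, hc, leftParent_append_cons_self hv]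
    · rw [Function.update_of_ne huv]
      by_cases hu : u ∈ A ++ B
      · simp only [wordParent, hmem, hu, or_true, if_true,
          leftParent_append_cons_of_mem hv hu, rightParent_append_cons_of_mem hnd hv hu]
      · simp only [wordParent, hmem, huv, hu, or_false, if_false]
  have key2 : ∀ c : Finset V, wordParent (A ++ v :: B) (insert v c) p =
      Function.update (wordParent (A ++ B) c p) v B.head? := by
    intro c
    funext u
    by_cases huv : u = v
    · subst huv
      simp [wordParent, rightParent_append_cons_self hv]
    · rw [Function.update_of_ne huv]
      by_cases hu : u ∈ A ++ B
      · simp only [wordParent, hmem, hu, or_true, if_true, Finset.mem_insert, huv, false_or,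
          leftParent_append_cons_of_mem hv hu, rightParent_append_cons_of_mem hnd hv hu]
      · simp only [wordParent, hmem, huv, hu, or_false, if_false]
  -- The subsets `c` then divide according to whether they contain `v`, and those that do acquire
  -- one more sign.
  have hsplit : splitLetters (A ++ v :: B) =
      if B.head?.isSome then insert v (splitLetters (A ++ B)) else splitLetters (A ++ B) := by
    ext u
    by_cases huv : u = v
    · subst huv
      have : u ∈ splitLetters (A ++ u :: B) ↔ B.head?.isSome := by
        simp [splitLetters, rightParent_append_cons_self hv]
      rw [this]
      split_ifs with h
      · simp [h]
      · simp [h, hvs]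
    · have : u ∈ splitLetters (A ++ v :: B) ↔ u ∈ splitLetters (A ++ B) := by
        simp only [splitLetters, Finset.mem_filter, List.mem_toFinset, hmem, huv, false_or]
        refine and_congr_right fun hu => ?_
        rw [rightParent_append_cons_of_mem hnd hv hu]
      rw [this]
      split_ifs with h
      · simp [huv]
      · rfl
  have hvc : ∀ c ∈ (splitLetters (A ++ B)).powerset, v ∉ c := fun c hc hm =>
    hvs (Finset.mem_powerset.1 hc hm)
  unfold permSum
  rw [hsplit]
  rcases hB : B.head? with _ | y
  · simp only [Option.isSome_none, Bool.false_eq_true, if_false, attach, Option.elim_none,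
      sub_zero]
    exact Finset.sum_congr rfl fun c hc => by rw [key1 c (hvc c hc)]
  · simp only [Option.isSome_some, if_true, attach, Option.elim_some]
    rw [Finset.sum_powerset_insert hvs, ← Finset.sum_add_distrib]
    refine Finset.sum_congr rfl fun c hc => ?_
    rw [key1 c (hvc c hc), key2 c, Finset.card_insert_of_notMem (hvc c hc), hB]
    ring

/-! ### Linearity and commutation of signed sums over words. -/

theorem wordParent_update_of_not_mem {M : List V} {v : V} (hv : v ∉ M) (c : Finset V)
    (p : V → Option V) (o : Option V) :
    wordParent M c (Function.update p v o) = Function.update (wordParent M c p) v o := by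
  funext u
  by_cases huv : u = v
  · subst huv
    simp [wordParent, hv]
  · simp [wordParent, huv]

theorem permSum_update_of_not_mem {M : List V} {v : V} (hv : v ∉ M)
    (f : (V → Option V) → ℂ) (p : V → Option V) (o : Option V) :
    permSum M f (Function.update p v o) = permSum M (fun q => f (Function.update q v o)) p := by
  simp only [permSum, wordParent_update_of_not_mem hv]

theorem permSum_sub (L : List V) (f g : (V → Option V) → ℂ) (p : V → Option V) :
    permSum L (fun q => f q - g q) p = permSum L f p - permSum L g p := by
  simp only [permSum, mul_sub, Finset.sum_sub_distrib]

theorem permSum_add (L : List V) (f g : (V → Option V) → ℂ) (p : V → Option V) :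
    permSum L (fun q => f q + g q) p = permSum L f p + permSum L g p := by
  simp only [permSum, mul_add, Finset.sum_add_distrib]

theorem permSum_const_mul (L : List V) (a : ℂ) (f : (V → Option V) → ℂ) (p : V → Option V) :
    permSum L (fun q => a * f q) p = a * permSum L f p := by
  simp only [permSum, Finset.mul_sum]
  exact Finset.sum_congr rfl fun c _ => by ring

theorem permSum_mul_const (L : List V) (a : ℂ) (f : (V → Option V) → ℂ) (p : V → Option V) :
    permSum L (fun q => f q * a) p = permSum L f p * a := by
  simp only [permSum, Finset.sum_mul]
  exact Finset.sum_congr rfl fun c _ => by ring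

theorem attach_permSum {M : List V} {v : V} (hv : v ∉ M) (o₁ o₂ : Option V)
    (f : (V → Option V) → ℂ) :
    attach v o₁ o₂ (permSum M f) = permSum M (attach v o₁ o₂ f) := by
  funext p
  unfold attach
  rcases o₂ with _ | y
  · simp only [Option.elim_none, sub_zero, permSum_update_of_not_mem hv]
  · simp only [Option.elim_some, permSum_update_of_not_mem hv, permSum_sub]

/-- The parents of the letters of one word depend on that word only, and the two words overwrite the
parent function at disjoint places. -/
theorem permSum_comm {L M : List V} (h : L.Disjoint M) (f : (V → Option V) → ℂ)
    (p : V → Option V) : permSum L (permSum M f) p = permSum M (permSum L f) p := by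
  simp only [permSum, Finset.mul_sum]
  rw [Finset.sum_comm]
  refine Finset.sum_congr rfl fun c _ => Finset.sum_congr rfl fun c' _ => ?_
  have : wordParent M c (wordParent L c' p) = wordParent L c' (wordParent M c p) := by
    funext v
    by_cases hM : v ∈ M
    · have hL : v ∉ L := fun hL => h hL hM
      simp [wordParent, hM, hL]
    · simp [wordParent, hM]
  rw [this]
  ring

/-- Induction on duplicate-free words by insertion of the largest letter. -/
@[elab_as_elim]
theorem nodup_max_induction {Q : List V → Prop} (nil : Q [])
    (insert_max : ∀ A v B, (A ++ B).Nodup → (∀ x ∈ A ++ B, x < v) → Q (A ++ B) →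
      Q (A ++ v :: B)) (L : List V) (hL : L.Nodup) : Q L := by
  induction hn : L.length generalizing L with
  | zero => rw [List.length_eq_zero_iff.1 hn]; exact nil
  | succ n ih =>
    have hne : L.toFinset.Nonempty := by
      rw [List.toFinset_nonempty_iff]
      rintro rfl
      simp at hn
    have hmax := Finset.max'_mem _ hne
    rw [List.mem_toFinset] at hmax
    have hle : ∀ x ∈ L, x ≤ L.toFinset.max' hne := fun x hx =>
      Finset.le_max' _ _ (List.mem_toFinset.2 hx)
    generalize L.toFinset.max' hne = v at hmax hle
    obtain ⟨A, B, rfl⟩ := List.append_of_mem hmax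
    have hnd := List.nodup_middle.1 hL
    rw [List.nodup_cons] at hnd
    refine insert_max A v B hnd.2 (fun x hx => lt_of_le_of_ne (hle x ?_) ?_)
      (ih _ hnd.2 (by simp at hn ⊢; omega))
    · simp only [List.mem_append, List.mem_cons] at hx ⊢; tauto
    · rintro rfl; exact hnd.1 hx

/-- Transport of `permSum` along an increasing renumbering. -/
theorem permSum_map {U : Type*} [LinearOrder U] (r : U ↪o V) (L : List U) (hL : L.Nodup)
    (f : (V → Option V) → ℂ) (g : (U → Option U) → ℂ) (p : V → Option V) (q : U → Option U)
    (h : ∀ p' q', (∀ u ∈ L, p' (r u) = (q' u).map r) → (∀ x, x ∉ L.map r → p' x = p x) →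
      f p' = g q') :
    permSum (L.map r) f p = permSum L g q := by
  revert f g
  refine nodup_max_induction ?_ (fun A v B hnd hv ih => ?_) L hL
  · intro f g h
    simp only [List.map_nil, permSum_nil]
    exact h p q (by simp) (fun _ _ => rfl)
  · intro f g h
    have hnd' : (A.map r ++ B.map r).Nodup := by
      rw [← List.map_append]; exact hnd.map r.injective
    have hv' : ∀ x ∈ A.map r ++ B.map r, x < r v := by
      rw [← List.map_append]
      intro x hx
      obtain ⟨u, hu, rfl⟩ := List.mem_map.1 hx
      exact r.lt_iff_lt.2 (hv u hu)
    have hvn : v ∉ A ++ B := fun h => (hv v h).false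
    rw [List.map_append, List.map_cons, permSum_append_cons hnd' hv', permSum_append_cons hnd hv,
      ← List.map_append]
    refine ih _ _ fun p' q' h1 h2 => ?_
    have key : ∀ o : Option U, f (Function.update p' (r v) (o.map r)) =
        g (Function.update q' v o) := by
      intro o
      refine h _ _ (fun u hu => ?_) (fun x hx => ?_)
      · by_cases huv : u = v
        · subst huv; simp
        · rw [Function.update_of_ne huv, Function.update_of_ne (r.injective.ne huv)]
          refine h1 u ?_
          simp only [List.mem_append, List.mem_cons] at hu ⊢; tauto
      · have hx' : x ≠ r v ∧ x ∉ (A ++ B).map r := by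
          constructor
          · rintro rfl; exact hx (by simp)
          · intro hh; apply hx
            simp only [List.map_append, List.mem_append, List.map_cons, List.mem_cons] at hh ⊢
            tauto
        rw [Function.update_of_ne hx'.1]
        exact h2 x hx'.2
    unfold attach
    rw [List.getLast?_map, List.head?_map, key]
    congr 1
    rcases B.head? with _ | y
    · rfl
    · exact key (some y)

end Words

/-! ### Shuffles -/

theorem shuffles_nil_left {A : Type*} (v : List A) : shuffles [] v = [v] := by
  cases v <;> simp [shuffles]

theorem shuffles_nil_right {A : Type*} (u : List A) : shuffles u [] = [u] := by
  cases u <;> simp [shuffles]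

theorem shuffles_cons_cons {A : Type*} (a : A) (u : List A) (b : A) (v : List A) :
    shuffles (a :: u) (b :: v) =
      (shuffles u (b :: v)).map (List.cons a) ++ (shuffles (a :: u) v).map (List.cons b) := by
  rw [shuffles]

theorem shuffles_comm {A : Type*} (u v : List A) : (shuffles u v).Perm (shuffles v u) := by
  induction u generalizing v with
  | nil => rw [shuffles_nil_left, shuffles_nil_right]
  | cons a u ihu =>
    induction v with
    | nil => rw [shuffles_nil_left, shuffles_nil_right]
    | cons b v ihv =>
      rw [shuffles_cons_cons, shuffles_cons_cons]
      exact (((ihu (b :: v)).map _).append (ihv.map _)).trans List.perm_append_comm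

theorem map_shuffles {A B : Type*} (g : A → B) (u v : List A) :
    shuffles (u.map g) (v.map g) = (shuffles u v).map (List.map g) := by
  induction u generalizing v with
  | nil => simp [shuffles_nil_left]
  | cons a u ihu =>
    induction v with
    | nil => simp [shuffles_nil_right]
    | cons b v ihv =>
      rw [List.map_cons, List.map_cons, shuffles_cons_cons, shuffles_cons_cons,
        ← List.map_cons (f := g) (a := b), ihu, ← List.map_cons (f := g) (a := a) (l := u), ihv]
      simp [List.map_map, Function.comp_def]

theorem perm_of_mem_shuffles {A : Type*} {u v x : List A} (hx : x ∈ shuffles u v) :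
    x.Perm (u ++ v) := by
  induction u generalizing v x with
  | nil => rw [shuffles_nil_left, List.mem_singleton] at hx; simp [hx]
  | cons a u ihu =>
    induction v generalizing x with
    | nil => rw [shuffles_nil_right, List.mem_singleton] at hx; simp [hx]
    | cons b v ihv =>
      rw [shuffles_cons_cons, List.mem_append, List.mem_map, List.mem_map] at hx
      rcases hx with ⟨y, hy, rfl⟩ | ⟨y, hy, rfl⟩
      · exact (ihu hy).cons a
      · exact ((ihv hy).cons b).trans List.perm_middle.symm

section Words

variable {V : Type*} [LinearOrder V]

/-- Telescoping: inserting the letter `v` at all places between two consecutive letters of `A ++ B`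
while shuffling with `M`. -/
theorem sum_shuffles_insert (v : V) (h : List V → ℂ) (G : List V → Option V → ℂ)
    (hG : ∀ X Y, (∀ x ∈ X ++ Y, x < v) →
      h (X ++ v :: Y) = G (X ++ Y) X.getLast? -
        Y.head?.elim 0 fun y => G (X ++ Y) (some y))
    (A B M pre : List V) (hv : ∀ x ∈ pre ++ A ++ B ++ M, x < v) :
    ((shuffles (A ++ v :: B) M).map fun L => h (pre ++ L)).sum =
      ((shuffles (A ++ B) M).map fun L => G (pre ++ L) (pre ++ A).getLast? -
        B.head?.elim 0 fun y => G (pre ++ L) (some y)).sum := by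
  have sum_sub : ∀ (l : List (List V)) (f g : List V → ℂ),
      (l.map fun L => f L - g L).sum = (l.map f).sum - (l.map g).sum := by
    intro l f g
    induction l with
    | nil => simp
    | cons a l ih => simp only [List.map_cons, List.sum_cons, ih]; ring
  induction A generalizing M pre with
  | nil =>
    rw [List.nil_append, List.nil_append]
    induction M generalizing pre with
    | nil =>
      rw [shuffles_nil_right, shuffles_nil_right]
      simp only [List.map_cons, List.map_nil, List.sum_cons, List.sum_nil, add_zero,
        List.append_nil]
      exact hG pre B (by simpa using hv)
    | cons b M ihM =>
      -- Either `v` comes immediately after `pre`, which is this identity, or `b` comes next and the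
      -- induction hypothesis `h2` applies with `pre ++ [b]`.
      have hsub : ∀ L ∈ shuffles B (b :: M), h (pre ++ v :: L) = G (pre ++ L) pre.getLast? -
          L.head?.elim 0 fun y => G (pre ++ L) (some y) := by
        intro L hL
        refine hG pre L fun x hx => hv x ?_
        have := (perm_of_mem_shuffles hL).mem_iff (a := x)
        simp only [List.mem_append, List.append_nil] at this hx ⊢
        tauto
      have h2 := ihM (pre ++ [b]) (by
        intro x hx
        refine hv x ?_
        simp only [List.mem_append, List.mem_cons, List.append_nil] at hx ⊢
        simp only [List.not_mem_nil, or_false] at hx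
        tauto)
      simp only [List.append_nil, List.getLast?_append, List.getLast?_singleton, Option.some_or,
        List.append_assoc, List.singleton_append] at h2
      rw [shuffles_cons_cons, List.map_append, List.sum_append, List.map_map, List.map_map]
      simp only [Function.comp_def]
      rw [h2, List.map_congr_left hsub]
      simp only [sum_sub, List.append_nil]
      -- The words `L` that start with `b` contribute minus "`v` attached to `b`" in the first case,
      -- and this cancels the plus term of `h2`. What survives is attachment to the end of `pre`
      -- minus attachment to the head of `B`.
      rcases B with _ | ⟨a, B⟩
      · simp [shuffles_nil_left]
      · rw [shuffles_cons_cons]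
        simp [List.map_map, Function.comp_def]
        ring
  | cons a A ihA =>
    induction M generalizing pre with
    | nil =>
      rw [shuffles_nil_right, shuffles_nil_right]
      simp only [List.map_cons, List.map_nil, List.sum_cons, List.sum_nil, add_zero]
      have := hG (pre ++ (a :: A)) B (by simpa using hv)
      simpa using this
    | cons b M ihM =>
      have h1 := ihA (b :: M) (pre ++ [a]) (by
        intro x hx
        refine hv x ?_
        simp only [List.mem_append, List.mem_cons] at hx ⊢
        simp only [List.not_mem_nil, or_false] at hx
        tauto)
      have h2 := ihM (pre ++ [b]) (by
        intro x hx
        refine hv x ?_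
        simp only [List.mem_append, List.mem_cons] at hx ⊢
        simp only [List.not_mem_nil, or_false] at hx
        tauto)
      simp only [List.append_assoc, List.singleton_append] at h1 h2
      -- As `A` is non-empty, the left neighbour in the result is the last letter of `A`, whatever
      -- letters of `M` have already been placed. Nothing telescopes here.
      have hlast : (pre ++ b :: a :: A).getLast? = (pre ++ a :: A).getLast? := by
        simp [List.getLast?_append, List.getLast?_cons]
      rw [hlast] at h2
      rw [List.cons_append, List.cons_append, shuffles_cons_cons, shuffles_cons_cons,
        List.map_append, List.map_append, List.sum_append, List.sum_append, List.map_map,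
        List.map_map, List.map_map, List.map_map]
      simp only [Function.comp_def]
      rw [h1]
      simp only [List.cons_append] at h2
      rw [h2]

/-- The shuffle property of permutation graphs. -/
theorem sum_shuffles_permSum (L M : List V) (hnd : (L ++ M).Nodup) (f : (V → Option V) → ℂ)
    (p : V → Option V) :
    ((shuffles L M).map fun X => permSum X f p).sum = permSum L (permSum M f) p := by
  -- Induction step when the largest letter lies in the left word. The shuffles telescope to the
  -- same attachment of `v` that the product side gives.
  have insertion : ∀ (A B M : List V) (v : V), (A ++ v :: B ++ M).Nodup →
      (∀ x ∈ A ++ B ++ M, x < v) → ∀ f : (V → Option V) → ℂ,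
      ((shuffles (A ++ B) M).map fun X =>
        permSum X (attach v A.getLast? B.head? f) p).sum =
          permSum (A ++ B) (permSum M (attach v A.getLast? B.head? f)) p →
      ((shuffles (A ++ v :: B) M).map fun X => permSum X f p).sum =
        permSum (A ++ v :: B) (permSum M f) p := by
    intro A B M v hnd hv f ih
    have hndAB : (A ++ B).Nodup := by
      refine List.Nodup.sublist ?_ hnd
      rw [List.append_assoc]
      exact List.Sublist.append_left ((List.sublist_append_left B M).cons v) A
    have hvM : v ∉ M := fun hm => (hv v (by simp [hm])).false
    rw [permSum_append_cons hndAB (fun x hx => hv x (by simp at hx ⊢; tauto)),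
      attach_permSum hvM, ← ih]
    -- The telescoping lemma quantifies over all words, while the insertion formula needs distinct
    -- letters. Setting the value to zero on words with repetitions makes its hypothesis hold
    -- everywhere.
    have hX : ∀ X ∈ shuffles (A ++ v :: B) M, permSum X f p =
        (if X.Nodup then permSum X f p else 0) := by
      intro X hX
      rw [if_pos]
      exact (perm_of_mem_shuffles hX).nodup_iff.2 hnd
    rw [List.map_congr_left hX]
    have := sum_shuffles_insert v (fun X => if X.Nodup then permSum X f p else 0)
      (fun X o => if X.Nodup then permSum X (fun q => f (Function.update q v o)) p else 0)
      (by
        intro X Y hXY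
        have hvn : v ∉ X ++ Y := fun hm => (hXY v hm).false
        have hiff : (X ++ v :: Y).Nodup ↔ (X ++ Y).Nodup := by
          rw [List.nodup_middle, List.nodup_cons]
          exact ⟨fun hh => hh.2, fun hh => ⟨hvn, hh⟩⟩
        by_cases hn : (X ++ Y).Nodup
        · simp only [hiff, hn, if_true]
          rw [permSum_append_cons hn hXY]
          unfold attach
          rcases Y.head? with _ | y
          · simp
          · simp only [Option.elim_some]
            rw [permSum_sub]
        · simp only [hiff, hn, if_false]
          rcases Y.head? with _ | y <;> simp)
      A B M [] (by simpa using hv)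
    simp only [List.nil_append] at this
    rw [this]
    refine congrArg List.sum (List.map_congr_left fun X hX => ?_)
    have hn : X.Nodup := by
      refine (perm_of_mem_shuffles hX).nodup_iff.2 (List.Nodup.sublist ?_ hnd)
      exact List.Sublist.append_right (List.Sublist.append_left (List.sublist_cons_self v B) A) M
    simp only [hn, if_true]
    unfold attach
    rcases B.head? with _ | y
    · simp
    · simp only [Option.elim_some]
      rw [permSum_sub]
  induction hn : (L ++ M).length generalizing L M f with
  | zero =>
    simp only [List.length_append, Nat.add_eq_zero_iff, List.length_eq_zero_iff] at hn
    obtain ⟨rfl, rfl⟩ := hn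
    simp [shuffles_nil_left, permSum_nil]
  | succ n ih =>
    have hne : (L ++ M).toFinset.Nonempty := by
      rw [List.toFinset_nonempty_iff]
      intro h0
      simp [h0] at hn
    have hmax := Finset.max'_mem _ hne
    rw [List.mem_toFinset] at hmax
    have hle : ∀ x ∈ L ++ M, x ≤ (L ++ M).toFinset.max' hne := fun x hx =>
      Finset.le_max' _ _ (List.mem_toFinset.2 hx)
    generalize (L ++ M).toFinset.max' hne = v at hmax hle
    rcases List.mem_append.1 hmax with hm | hm
    · obtain ⟨A, B, rfl⟩ := List.append_of_mem hm
      have hnd' : (v :: (A ++ B ++ M)).Nodup := by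
        refine (List.Perm.nodup_iff ?_).1 hnd
        rw [← List.cons_append]
        exact (List.perm_middle).append_right M
      rw [List.nodup_cons] at hnd'
      refine insertion A B M v hnd (fun x hx => lt_of_le_of_ne (hle x ?_) ?_) f
        (ih _ _ hnd'.2 _ (by simp at hn ⊢; omega))
      · simp only [List.mem_append, List.mem_cons] at hx ⊢; tauto
      · rintro rfl; exact hnd'.1 hx
    -- The largest letter lies in the right word. Both sides are symmetric in the two words, up to a
    -- permutation of the list of shuffles, so the same step applies.
    · obtain ⟨A, B, rfl⟩ := List.append_of_mem hm
      have hndc : (A ++ v :: B ++ L).Nodup := (List.perm_append_comm.nodup_iff).1 hnd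
      have hnd' : (v :: (A ++ B ++ L)).Nodup := by
        refine (List.Perm.nodup_iff ?_).1 hndc
        rw [← List.cons_append]
        exact (List.perm_middle).append_right L
      rw [List.nodup_cons] at hnd'
      have hnd'' : (L ++ (A ++ B)).Nodup := (List.perm_append_comm.nodup_iff).1 hnd'.2
      rw [((shuffles_comm L _).map _).sum_eq, permSum_comm (List.disjoint_of_nodup_append hnd)]
      refine insertion A B L v hndc (fun x hx => lt_of_le_of_ne (hle x ?_) ?_) f ?_
      · simp only [List.mem_append, List.mem_cons] at hx ⊢; tauto
      · rintro rfl; exact hnd'.1 hx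
      · rw [← ((shuffles_comm L _).map _).sum_eq,
          ← permSum_comm (List.disjoint_of_nodup_append hnd'')]
        exact ih _ _ hnd'' _ (by simp at hn ⊢; omega)

end Words

/-! ### The coproduct of permutation graphs -/

section Words

variable {V : Type*} [LinearOrder V]

/-- The subsets `R` of `S` such that, inside `S`, the parents of elements of `R` belong to `R`. -/
def lowerSets (p : V → Option V) (S : Finset V) : Finset (Finset V) :=
  S.powerset.filter fun R => ∀ v ∈ R, ∀ w ∈ S, p v = some w → w ∈ R

/-- Cut the edges that enter `R` from outside. -/
def cutParent (R : Finset V) (p : V → Option V) (v : V) : Option V :=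
  if v ∈ R then p v else (p v).filter fun w => decide (w ∉ R)

/-- The new vertex is a leaf, because no parent equals `v`. It may always stay outside `R`, and then
it becomes a root if its parent lies in `R`. It may join `R` only if it is a root or its parent is
in `R`. -/
theorem sum_lowerSets_update {S : Finset V} {p : V → Option V} {v : V} (hvS : v ∉ S)
    (hp : ∀ u w, p u = some w → w ∈ S) {o : Option V} (ho : ∀ w, o = some w → w ∈ S)
    (F : Finset V → (V → Option V) → ℂ) :
    ∑ R ∈ lowerSets (Function.update p v o) (insert v S),
        F R (cutParent R (Function.update p v o)) =
      ∑ R ∈ lowerSets p S,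
        (F R (Function.update (cutParent R p) v (o.filter fun w => decide (w ∉ R))) +
          if ∀ w, o = some w → w ∈ R then F (insert v R) (Function.update (cutParent R p) v o)
          else 0) := by
  have hpv : ∀ u, p u ≠ some v := fun u hu => hvS (hp u v hu)
  unfold lowerSets
  rw [Finset.sum_filter, Finset.sum_filter, Finset.sum_powerset_insert hvS,
    ← Finset.sum_add_distrib]
  refine Finset.sum_congr rfl fun R hR => ?_
  rw [Finset.mem_powerset] at hR
  have hvR : v ∉ R := fun h => hvS (hR h)
  have hne : ∀ u ∈ R, u ≠ v := fun u hu h => hvR (h ▸ hu)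
  have e1 : (∀ u ∈ R, ∀ w ∈ insert v S, Function.update p v o u = some w → w ∈ R) ↔
      ∀ u ∈ R, ∀ w ∈ S, p u = some w → w ∈ R := by
    refine forall₂_congr fun u hu => ?_
    rw [Function.update_of_ne (hne u hu)]
    constructor
    · exact fun h w hw => h w (Finset.mem_insert_of_mem hw)
    · intro h w _ hpw
      exact h w (hp u w hpw) hpw
  have e2 : (∀ u ∈ insert v R, ∀ w ∈ insert v S, Function.update p v o u = some w →
      w ∈ insert v R) ↔ (∀ u ∈ R, ∀ w ∈ S, p u = some w → w ∈ R) ∧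
        ∀ w, o = some w → w ∈ R := by
    constructor
    · intro h
      refine ⟨fun u hu w hw hpw => ?_, fun w how => ?_⟩
      · have := h u (Finset.mem_insert_of_mem hu) w (Finset.mem_insert_of_mem hw)
          (by rwa [Function.update_of_ne (hne u hu)])
        exact Finset.mem_of_mem_insert_of_ne this fun h => hvS (h ▸ hw)
      · have := h v (Finset.mem_insert_self _ _) w (Finset.mem_insert_of_mem (ho w how))
          (by rwa [Function.update_self])
        exact Finset.mem_of_mem_insert_of_ne this fun h => hvS (h ▸ ho w how)
    · rintro ⟨h1, h2⟩ u hu w hw huw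
      rcases Finset.mem_insert.1 hu with rfl | hu
      · rw [Function.update_self] at huw
        exact Finset.mem_insert_of_mem (h2 w huw)
      · rw [Function.update_of_ne (hne u hu)] at huw
        exact Finset.mem_insert_of_mem (h1 u hu w (hp u w huw) huw)
  have c1 : cutParent R (Function.update p v o) =
      Function.update (cutParent R p) v (o.filter fun w => decide (w ∉ R)) := by
    funext u
    by_cases huv : u = v
    · subst huv; simp [cutParent, hvR]
    · simp [cutParent, Function.update_of_ne huv]
  have c2 : cutParent (insert v R) (Function.update p v o) =
      Function.update (cutParent R p) v o := by
    funext u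
    by_cases huv : u = v
    · subst huv; simp [cutParent]
    · simp only [cutParent, Function.update_of_ne huv, Finset.mem_insert, huv, false_or]
      split_ifs with h
      · rfl
      · rcases hu : p u with _ | w
        · rfl
        · have : w ≠ v := fun h => hpv u (h ▸ hu)
          simp [Option.filter, this]
  rw [c1, c2]
  simp only [e1, e2]
  by_cases h1 : ∀ u ∈ R, ∀ w ∈ S, p u = some w → w ∈ R
  · by_cases h2 : ∀ w, o = some w → w ∈ R
    · rw [if_pos h1, if_pos ⟨h1, h2⟩, if_pos h1, if_pos h2]
    · rw [if_pos h1, if_neg (fun h => h2 h.2), if_pos h1, if_neg h2]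
  · rw [if_neg h1, if_neg (fun h => h1 h.1), if_neg h1, add_zero]

/-- Arranged to match `sum_splits_append`: a split strictly inside `A` or inside `B` extends
uniquely to the longer word, and the split between `A` and `B` gives two, with `v` on either side.
-/
theorem sum_splits_append_cons {V : Type*} (A B : List V) (v : V) (φ : List V → List V → ℂ) :
    ∑ j ∈ Finset.range ((A ++ v :: B).length + 1),
        φ ((A ++ v :: B).take j) ((A ++ v :: B).drop j) =
      ∑ j ∈ Finset.range A.length, φ (A.take j) (A.drop j ++ v :: B) +
        (φ A (v :: B) + φ (A ++ [v]) B) +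
        ∑ i ∈ Finset.range B.length, φ (A ++ v :: B.take (i + 1)) (B.drop (i + 1)) := by
  have hlen : (A ++ v :: B).length + 1 = A.length + (B.length + 1 + 1) := by simp; omega
  rw [hlen, Finset.sum_range_add, Finset.sum_range_succ', Finset.sum_range_succ']
  have h1 : ∀ j ∈ Finset.range A.length, φ ((A ++ v :: B).take j) ((A ++ v :: B).drop j) =
      φ (A.take j) (A.drop j ++ v :: B) := by
    intro j hj
    rw [Finset.mem_range] at hj
    rw [List.take_append_of_le_length hj.le, List.drop_append_of_le_length hj.le]
  have h2 : ∀ i, φ ((A ++ v :: B).take (A.length + (i + 1)))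
      ((A ++ v :: B).drop (A.length + (i + 1))) = φ (A ++ v :: B.take i) (B.drop i) := by
    intro i
    simp [List.take_length_add_append]
  rw [Finset.sum_congr rfl h1]
  simp only [h2]
  simp
  ring

theorem sum_splits_append {V : Type*} (A B : List V) (φ : List V → List V → ℂ) :
    ∑ j ∈ Finset.range ((A ++ B).length + 1), φ ((A ++ B).take j) ((A ++ B).drop j) =
      ∑ j ∈ Finset.range A.length, φ (A.take j) (A.drop j ++ B) + φ A B +
        ∑ i ∈ Finset.range B.length, φ (A ++ B.take (i + 1)) (B.drop (i + 1)) := by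
  have hlen : (A ++ B).length + 1 = A.length + (B.length + 1) := by simp; omega
  rw [hlen, Finset.sum_range_add, Finset.sum_range_succ']
  have h1 : ∀ j ∈ Finset.range A.length, φ ((A ++ B).take j) ((A ++ B).drop j) =
      φ (A.take j) (A.drop j ++ B) := by
    intro j hj
    rw [Finset.mem_range] at hj
    rw [List.take_append_of_le_length hj.le, List.drop_append_of_le_length hj.le]
  rw [Finset.sum_congr rfl h1]
  simp only [List.take_length_add_append, List.drop_length_add_append, add_zero, List.take_left,
    List.drop_left]
  ring

/-- The coproduct of a permutation graph is the deconcatenation of words. -/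
theorem permSum_sum_lowerSets (L : List V) (hL : L.Nodup) (F : Finset V → (V → Option V) → ℂ) :
    permSum L (fun p => ∑ R ∈ lowerSets p L.toFinset, F R (cutParent R p)) (fun _ => none) =
      ∑ j ∈ Finset.range (L.length + 1),
        permSum (L.take j) (permSum (L.drop j) (F (L.take j).toFinset)) fun _ => none := by
  revert F
  refine nodup_max_induction ?_ (fun A v B hnd hv ih => ?_) L hL
  · intro F
    have h1 : lowerSets (fun _ : V => none) ∅ = {∅} := by
      simp [lowerSets]
    have h2 : cutParent ∅ (fun _ : V => none) = fun _ => none := by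
      funext u; simp [cutParent]
    simp [permSum_nil, h1, h2]
  · intro F
    have hvn : v ∉ A ++ B := fun h => (hv v h).false
    have hvA : v ∉ A := fun h => hvn (by simp [h])
    have hvB : v ∉ B := fun h => hvn (by simp [h])
    have hvS : v ∉ (A ++ B).toFinset := by rwa [List.mem_toFinset]
    have hS : (A ++ v :: B).toFinset = insert v (A ++ B).toFinset := by
      ext u; simp only [List.mem_toFinset, List.mem_append, List.mem_cons, Finset.mem_insert]; tauto
    have hdisj := List.disjoint_of_nodup_append hnd
    rw [permSum_append_cons hnd hv, hS]
    -- `H R o` collects the two possible positions of `v` relative to the lower set `R` when the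
    -- parent of `v` is `o`.
    let H : Finset V → Option V → (V → Option V) → ℂ := fun R o q =>
      F R (Function.update q v (o.filter fun w => decide (w ∉ R))) +
        if ∀ w, o = some w → w ∈ R then F (insert v R) (Function.update q v o) else 0
    have step : ∀ c, attach v A.getLast? B.head?
        (fun p => ∑ R ∈ lowerSets p (insert v (A ++ B).toFinset), F R (cutParent R p))
          (wordParent (A ++ B) c fun _ => none) =
        ∑ R ∈ lowerSets (wordParent (A ++ B) c fun _ => none) (A ++ B).toFinset,
          (fun R q => H R A.getLast? q - B.head?.elim 0 fun y => H R (some y) q) R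
            (cutParent R (wordParent (A ++ B) c fun _ => none)) := by
      intro c
      have hp : ∀ u w, wordParent (A ++ B) c (fun _ => none) u = some w →
          w ∈ (A ++ B).toFinset := by
        intro u w h
        rw [List.mem_toFinset]
        by_cases hu : u ∈ A ++ B
        · exact (wordParent_spec hu h).1
        · rw [wordParent_of_not_mem hu] at h
          exact absurd h (by simp)
      unfold attach
      dsimp only
      rw [sum_lowerSets_update hvS hp]
      · rcases hB : B.head? with _ | y
        · simp only [Option.elim_none, sub_zero]; rfl
        · have hyB : y ∈ B := List.mem_of_mem_head? hB
          simp only [Option.elim_some]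
          rw [sum_lowerSets_update hvS hp, Finset.sum_sub_distrib]
          intro w hw
          rw [Option.some.injEq] at hw
          simp [← hw, hyB]
      · intro w hw
        simp [List.mem_of_getLast? hw]
    have step' := permSum_congr (p := fun _ => none) (L := A ++ B)
      (g := fun p => ∑ R ∈ lowerSets p (A ++ B).toFinset,
        (fun R q => H R A.getLast? q - B.head?.elim 0 fun y => H R (some y) q) R
          (cutParent R p)) step
    rw [step']
    refine ((ih fun R q => H R A.getLast? q - B.head?.elim 0 fun y => H R (some y) q).trans
      (sum_splits_append A B fun X Y => permSum X (permSum Y fun q =>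
        H X.toFinset A.getLast? q - B.head?.elim 0 fun y => H X.toFinset (some y) q)
          fun _ => none)).trans (Eq.trans ?_ (sum_splits_append_cons A B v fun X Y =>
            permSum X (permSum Y (F X.toFinset)) fun _ => none).symm)
    refine congrArg₂ (· + ·) ?_ ?_
    · refine congrArg₂ (· + ·) ?_ ?_
      -- Split strictly inside `A`: both neighbours of `v` are outside `R`, so `v` cannot join `R`
      -- and is simply inserted into the right-hand word.
      · refine Finset.sum_congr rfl fun j hj => ?_
        rw [Finset.mem_range] at hj
        generalize hX : A.take j = X
        generalize hD : A.drop j = D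
        have hA : A = X ++ D := by rw [← hX, ← hD, List.take_append_drop]
        have hDne : D ≠ [] := by
          rintro rfl
          have := List.drop_eq_nil_iff.1 hD
          omega
        have hlast : A.getLast? = D.getLast? := by
          rw [hA, List.getLast?_append]
          rcases hDl : D.getLast? with _ | z
          · exact absurd (List.getLast?_eq_none_iff.1 hDl) hDne
          · rfl
        have hXD : X.Disjoint D := List.disjoint_of_nodup_append (hA ▸ (List.nodup_append.1 hnd).1)
        have hXB : X.Disjoint B := fun x hx hxB => hdisj (by simp [hA, hx]) hxB
        have hndDB : (D ++ B).Nodup := by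
          rw [hA, List.append_assoc] at hnd
          exact (List.nodup_append.1 hnd).2.1
        have hvDB : ∀ x ∈ D ++ B, x < v := by
          intro x hx
          apply hv x
          simp only [hA, List.mem_append] at hx ⊢; tauto
        have hfun : (fun q => H X.toFinset A.getLast? q -
            B.head?.elim 0 fun y => H X.toFinset (some y) q) =
            attach v D.getLast? B.head? (F X.toFinset) := by
          funext q
          have hH : ∀ z, z ∉ X → H X.toFinset (some z) q =
              F X.toFinset (Function.update q v (some z)) := by
            intro z hz
            simp [H, hz, Option.filter]
          unfold attach
          rw [hlast]
          refine congrArg₂ (· - ·) ?_ ?_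
          · rcases hDl : D.getLast? with _ | z
            · exact absurd (List.getLast?_eq_none_iff.1 hDl) hDne
            · exact hH z fun h => hXD h (List.mem_of_getLast? hDl)
          · rcases hB : B.head? with _ | y
            · rfl
            · exact hH y fun h => hXB h (List.mem_of_mem_head? hB)
        rw [hfun]
        exact permSum_congr fun c => (permSum_append_cons hndDB hvDB _ _).symm
      -- Split between `A` and `B`: the left neighbour is in `R` and the right one is not. The three
      -- or fewer terms regroup as `v` put in front of `B` (a root, minus attachment to the head of
      -- `B`) plus `v` put at the end of `A`.
      · have hndB : ([] ++ B).Nodup := (List.nodup_append.1 hnd).2.1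
        have hndA : (A ++ []).Nodup := by rw [List.append_nil]; exact (List.nodup_append.1 hnd).1
        have hfun : (fun q => H A.toFinset A.getLast? q -
            B.head?.elim 0 fun y => H A.toFinset (some y) q) =
            fun q => attach v none B.head? (F A.toFinset) q +
              attach v A.getLast? none (F (insert v A.toFinset)) q := by
          funext q
          have h1 : H A.toFinset A.getLast? q = F A.toFinset (Function.update q v none) +
              F (insert v A.toFinset) (Function.update q v A.getLast?) := by
            rcases hAl : A.getLast? with _ | z
            · simp [H, Option.filter]
            · have := List.mem_of_getLast? hAl
              simp [H, Option.filter, this]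
          have h2 : (B.head?.elim 0 fun y => H A.toFinset (some y) q) =
              B.head?.elim 0 fun y => F A.toFinset (Function.update q v (some y)) := by
            rcases hB : B.head? with _ | y
            · rfl
            · have hyA : y ∉ A := fun h => hdisj h (List.mem_of_mem_head? hB)
              simp [H, hyA, Option.filter]
          rw [h1, h2]
          unfold attach
          simp only [Option.elim_none]
          ring
        rw [hfun]
        have hsp : permSum B (fun q => attach v none B.head? (F A.toFinset) q +
            attach v A.getLast? none (F (insert v A.toFinset)) q) =
            fun q => permSum B (attach v none B.head? (F A.toFinset)) q +
              permSum B (attach v A.getLast? none (F (insert v A.toFinset))) q :=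
          funext fun q => permSum_add _ _ _ _
        rw [hsp, permSum_add]
        refine congrArg₂ (· + ·) ?_ ?_
        · refine permSum_congr fun c => ?_
          have := permSum_append_cons (A := []) (B := B) (v := v) hndB
            (fun x hx => hv x (by simp at hx ⊢; tauto)) (F A.toFinset)
            (wordParent A c fun _ => none)
          simpa using this.symm
        · rw [← attach_permSum hvB]
          have := permSum_append_cons (A := A) (B := []) (v := v) hndA
            (fun x hx => hv x (by simp at hx ⊢; tauto))
            (permSum B (F (insert v A.toFinset))) (fun _ => none)
          have hins : (A ++ [v]).toFinset = insert v A.toFinset := by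
            ext u; simp
          rw [hins, this]
          simp
    -- Split inside `B`: both neighbours are in `R`, so the terms where `v` is cut off as a root
    -- occur with opposite signs and cancel. What remains inserts `v` into the left-hand word.
    · refine Finset.sum_congr rfl fun i hi => ?_
      rw [Finset.mem_range] at hi
      generalize hE : B.take (i + 1) = E
      generalize hY : B.drop (i + 1) = Y
      have hBE : B = E ++ Y := by rw [← hE, ← hY, List.take_append_drop]
      have hEne : E ≠ [] := by
        rintro rfl
        rw [List.take_eq_nil_iff] at hE
        rcases hE with h | h
        · omega
        · simp [h] at hi
      have hhead : B.head? = E.head? := by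
        rw [hBE, List.head?_append_of_ne_nil _ hEne]
      have hndAE : (A ++ E).Nodup := by
        rw [hBE, ← List.append_assoc] at hnd
        exact (List.nodup_append.1 hnd).1
      have hvAE : ∀ x ∈ A ++ E, x < v := by
        intro x hx
        apply hv x
        simp only [hBE, List.mem_append] at hx ⊢; tauto
      have hvY : v ∉ Y := fun h => hvB (by simp [hBE, h])
      have hfun : (fun q => H (A ++ E).toFinset A.getLast? q -
          B.head?.elim 0 fun y => H (A ++ E).toFinset (some y) q) =
          attach v A.getLast? E.head? (F (insert v (A ++ E).toFinset)) := by
        funext q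
        have hH : ∀ o : Option V, (∀ z, o = some z → z ∈ (A ++ E).toFinset) →
            H (A ++ E).toFinset o q = F (A ++ E).toFinset (Function.update q v none) +
              F (insert v (A ++ E).toFinset) (Function.update q v o) := by
          intro o ho
          simp only [H]
          rw [if_pos ho]
          congr 3
          rcases o with _ | z
          · rfl
          · have := ho z rfl
            simp only [Option.filter, this, not_true_eq_false, decide_false]
            rfl
        rw [hH A.getLast? (fun z hz => by simp [List.mem_of_getLast? hz]), hhead]
        rcases hEl : E.head? with _ | y
        · exact absurd (List.head?_eq_none_iff.1 hEl) hEne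
        · have hyE : y ∈ E := List.mem_of_mem_head? hEl
          simp only [Option.elim_some, attach]
          rw [hH (some y) (fun z hz => by rw [Option.some.injEq] at hz; simp [← hz, hyE])]
          ring
      have hins : (A ++ v :: E).toFinset = insert v (A ++ E).toFinset := by
        ext u; simp only [List.mem_toFinset, List.mem_append, List.mem_cons, Finset.mem_insert]; tauto
      rw [hfun, ← attach_permSum hvY, hins, permSum_append_cons hndAE hvAE]

end Words

/-! ### Sub-forests, components and admissible cuts -/

namespace Forest

variable {n m : ℕ}

theorem parent_injective : Function.Injective (parent : Forest n → _) := by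
  rintro ⟨p, hp⟩ ⟨q, hq⟩ h
  cases h
  rfl

/-- The forest induced by `F` along an increasing embedding of vertices. -/
noncomputable def pullback (F : Forest n) (e : Fin m ↪o Fin n) : Forest m where
  parent i := (F.parent (e i)).bind (Function.partialInv e)
  parent_lt := by
    intro v w h
    rw [Option.bind_eq_some_iff] at h
    obtain ⟨a, ha, haw⟩ := h
    rw [e.injective.isPartialInv] at haw
    rw [← haw] at ha
    exact e.lt_iff_lt.1 (F.parent_lt _ _ ha)

theorem pullback_parent_eq_some (F : Forest n) (e : Fin m ↪o Fin n) (i j : Fin m) :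
    (F.pullback e).parent i = some j ↔ F.parent (e i) = some (e j) := by
  simp only [pullback, Option.bind_eq_some_iff]
  constructor
  · rintro ⟨a, ha, haw⟩
    rw [e.injective.isPartialInv] at haw
    rw [ha, haw]
  · intro h
    exact ⟨_, h, (e.injective.isPartialInv _ _).2 rfl⟩

theorem eq_of_parent_eq_some_iff {F G : Forest n}
    (h : ∀ i j, F.parent i = some j ↔ G.parent i = some j) : F = G :=
  parent_injective (funext fun i => Option.ext fun j => h i j)

/-- Pullbacks compose along embeddings, which avoids repeated renumbering of subsets of subsets. -/
theorem restrict_eq_pullback (F : Forest n) (S : Finset (Fin n)) :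
    F.restrict S = F.pullback (S.orderEmbOfFin rfl) := by
  refine eq_of_parent_eq_some_iff fun i j => ?_
  rw [pullback_parent_eq_some]
  simp only [restrict, Option.bind_eq_some_iff]
  constructor
  · rintro ⟨w, hw, hwj⟩
    split_ifs at hwj with h
    rw [Option.some.injEq] at hwj
    rw [hw, ← hwj, ← Finset.coe_orderIsoOfFin_apply, OrderIso.apply_symm_apply]
  · intro h
    refine ⟨_, h, ?_⟩
    rw [dif_pos (Finset.orderEmbOfFin_mem S rfl j), Option.some.injEq,
      OrderIso.symm_apply_eq]
    exact Subtype.ext (Finset.coe_orderIsoOfFin_apply _ _ _).symm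

theorem pullback_pullback {l : ℕ} (F : Forest n) (e : Fin m ↪o Fin n) (e' : Fin l ↪o Fin m) :
    (F.pullback e).pullback e' = F.pullback (e'.trans e) := by
  refine eq_of_parent_eq_some_iff fun i j => ?_
  simp only [pullback_parent_eq_some, RelEmbedding.coe_trans, Function.comp_apply]

/-- The edge relation of the sub-forest with vertex set `S`. -/
def Edge (F : Forest n) (S : Finset (Fin n)) (a b : Fin n) : Prop :=
  a ∈ S ∧ b ∈ S ∧ F.parent a = some b

/-- `v` is equal to or above `w` in the sub-forest with vertex set `S`. -/
def Reach (F : Forest n) (S : Finset (Fin n)) (v w : Fin n) : Prop :=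
  Relation.ReflTransGen (F.Edge S) v w

/-! ### Reachability, roots and tree components of sub-forests. -/

variable (F : Forest n) {S T : Finset (Fin n)} {v w r : Fin n}

theorem mem_roots : v ∈ F.roots S ↔ v ∈ S ∧ ∀ w ∈ S, F.parent v ≠ some w := by
  simp [roots]

theorem not_edge_of_mem_roots (hv : v ∈ F.roots S) : ¬ F.Edge S v w := fun h =>
  ((F.mem_roots).1 hv).2 w h.2.1 h.2.2

theorem conn_iff : F.Conn S v w ↔ ∃ u, F.Edge S v u ∧ F.Reach S u w :=
  Relation.TransGen.head'_iff

theorem mem_comp : v ∈ F.comp S r ↔ v ∈ S ∧ F.Reach S v r := by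
  simp only [comp, Finset.mem_filter]
  refine and_congr_right fun _ => ?_
  rw [Reach, Relation.reflTransGen_iff_eq_or_transGen, eq_comm]
  rfl

theorem mem_lea {c : Finset (Fin n)} (hc : c ⊆ S) :
    v ∈ F.lea S c ↔ ∃ w ∈ c, F.Reach S v w := by
  simp only [lea, Finset.mem_filter]
  constructor
  · rintro ⟨-, h | ⟨w, hw, h⟩⟩
    · exact ⟨v, h, Relation.ReflTransGen.refl⟩
    · exact ⟨w, hw, Relation.TransGen.to_reflTransGen h⟩
  · rintro ⟨w, hw, h⟩
    rcases Relation.reflTransGen_iff_eq_or_transGen.1 h with h | h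
    · subst h
      exact ⟨hc hw, Or.inl hw⟩
    · obtain ⟨u, hu, -⟩ := F.conn_iff.1 h
      exact ⟨hu.1, Or.inr ⟨w, hw, h⟩⟩

theorem Reach.mono {F : Forest n} (h : F.Reach S v w) (hST : S ⊆ T) : F.Reach T v w :=
  Relation.ReflTransGen.mono (fun _ _ h => ⟨hST h.1, hST h.2.1, h.2.2⟩) v w h

theorem exists_root (hv : v ∈ S) : ∃ r ∈ F.roots S, F.Reach S v r := by
  induction v using WellFoundedLT.induction with
  | _ v ih =>
    by_cases h : v ∈ F.roots S
    · exact ⟨v, h, Relation.ReflTransGen.refl⟩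
    · simp only [mem_roots, hv, true_and, not_forall, not_not] at h
      obtain ⟨w, hw, hvw⟩ := h
      obtain ⟨r, hr, hwr⟩ := ih w (F.parent_lt _ _ hvw) hw
      exact ⟨r, hr, Relation.ReflTransGen.head ⟨hv, hw, hvw⟩ hwr⟩

theorem roots_subset : F.roots S ⊆ S := fun _ hv => ((F.mem_roots).1 hv).1

theorem comp_subset : F.comp S r ⊆ S := fun _ hv => ((F.mem_comp).1 hv).1

theorem roots_comp (hr : r ∈ F.roots S) : F.roots (F.comp S r) = {r} := by
  have hrS := F.roots_subset hr
  ext v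
  rw [Finset.mem_singleton, mem_roots]
  constructor
  · rintro ⟨hv, hvr⟩
    obtain ⟨hvS, hreach⟩ := (F.mem_comp).1 hv
    rcases Relation.ReflTransGen.cases_head hreach with h | ⟨u, hu, hur⟩
    · exact h
    · exact absurd hu.2.2 (hvr u ((F.mem_comp).2 ⟨hu.2.1, hur⟩))
  · rintro rfl
    exact ⟨(F.mem_comp).2 ⟨hrS, Relation.ReflTransGen.refl⟩, fun w hw h =>
      F.not_edge_of_mem_roots hr ⟨hrS, F.comp_subset hw, h⟩⟩

theorem comp_eq_self (h : F.roots S = {r}) : F.comp S r = S := by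
  refine Finset.Subset.antisymm F.comp_subset fun v hv => (F.mem_comp).2 ⟨hv, ?_⟩
  obtain ⟨r', hr', hreach⟩ := F.exists_root hv
  rw [h, Finset.mem_singleton] at hr'
  exact hr' ▸ hreach

/-- There is no edge between the disjoint sets of vertices `S` and `T`. -/
def Separated (F : Forest n) (S T : Finset (Fin n)) : Prop :=
  Disjoint S T ∧ ∀ v ∈ S, ∀ w ∈ T, F.parent v ≠ some w ∧ F.parent w ≠ some v

variable {F}

theorem Separated.symm (h : F.Separated S T) : F.Separated T S :=
  ⟨h.1.symm, fun v hv w hw => ⟨(h.2 w hw v hv).2, (h.2 w hw v hv).1⟩⟩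

theorem Separated.mono (h : F.Separated S T) {S' T' : Finset (Fin n)} (hS : S' ⊆ S)
    (hT : T' ⊆ T) : F.Separated S' T' :=
  ⟨h.1.mono hS hT, fun v hv w hw => h.2 v (hS hv) w (hT hw)⟩

theorem separated_comp (hr : r ∈ F.roots S) : F.Separated (F.comp S r) (S \ F.comp S r) := by
  refine ⟨Finset.disjoint_sdiff, fun v hv w hw => ?_⟩
  obtain ⟨hwS, hwc⟩ := Finset.mem_sdiff.1 hw
  obtain ⟨hvS, hreach⟩ := (F.mem_comp).1 hv
  constructor
  · intro hvw
    rcases Relation.ReflTransGen.cases_head hreach with rfl | ⟨u, hu, hur⟩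
    · exact F.not_edge_of_mem_roots hr ⟨hvS, hwS, hvw⟩
    · have : u = w := Option.some.inj (hu.2.2.symm.trans hvw)
      subst this
      exact hwc ((F.mem_comp).2 ⟨hwS, hur⟩)
  · intro hwv
    exact hwc ((F.mem_comp).2 ⟨hwS, Relation.ReflTransGen.head ⟨hwS, hvS, hwv⟩ hreach⟩)

theorem mem_roots_union_left (h : F.Separated S T) (hv : v ∈ S) :
    v ∈ F.roots (S ∪ T) ↔ v ∈ F.roots S := by
  simp only [mem_roots, Finset.mem_union, hv, true_or, true_and]
  constructor
  · exact fun h' w hw => h' w (Or.inl hw)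
  · rintro h' w (hw | hw)
    · exact h' w hw
    · exact (h.2 v hv w hw).1

theorem roots_union (h : F.Separated S T) : F.roots (S ∪ T) = F.roots S ∪ F.roots T := by
  ext v
  by_cases hv : v ∈ S ∪ T
  · rw [Finset.mem_union]
    rcases Finset.mem_union.1 hv with hv | hv
    · rw [mem_roots_union_left h hv]
      exact ⟨Or.inl, fun h' => h'.elim id fun hT =>
        absurd (F.roots_subset hT) (Finset.disjoint_left.1 h.1 hv)⟩
    · rw [Finset.union_comm, mem_roots_union_left h.symm hv]
      exact ⟨Or.inr, fun h' => h'.elim (fun hS =>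
        absurd hv (Finset.disjoint_left.1 h.1 (F.roots_subset hS))) id⟩
  · constructor
    · exact fun h' => absurd (F.roots_subset h') hv
    · exact fun h' => absurd (Finset.union_subset_union F.roots_subset F.roots_subset h') hv

theorem comp_union (h : F.Separated S T) (hr : r ∈ S) : F.comp (S ∪ T) r = F.comp S r := by
  ext v
  rw [mem_comp, mem_comp]
  constructor
  · rintro ⟨hv, hreach⟩
    have : v ∈ S ∧ F.Reach S v r := by
      clear hv
      unfold Reach at hreach
      induction hreach using Relation.ReflTransGen.head_induction_on with
      | refl => exact ⟨hr, Relation.ReflTransGen.refl⟩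
      | head hvu _ ih =>
        have hvS := (Finset.mem_union.1 hvu.1).resolve_right fun h' =>
          (h.2 _ ih.1 _ h').2 hvu.2.2
        exact ⟨hvS, Relation.ReflTransGen.head ⟨hvS, ih.1, hvu.2.2⟩ ih.2⟩
    exact this
  · rintro ⟨hv, hreach⟩
    exact ⟨Finset.mem_union_left _ hv, hreach.mono Finset.subset_union_left⟩

/-- Induction on sub-forests: the empty forest, trees, and unions of separated sub-forests. -/
theorem subforest_induction {Q : Finset (Fin n) → Prop} (F : Forest n) (empty : Q ∅)
    (tree : ∀ S r, F.roots S = {r} → Q S)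
    (union : ∀ S T, F.Separated S T → Q S → Q T → Q (S ∪ T)) (S : Finset (Fin n)) : Q S := by
  induction S using Finset.strongInduction with
  | H S ih =>
    rcases S.eq_empty_or_nonempty with rfl | ⟨v, hv⟩
    · exact empty
    · obtain ⟨r, hr, -⟩ := F.exists_root hv
      have hrc : r ∈ F.comp S r := (F.mem_comp).2 ⟨F.roots_subset hr, Relation.ReflTransGen.refl⟩
      have h := union _ _ (separated_comp hr) (tree _ r (F.roots_comp hr))
        (ih _ (Finset.sdiff_ssubset F.comp_subset ⟨r, hrc⟩))
      rwa [Finset.union_sdiff_of_subset F.comp_subset] at h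

/-- The multiplicative extension of a function of trees to sub-forests. -/
noncomputable def multExt (F : Forest n) (g : Finset (Fin n) → ℂ) (S : Finset (Fin n)) : ℂ :=
  ∏ r ∈ F.roots S, g (F.comp S r)

theorem multExt_empty (g : Finset (Fin n) → ℂ) : F.multExt g ∅ = 1 := by
  have : F.roots ∅ = ∅ := Finset.subset_empty.1 F.roots_subset
  rw [multExt, this, Finset.prod_empty]

theorem multExt_tree (g : Finset (Fin n) → ℂ) (h : F.roots S = {r}) : F.multExt g S = g S := by
  rw [multExt, h, Finset.prod_singleton, F.comp_eq_self h]

theorem multExt_union (g : Finset (Fin n) → ℂ) (h : F.Separated S T) :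
    F.multExt g (S ∪ T) = F.multExt g S * F.multExt g T := by
  unfold multExt
  rw [roots_union h, Finset.prod_union (h.1.mono F.roots_subset F.roots_subset)]
  congr 1
  · exact Finset.prod_congr rfl fun r hr => by rw [comp_union h (F.roots_subset hr)]
  · exact Finset.prod_congr rfl fun r hr => by
      rw [Finset.union_comm, comp_union h.symm (F.roots_subset hr)]

/-- The convolution of two functions of sub-forests. -/
noncomputable def conv (F : Forest n) (X Y : Finset (Fin n) → ℂ) (S : Finset (Fin n)) : ℂ :=
  ∑ R ∈ lowerSets F.parent S, X R * Y (S \ R)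

theorem mem_lowerSets {p : Fin n → Option (Fin n)} {R : Finset (Fin n)} :
    R ∈ lowerSets p S ↔ R ⊆ S ∧ ∀ v ∈ R, ∀ w ∈ S, p v = some w → w ∈ R := by
  simp [lowerSets]

/-- With no edge between `S` and `T`, a lower set of the union is an independent choice of a lower
set in each. -/
theorem conv_union {X Y : Finset (Fin n) → ℂ}
    (hX : ∀ S T, F.Separated S T → X (S ∪ T) = X S * X T)
    (hY : ∀ S T, F.Separated S T → Y (S ∪ T) = Y S * Y T) (h : F.Separated S T) :
    F.conv X Y (S ∪ T) = F.conv X Y S * F.conv X Y T := by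
  unfold conv
  rw [Finset.sum_mul_sum, ← Finset.sum_product']
  have hd := Finset.disjoint_left.1 h.1
  symm
  refine Finset.sum_bij' (fun q _ => q.1 ∪ q.2) (fun R _ => (R ∩ S, R ∩ T)) ?_ ?_ ?_ ?_ ?_
  · rintro ⟨R₁, R₂⟩ hR
    simp only [Finset.mem_product, mem_lowerSets] at hR
    obtain ⟨⟨h1, h1'⟩, h2, h2'⟩ := hR
    refine mem_lowerSets.2 ⟨Finset.union_subset_union h1 h2, fun v hv w hw hvw => ?_⟩
    rw [Finset.mem_union] at hv hw ⊢
    rcases hv with hv | hv <;> rcases hw with hw | hw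
    · exact Or.inl (h1' v hv w hw hvw)
    · exact absurd hvw (h.2 v (h1 hv) w hw).1
    · exact absurd hvw (h.2 w hw v (h2 hv)).2
    · exact Or.inr (h2' v hv w hw hvw)
  · intro R hR
    obtain ⟨h1, h2⟩ := mem_lowerSets.1 hR
    simp only [Finset.mem_product, mem_lowerSets, Finset.mem_inter]
    exact ⟨⟨Finset.inter_subset_right, fun v hv w hw hvw =>
      ⟨h2 v hv.1 w (Finset.mem_union_left _ hw) hvw, hw⟩⟩,
      Finset.inter_subset_right, fun v hv w hw hvw =>
      ⟨h2 v hv.1 w (Finset.mem_union_right _ hw) hvw, hw⟩⟩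
  · rintro ⟨R₁, R₂⟩ hR
    simp only [Finset.mem_product, mem_lowerSets] at hR
    obtain ⟨⟨h1, -⟩, h2, -⟩ := hR
    refine Prod.ext ?_ ?_
    · ext v
      simp only [Finset.mem_inter, Finset.mem_union]
      exact ⟨fun hv => hv.1.elim id fun hv2 => absurd (h2 hv2) (hd hv.2),
        fun hv => ⟨Or.inl hv, h1 hv⟩⟩
    · ext v
      simp only [Finset.mem_inter, Finset.mem_union]
      exact ⟨fun hv => hv.1.elim (fun hv1 => absurd hv.2 (hd (h1 hv1))) id,
        fun hv => ⟨Or.inr hv, h2 hv⟩⟩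
  · intro R hR
    dsimp only
    rw [← Finset.inter_union_distrib_left, Finset.inter_eq_left]
    exact (mem_lowerSets.1 hR).1
  · rintro ⟨R₁, R₂⟩ hR
    simp only [Finset.mem_product, mem_lowerSets] at hR
    obtain ⟨⟨h1, -⟩, h2, -⟩ := hR
    have hsd : (S ∪ T) \ (R₁ ∪ R₂) = S \ R₁ ∪ T \ R₂ := by
      ext v
      simp only [Finset.mem_sdiff, Finset.mem_union, not_or]
      constructor
      · rintro ⟨h3 | h3, h4, h5⟩
        · exact Or.inl ⟨h3, h4⟩
        · exact Or.inr ⟨h3, h5⟩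
      · rintro (⟨h3, h4⟩ | ⟨h3, h4⟩)
        · exact ⟨Or.inl h3, h4, fun h5 => hd h3 (h2 h5)⟩
        · exact ⟨Or.inr h3, fun h5 => hd (h1 h5) h3, h4⟩
    dsimp only
    rw [hsd, hX _ _ (h.mono h1 h2), hY _ _ (h.mono Finset.sdiff_subset Finset.sdiff_subset)]
    ring

/-- Both sides run over chains `Q ⊆ R ⊆ S` of lower sets, with weight `X Q * Y (R \ Q) * W (S \ R)`.
-/
theorem conv_assoc (X Y W : Finset (Fin n) → ℂ) (S : Finset (Fin n)) :
    F.conv (F.conv X Y) W S = F.conv X (F.conv Y W) S := by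
  unfold conv
  simp only [Finset.sum_mul, Finset.mul_sum]
  rw [Finset.sum_sigma', Finset.sum_sigma']
  refine Finset.sum_bij' (fun q _ => ⟨q.2, q.1 \ q.2⟩) (fun q _ => ⟨q.1 ∪ q.2, q.1⟩)
    ?_ ?_ ?_ ?_ ?_
  · rintro ⟨R, Q⟩ h
    simp only [Finset.mem_sigma, mem_lowerSets, Finset.mem_sdiff] at h ⊢
    obtain ⟨⟨h1, h1'⟩, h2, h2'⟩ := h
    refine ⟨⟨h2.trans h1, fun v hv w hw hvw => h2' v hv w (h1' v (h2 hv) w hw hvw) hvw⟩,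
      Finset.sdiff_subset_sdiff h1 (Finset.Subset.refl _), fun v hv w hw hvw =>
        ⟨h1' v hv.1 w hw.1 hvw, hw.2⟩⟩
  · rintro ⟨Q, R⟩ h
    simp only [Finset.mem_sigma, mem_lowerSets, Finset.mem_sdiff, Finset.mem_union] at h ⊢
    obtain ⟨⟨h1, h1'⟩, h2, h2'⟩ := h
    refine ⟨⟨Finset.union_subset h1 (h2.trans Finset.sdiff_subset), fun v hv w hw hvw => ?_⟩,
      Finset.subset_union_left, fun v hv w hw hvw => ?_⟩
    · rcases hv with hv | hv
      · exact Or.inl (h1' v hv w hw hvw)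
      · by_cases hwQ : w ∈ Q
        · exact Or.inl hwQ
        · exact Or.inr (h2' v hv w ⟨hw, hwQ⟩ hvw)
    · refine h1' v hv w (hw.elim (fun h => h1 h) fun h => (Finset.mem_sdiff.1 (h2 h)).1) hvw
  · rintro ⟨R, Q⟩ h
    simp only [Finset.mem_sigma, mem_lowerSets] at h
    simp only [Finset.union_sdiff_of_subset h.2.1]
  · rintro ⟨Q, R⟩ h
    simp only [Finset.mem_sigma, mem_lowerSets] at h
    have : (Q ∪ R) \ Q = R := by
      rw [Finset.union_sdiff_left, Finset.sdiff_eq_self_iff_disjoint]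
      exact (Finset.disjoint_of_subset_left h.2.1 Finset.sdiff_disjoint)
    simp only [this]
  · rintro ⟨R, Q⟩ h
    simp only [Finset.mem_sigma, mem_lowerSets] at h
    have : (S \ Q) \ (R \ Q) = S \ R := by
      ext v
      simp only [Finset.mem_sdiff, not_and, not_not]
      constructor
      · rintro ⟨⟨h1, h2⟩, h3⟩
        exact ⟨h1, fun h4 => h2 (h3 h4)⟩
      · rintro ⟨h1, h2⟩
        exact ⟨⟨h1, fun h3 => h2 (h.2.1 h3)⟩, fun h3 => absurd h3 h2⟩
    dsimp only
    rw [this, mul_assoc]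

theorem self_mem_lowerSets : S ∈ lowerSets F.parent S :=
  mem_lowerSets.2 ⟨Finset.Subset.refl _, fun _ _ _ hw _ => hw⟩

theorem conv_eq_add (X Y : Finset (Fin n) → ℂ) (hY : Y ∅ = 1) (S : Finset (Fin n)) :
    F.conv X Y S = X S + ∑ R ∈ (lowerSets F.parent S).erase S, X R * Y (S \ R) := by
  unfold conv
  rw [← Finset.add_sum_erase _ _ F.self_mem_lowerSets, Finset.sdiff_self, hY, mul_one]

/-- Convolution by `Y` is unitriangular for inclusion: apart from `X S` itself, only proper subsets
of `S` enter. -/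
theorem eq_of_conv_eq {X X' Y : Finset (Fin n) → ℂ} (hY : Y ∅ = 1)
    (h : ∀ S, F.conv X Y S = F.conv X' Y S) (S : Finset (Fin n)) : X S = X' S := by
  induction S using Finset.strongInduction with
  | H S ih =>
    have h1 := h S
    rw [conv_eq_add X Y hY, conv_eq_add X' Y hY] at h1
    have h2 : ∑ R ∈ (lowerSets F.parent S).erase S, X R * Y (S \ R) =
        ∑ R ∈ (lowerSets F.parent S).erase S, X' R * Y (S \ R) := by
      refine Finset.sum_congr rfl fun R hR => ?_
      obtain ⟨hne, hR⟩ := Finset.mem_erase.1 hR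
      rw [ih R (lt_of_le_of_ne (mem_lowerSets.1 hR).1 hne)]
    rw [h2] at h1
    exact add_right_cancel h1

theorem Reach.mem_of_lower {R : Finset (Fin n)} (hR : R ∈ lowerSets F.parent S)
    (h : F.Reach S v w) (hv : v ∈ R) : w ∈ R := by
  unfold Reach at h
  induction h with
  | refl => exact hv
  | tail _ hbc ih => exact (mem_lowerSets.1 hR).2 _ ih _ hbc.2.1 hbc.2.2

theorem mem_cuts {c : Finset (Fin n)} : c ∈ F.cuts S ↔
    c ⊆ S \ F.roots S ∧ c.Nonempty ∧ ∀ v ∈ c, ∀ w ∈ c, ¬ F.Conn S v w := by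
  simp [cuts]

theorem roo_mem_lowerSets {c : Finset (Fin n)} (hc : c ⊆ S) :
    F.roo S c ∈ lowerSets F.parent S := by
  refine mem_lowerSets.2 ⟨Finset.sdiff_subset, fun v hv w hw hvw => ?_⟩
  simp only [roo, Finset.mem_sdiff, mem_lea F hc] at hv ⊢
  refine ⟨hw, fun ⟨x, hx, hwx⟩ => hv.2 ⟨x, hx, ?_⟩⟩
  exact Relation.ReflTransGen.head ⟨hv.1, hw, hvw⟩ hwx

theorem root_mem_roo {c : Finset (Fin n)} (hc : c ⊆ S \ F.roots S) (hr : r ∈ F.roots S) :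
    r ∈ F.roo S c := by
  rw [roo, Finset.mem_sdiff, mem_lea F (hc.trans Finset.sdiff_subset)]
  refine ⟨F.roots_subset hr, fun ⟨w, hw, hrw⟩ => ?_⟩
  rcases Relation.ReflTransGen.cases_head hrw with rfl | ⟨u, hu, -⟩
  · exact (Finset.mem_sdiff.1 (hc hw)).2 hr
  · exact F.not_edge_of_mem_roots hr hu

theorem roots_roo {c : Finset (Fin n)} (hc : c ⊆ S \ F.roots S) (h : F.roots S = {r}) :
    F.roots (F.roo S c) = {r} := by
  have hcS := hc.trans Finset.sdiff_subset
  have hr : r ∈ F.roots S := by simp [h]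
  ext v
  rw [Finset.mem_singleton]
  constructor
  · intro hv
    rw [mem_roots] at hv
    have hvS : v ∈ S := Finset.sdiff_subset hv.1
    rw [← Finset.mem_singleton, ← h, mem_roots]
    exact ⟨hvS, fun w hw hvw => hv.2 w ((mem_lowerSets.1 (roo_mem_lowerSets hcS)).2 v hv.1 w hw hvw)
      hvw⟩
  · rintro rfl
    exact (F.mem_roots).2 ⟨root_mem_roo hc hr, fun w hw =>
      ((F.mem_roots).1 hr).2 w (Finset.sdiff_subset hw)⟩

theorem lea_subset {c : Finset (Fin n)} : F.lea S c ⊆ S := by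
  intro v hv
  simp only [lea, Finset.mem_filter] at hv
  exact hv.1

theorem roots_lea {c : Finset (Fin n)} (hc : c ∈ F.cuts S) : F.roots (F.lea S c) = c := by
  obtain ⟨hsub, -, hanti⟩ := mem_cuts.1 hc
  have hcS := hsub.trans Finset.sdiff_subset
  ext v
  rw [mem_roots, mem_lea F hcS]
  constructor
  · rintro ⟨⟨w, hw, hvw⟩, hv⟩
    rcases Relation.ReflTransGen.cases_head hvw with rfl | ⟨u, hu, huw⟩
    · exact hw
    · exact absurd hu.2.2 (hv u ((mem_lea F hcS).2 ⟨w, hw, huw⟩))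
  · intro hv
    refine ⟨⟨v, hv, Relation.ReflTransGen.refl⟩, fun w hw hvw => ?_⟩
    obtain ⟨x, hx, hwx⟩ := (mem_lea F hcS).1 hw
    exact hanti v hv x hx (F.conn_iff.2 ⟨w, ⟨hcS hv, lea_subset hw, hvw⟩, hwx⟩)

theorem lea_roots_sdiff {R : Finset (Fin n)} (hR : R ∈ lowerSets F.parent S) :
    F.lea S (F.roots (S \ R)) = S \ R := by
  have hsub : F.roots (S \ R) ⊆ S := F.roots_subset.trans Finset.sdiff_subset
  ext v
  rw [mem_lea F hsub]
  constructor
  · rintro ⟨w, hw, hvw⟩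
    have hwR := Finset.mem_sdiff.1 (F.roots_subset hw)
    have hvS : v ∈ S := by
      rcases Relation.ReflTransGen.cases_head hvw with rfl | ⟨u, hu, -⟩
      · exact hwR.1
      · exact hu.1
    exact Finset.mem_sdiff.2 ⟨hvS, fun hv => hwR.2 (hvw.mem_of_lower hR hv)⟩
  · intro hv
    obtain ⟨r, hr, hvr⟩ := F.exists_root hv
    exact ⟨r, hr, hvr.mono Finset.sdiff_subset⟩

/-- On a tree, the convolution is a sum over admissible cuts. -/
theorem conv_tree {X Y : Finset (Fin n) → ℂ} (hX : X ∅ = 1) (hY : Y ∅ = 1)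
    (h : F.roots S = {r}) :
    F.conv X Y S = X S + Y S + ∑ c ∈ F.cuts S, X (F.roo S c) * Y (F.lea S c) := by
  have hr : r ∈ F.roots S := by simp [h]
  have hrS := F.roots_subset hr
  have hS : S.Nonempty := ⟨r, hrS⟩
  -- The lower sets `S` and `∅` give the terms `X S` and `Y S`. All the others are proper, contain
  -- the root, and correspond to admissible cuts through the roots of their complement.
  have hempty : ∅ ∈ (lowerSets F.parent S).erase S :=
    Finset.mem_erase.2 ⟨hS.ne_empty.symm, mem_lowerSets.2 ⟨Finset.empty_subset _, by simp⟩⟩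
  rw [conv_eq_add X Y hY, ← Finset.add_sum_erase _ _ hempty, hX, one_mul, Finset.sdiff_empty,
    add_assoc]
  congr 2
  symm
  refine Finset.sum_bij' (fun c _ => F.roo S c) (fun R _ => F.roots (S \ R)) ?_ ?_ ?_ ?_ ?_
  · intro c hc
    obtain ⟨hsub, -, -⟩ := mem_cuts.1 hc
    refine Finset.mem_erase.2 ⟨?_, Finset.mem_erase.2 ⟨?_, ?_⟩⟩
    · exact Finset.Nonempty.ne_empty ⟨r, root_mem_roo hsub hr⟩
    · intro heq
      have := F.card_roo_lt hc
      rw [heq] at this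
      exact lt_irrefl _ this
    · exact roo_mem_lowerSets (hsub.trans Finset.sdiff_subset)
  · intro R hR
    obtain ⟨hne, hR⟩ := Finset.mem_erase.1 hR
    obtain ⟨hneS, hR⟩ := Finset.mem_erase.1 hR
    obtain ⟨hRS, hRl⟩ := mem_lowerSets.1 hR
    have hrR : r ∈ R := by
      obtain ⟨v, hv⟩ := Finset.nonempty_iff_ne_empty.2 hne
      obtain ⟨r', hr', hreach⟩ := F.exists_root (hRS hv)
      rw [h, Finset.mem_singleton] at hr'
      subst hr'
      exact hreach.mem_of_lower hR hv
    refine mem_cuts.2 ⟨fun v hv => ?_, ?_, fun v hv w hw hvw => ?_⟩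
    · obtain ⟨h1, h2⟩ := Finset.mem_sdiff.1 (F.roots_subset hv)
      refine Finset.mem_sdiff.2 ⟨h1, fun h3 => h2 ?_⟩
      rw [h, Finset.mem_singleton] at h3
      exact h3 ▸ hrR
    · have : (S \ R).Nonempty := by
        rw [Finset.sdiff_nonempty]
        exact fun h' => hneS (Finset.Subset.antisymm hRS h')
      obtain ⟨v, hv⟩ := this
      obtain ⟨r', hr', -⟩ := F.exists_root hv
      exact ⟨r', hr'⟩
    · obtain ⟨u, hu, huw⟩ := F.conn_iff.1 hvw
      have hwR := (Finset.mem_sdiff.1 (F.roots_subset hw)).2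
      exact ((F.mem_roots).1 hv).2 u
        (Finset.mem_sdiff.2 ⟨hu.2.1, fun huR => hwR (huw.mem_of_lower hR huR)⟩) hu.2.2
  · intro c hc
    have : S \ F.roo S c = F.lea S c := by rw [roo, Finset.sdiff_sdiff_eq_self lea_subset]
    rw [this, roots_lea hc]
  · intro R hR
    have hR' := Finset.mem_of_mem_erase (Finset.mem_of_mem_erase hR)
    rw [roo, lea_roots_sdiff hR', Finset.sdiff_sdiff_eq_self (mem_lowerSets.1 hR').1]
  · intro c hc
    rw [roo, Finset.sdiff_sdiff_eq_self lea_subset]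

/-! #### Increasing renumberings -/

variable (e : Fin m ↪o Fin n) {U : Finset (Fin m)}

theorem roots_map : F.roots (U.map e.toEmbedding) =
    ((F.pullback e).roots U).map e.toEmbedding := by
  ext v
  simp only [mem_roots, Finset.mem_map, RelEmbedding.coe_toEmbedding]
  constructor
  · rintro ⟨⟨i, hi, rfl⟩, h⟩
    exact ⟨i, ⟨hi, fun j hj hij => h (e j) ⟨j, hj, rfl⟩ ((pullback_parent_eq_some F e i j).1 hij)⟩,
      rfl⟩
  · rintro ⟨i, ⟨hi, h⟩, rfl⟩
    refine ⟨⟨i, hi, rfl⟩, ?_⟩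
    rintro w ⟨j, hj, rfl⟩ hij
    exact h j hj ((pullback_parent_eq_some F e i j).2 hij)

theorem edge_map {i j : Fin m} : F.Edge (U.map e.toEmbedding) (e i) (e j) ↔
    (F.pullback e).Edge U i j := by
  simp only [Edge, Finset.mem_map, RelEmbedding.coe_toEmbedding, EmbeddingLike.apply_eq_iff_eq,
    exists_eq_right, pullback_parent_eq_some]

theorem reach_map {i j : Fin m} : F.Reach (U.map e.toEmbedding) (e i) (e j) ↔
    (F.pullback e).Reach U i j := by
  constructor
  · intro h
    unfold Reach at h
    generalize hv : e i = v at h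
    induction h using Relation.ReflTransGen.head_induction_on generalizing i with
    | refl => rw [e.injective hv]; exact Relation.ReflTransGen.refl
    | head hab _ ih =>
      subst hv
      obtain ⟨l, hl, hl'⟩ := Finset.mem_map.1 hab.2.1
      rw [RelEmbedding.coe_toEmbedding] at hl'
      subst hl'
      exact Relation.ReflTransGen.head ((edge_map e).1 hab) (ih rfl)
  · exact fun h => Relation.ReflTransGen.lift e (fun _ _ h => (edge_map e).2 h) _ _ h

theorem comp_map (i : Fin m) : F.comp (U.map e.toEmbedding) (e i) =
    ((F.pullback e).comp U i).map e.toEmbedding := by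
  ext v
  simp only [mem_comp, Finset.mem_map, RelEmbedding.coe_toEmbedding]
  constructor
  · rintro ⟨⟨j, hj, rfl⟩, h⟩
    exact ⟨j, ⟨hj, (reach_map e).1 h⟩, rfl⟩
  · rintro ⟨j, ⟨hj, h⟩, rfl⟩
    exact ⟨⟨j, hj, rfl⟩, (reach_map e).2 h⟩

theorem multExt_map (g : Finset (Fin n) → ℂ) (U : Finset (Fin m)) :
    F.multExt g (U.map e.toEmbedding) =
      (F.pullback e).multExt (fun T => g (T.map e.toEmbedding)) U := by
  unfold multExt
  rw [roots_map, Finset.prod_map]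
  exact Finset.prod_congr rfl fun i _ => by rw [RelEmbedding.coe_toEmbedding, comp_map]

theorem conv_map (X Y : Finset (Fin n) → ℂ) (U : Finset (Fin m)) :
    F.conv X Y (U.map e.toEmbedding) =
      (F.pullback e).conv (fun T => X (T.map e.toEmbedding))
        (fun T => Y (T.map e.toEmbedding)) U := by
  have : lowerSets F.parent (U.map e.toEmbedding) =
      (lowerSets (F.pullback e).parent U).map (Finset.mapEmbedding e.toEmbedding).toEmbedding := by
    ext R
    simp only [mem_lowerSets, Finset.mem_map, RelEmbedding.coe_toEmbedding,
      Finset.mapEmbedding_apply]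
    constructor
    · rintro ⟨h1, h2⟩
      obtain ⟨T, hT, rfl⟩ := Finset.subset_map_iff.1 h1
      refine ⟨T, ⟨hT, fun i hi j hj hij => ?_⟩, rfl⟩
      have := h2 (e i) (Finset.mem_map_of_mem _ hi) (e j) ⟨j, hj, rfl⟩
        ((pullback_parent_eq_some F e i j).1 hij)
      simpa using this
    · rintro ⟨T, ⟨hT, h⟩, rfl⟩
      refine ⟨Finset.map_subset_map.2 hT, ?_⟩
      rintro v hv w ⟨j, hj, rfl⟩ hvw
      obtain ⟨i, hi, rfl⟩ := Finset.mem_map.1 hv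
      exact Finset.mem_map_of_mem _ (h i hi j hj ((pullback_parent_eq_some F e i j).2 hvw))
  unfold conv
  rw [this, Finset.sum_map]
  refine Finset.sum_congr rfl fun R _ => ?_
  simp only [RelEmbedding.coe_toEmbedding, Finset.mapEmbedding_apply, Finset.map_sdiff]

end Forest

/-! ### Regularized tree integrals of sub-forests -/

section Integrals

open Forest

variable {d : ℕ} (P : DyadicPartition) (Z : RegDomains d) (Γ : Fin d → ℝ → ℝ) {n m : ℕ}

/-! ### Invariance under increasing renumbering, and the convolution identity. -/

theorem regSkeletonTree_eq (F : Forest n) (ℓ : Fin n → Fin d) (κ k : Fin n → ℤ)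
    (S : Finset (Fin n)) (t : ℝ) (h : S.card = m) :
    regSkeletonTree P Z Γ F ℓ κ k S t =
      regSkeleton P Z Γ (F.pullback (S.orderEmbOfFin h)) (fun v => ℓ (S.orderEmbOfFin h v))
        (fun v => κ (S.orderEmbOfFin h v)) (fun v => k (S.orderEmbOfFin h v)) t := by
  subst h
  rw [regSkeletonTree, restrict_eq_pullback]

theorem regSkeletonTree_map (F : Forest n) (ℓ : Fin n → Fin d) (κ k : Fin n → ℤ)
    (e : Fin m ↪o Fin n) (U : Finset (Fin m)) (t : ℝ) :
    regSkeletonTree P Z Γ F ℓ κ k (U.map e.toEmbedding) t =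
      regSkeletonTree P Z Γ (F.pullback e) (fun v => ℓ (e v)) (fun v => κ (e v))
        (fun v => k (e v)) U t := by
  have h : (U.map e.toEmbedding).card = U.card := Finset.card_map _
  have he : (U.map e.toEmbedding).orderEmbOfFin h = (U.orderEmbOfFin rfl).trans e := by
    symm
    refine Finset.orderEmbOfFin_unique' _ fun i => ?_
    simp
  rw [regSkeletonTree_eq P Z Γ F ℓ κ k _ t h, regSkeletonTree_eq P Z Γ _ _ _ _ U t rfl, he,
    pullback_pullback]
  rfl

theorem regSkeletonTree_univ (F : Forest n) (ℓ : Fin n → Fin d) (κ k : Fin n → ℤ) (t : ℝ) :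
    regSkeletonTree P Z Γ F ℓ κ k Finset.univ t = regSkeleton P Z Γ F ℓ κ k t := by
  have he : (Finset.univ : Finset (Fin n)).orderEmbOfFin (Finset.card_fin n) =
      RelEmbedding.refl _ := by
    symm
    exact Finset.orderEmbOfFin_unique' _ fun i => Finset.mem_univ _
  rw [regSkeletonTree_eq P Z Γ F ℓ κ k _ t (Finset.card_fin n), he]
  have : F.pullback (RelEmbedding.refl _) = F :=
    eq_of_parent_eq_some_iff fun i j => pullback_parent_eq_some F _ i j
  rw [this]
  rfl

theorem regSkeletonForest_map (F : Forest n) (ℓ : Fin n → Fin d) (κ k : Fin n → ℤ)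
    (e : Fin m ↪o Fin n) (U : Finset (Fin m)) (t : ℝ) :
    regSkeletonForest P Z Γ F ℓ κ k (U.map e.toEmbedding) t =
      regSkeletonForest P Z Γ (F.pullback e) (fun v => ℓ (e v)) (fun v => κ (e v))
        (fun v => k (e v)) U t := by
  have h := multExt_map (F := F) e (fun S => regSkeletonTree P Z Γ F ℓ κ k S t) U
  simp only [regSkeletonTree_map] at h
  exact h

/-- The regularized integral of the sub-forest of `F` with vertex set `S`. -/
noncomputable def regSubforestIntegral (F : Forest n) (ℓ : Fin n → Fin d) (κ k : Fin n → ℤ)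
    (t s : ℝ) (S : Finset (Fin n)) : ℂ :=
  F.multExt (regTreeIntegral P Z Γ F ℓ κ k t s) S

theorem regForestIntegral_eq (F : Forest n) (ℓ : Fin n → Fin d) (κ k : Fin n → ℤ) (t s : ℝ) :
    regForestIntegral P Z Γ F ℓ κ k t s =
      regSubforestIntegral P Z Γ F ℓ κ k t s Finset.univ := rfl

theorem regSkeletonForest_empty (F : Forest n) (ℓ : Fin n → Fin d) (κ k : Fin n → ℤ) (t : ℝ) :
    regSkeletonForest P Z Γ F ℓ κ k ∅ t = 1 :=
  multExt_empty (F := F) fun S => regSkeletonTree P Z Γ F ℓ κ k S t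

theorem regSubforestIntegral_empty (F : Forest n) (ℓ : Fin n → Fin d) (κ k : Fin n → ℤ)
    (t s : ℝ) : regSubforestIntegral P Z Γ F ℓ κ k t s ∅ = 1 :=
  multExt_empty _

theorem regSubforestIntegral_union {F : Forest n} (ℓ : Fin n → Fin d) (κ k : Fin n → ℤ)
    (t s : ℝ) {S T : Finset (Fin n)} (h : F.Separated S T) :
    regSubforestIntegral P Z Γ F ℓ κ k t s (S ∪ T) =
      regSubforestIntegral P Z Γ F ℓ κ k t s S * regSubforestIntegral P Z Γ F ℓ κ k t s T :=
  multExt_union _ h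

theorem regSkeletonForest_union {F : Forest n} (ℓ : Fin n → Fin d) (κ k : Fin n → ℤ)
    (t : ℝ) {S T : Finset (Fin n)} (h : F.Separated S T) :
    regSkeletonForest P Z Γ F ℓ κ k (S ∪ T) t =
      regSkeletonForest P Z Γ F ℓ κ k S t * regSkeletonForest P Z Γ F ℓ κ k T t :=
  multExt_union (fun S => regSkeletonTree P Z Γ F ℓ κ k S t) h

/-- For a tree this is the defining recursion with the cut terms moved to the other side. Both sides
are multiplicative over components, which extends it to forests. -/
theorem conv_regSubforestIntegral (F : Forest n) (ℓ : Fin n → Fin d) (κ k : Fin n → ℤ)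
    (t s : ℝ) (S : Finset (Fin n)) :
    F.conv (regSubforestIntegral P Z Γ F ℓ κ k t s)
        (fun R => regSkeletonForest P Z Γ F ℓ κ k R s) S =
      regSkeletonForest P Z Γ F ℓ κ k S t := by
  have h1 := regSubforestIntegral_empty P Z Γ F ℓ κ k t s
  have h2 := regSkeletonForest_empty P Z Γ F ℓ κ k s
  refine F.subforest_induction (Q := fun S => F.conv (regSubforestIntegral P Z Γ F ℓ κ k t s)
    (fun R => regSkeletonForest P Z Γ F ℓ κ k R s) S = regSkeletonForest P Z Γ F ℓ κ k S t)
    ?_ (fun S r hr => ?_) (fun S T hST hS hT => ?_) S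
  · have : lowerSets F.parent ∅ = {∅} := by simp [lowerSets]
    rw [regSkeletonForest_empty, conv, this, Finset.sum_singleton, h1, Finset.sdiff_empty, h2,
      one_mul]
  · rw [conv_tree (r := r) h1 h2 hr]
    have e1 : ∀ t', regSkeletonForest P Z Γ F ℓ κ k S t' = regSkeletonTree P Z Γ F ℓ κ k S t' :=
      fun t' => multExt_tree (fun S => regSkeletonTree P Z Γ F ℓ κ k S t') hr
    have e2 : ∀ S', F.roots S' = {r} → regSubforestIntegral P Z Γ F ℓ κ k t s S' =
      regTreeIntegral P Z Γ F ℓ κ k t s S' := fun S' hS' => multExt_tree _ hS'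
    have e3 : ∑ c ∈ F.cuts S, regSubforestIntegral P Z Γ F ℓ κ k t s (F.roo S c) *
        regSkeletonForest P Z Γ F ℓ κ k (F.lea S c) s =
        ∑ c ∈ F.cuts S, regTreeIntegral P Z Γ F ℓ κ k t s (F.roo S c) *
        regSkeletonForest P Z Γ F ℓ κ k (F.lea S c) s :=
      Finset.sum_congr rfl fun c hc => by rw [e2 _ (roots_roo (mem_cuts.1 hc).1 hr)]
    rw [e3, e1, e1, e2 S hr, regTreeIntegral, ← Finset.sum_attach (F.cuts S)]
    ring
  · rw [conv_union (fun _ _ h => regSubforestIntegral_union P Z Γ ℓ κ k t s h)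
      (fun _ _ h => regSkeletonForest_union P Z Γ ℓ κ k s h) hST, hS, hT,
      regSkeletonForest_union P Z Γ ℓ κ k t hST]

/-- The convolution identity determines the integral, so the renumbering of skeleton integrals
suffices and the recursion need not be unfolded. -/
theorem regSubforestIntegral_map (F : Forest n) (ℓ : Fin n → Fin d) (κ k : Fin n → ℤ)
    (e : Fin m ↪o Fin n) (t s : ℝ) (U : Finset (Fin m)) :
    regSubforestIntegral P Z Γ F ℓ κ k t s (U.map e.toEmbedding) =
      regSubforestIntegral P Z Γ (F.pullback e) (fun v => ℓ (e v)) (fun v => κ (e v))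
        (fun v => k (e v)) t s U := by
  refine eq_of_conv_eq (F := F.pullback e)
    (X := fun U => regSubforestIntegral P Z Γ F ℓ κ k t s (U.map e.toEmbedding))
    (Y := fun U => regSkeletonForest P Z Γ (F.pullback e) (fun v => ℓ (e v)) (fun v => κ (e v))
        (fun v => k (e v)) U s) (regSkeletonForest_empty P Z Γ _ _ _ _ s) (fun U => ?_) U
  rw [conv_regSubforestIntegral, ← regSkeletonForest_map P Z Γ F ℓ κ k e U t,
    ← conv_regSubforestIntegral P Z Γ F ℓ κ k t s, conv_map]
  simp only [regSkeletonForest_map]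

theorem regSubforestIntegral_map_univ (F : Forest n) (ℓ : Fin n → Fin d) (κ k : Fin n → ℤ)
    (e : Fin m ↪o Fin n) (t s : ℝ) :
    regSubforestIntegral P Z Γ F ℓ κ k t s (Finset.univ.map e.toEmbedding) =
      regForestIntegral P Z Γ (F.pullback e) (fun v => ℓ (e v)) (fun v => κ (e v))
        (fun v => k (e v)) t s :=
  regSubforestIntegral_map P Z Γ F ℓ κ k e t s Finset.univ

theorem regSubforestIntegral_congr {F G : Forest n} (ℓ : Fin n → Fin d) (κ k : Fin n → ℤ)
    (t s : ℝ) {S : Finset (Fin n)}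
    (h : ∀ v ∈ S, ∀ w ∈ S, F.parent v = some w ↔ G.parent v = some w) :
    regSubforestIntegral P Z Γ F ℓ κ k t s S = regSubforestIntegral P Z Γ G ℓ κ k t s S := by
  have hS : S = Finset.univ.map (S.orderEmbOfFin rfl).toEmbedding := by
    simp
  have hFG : F.pullback (S.orderEmbOfFin rfl) = G.pullback (S.orderEmbOfFin rfl) := by
    refine eq_of_parent_eq_some_iff fun i j => ?_
    rw [pullback_parent_eq_some, pullback_parent_eq_some]
    exact h _ (Finset.orderEmbOfFin_mem _ _ _) _ (Finset.orderEmbOfFin_mem _ _ _)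
  rw [hS, regSubforestIntegral_map_univ, regSubforestIntegral_map_univ, hFG]

/-- The Chen property of the regularized integrals of a fixed forest. -/
theorem regSubforestIntegral_chen (F : Forest n) (ℓ : Fin n → Fin d) (κ k : Fin n → ℤ)
    (t u s : ℝ) (S : Finset (Fin n)) :
    regSubforestIntegral P Z Γ F ℓ κ k t s S =
      F.conv (regSubforestIntegral P Z Γ F ℓ κ k t u)
        (regSubforestIntegral P Z Γ F ℓ κ k u s) S := by
  refine eq_of_conv_eq (F := F) (Y := fun R => regSkeletonForest P Z Γ F ℓ κ k R s)
    (regSkeletonForest_empty P Z Γ F ℓ κ k s) (fun S => ?_) S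
  -- Convolving the right side with S^s gives I^{tu} * (I^{us} * S^s) = I^{tu} * S^u = S^t, the same
  -- as for the left side.
  have h : F.conv (regSubforestIntegral P Z Γ F ℓ κ k u s)
      (fun R => regSkeletonForest P Z Γ F ℓ κ k R s) =
        fun R => regSkeletonForest P Z Γ F ℓ κ k R u :=
    funext (conv_regSubforestIntegral P Z Γ F ℓ κ k u s)
  rw [conv_assoc, h, conv_regSubforestIntegral, conv_regSubforestIntegral]

/-- The forest with parent function `p`, where edges that are not decreasing are cut. -/
def Forest.ofParent (p : Fin n → Option (Fin n)) : Forest n where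
  parent v := (p v).filter fun w => decide (w < v)
  parent_lt := by
    intro v w h
    simpa using (Option.filter_eq_some_iff.1 h).2

theorem Forest.ofParent_parent_eq_some {p : Fin n → Option (Fin n)} {v w : Fin n} :
    (Forest.ofParent p).parent v = some w ↔ p v = some w ∧ w < v := by
  simp [Forest.ofParent, Option.filter_eq_some_iff]

theorem Forest.ofParent_parent (F : Forest n) : Forest.ofParent F.parent = F :=
  eq_of_parent_eq_some_iff fun i j => by
    rw [Forest.ofParent_parent_eq_some]
    exact ⟨fun h => h.1, fun h => ⟨h, F.parent_lt _ _ h⟩⟩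

theorem Forest.ofParent_pullback {p : Fin n → Option (Fin n)} (e : Fin m ↪o Fin n)
    {q : Fin m → Option (Fin m)} (h : ∀ i, p (e i) = (q i).map e) :
    (Forest.ofParent p).pullback e = Forest.ofParent q := by
  refine eq_of_parent_eq_some_iff fun i j => ?_
  rw [pullback_parent_eq_some, Forest.ofParent_parent_eq_some, Forest.ofParent_parent_eq_some, h,
    e.lt_iff_lt]
  simp

/-- The signed sum, over the forests attached to the word `L`, of the regularized integrals. -/
noncomputable def wordIntegral (L : List (Fin n)) (ℓ : Fin n → Fin d) (κ k : Fin n → ℤ)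
    (t s : ℝ) : ℂ :=
  permSum L (fun p => regForestIntegral P Z Γ (Forest.ofParent p) ℓ κ k t s) fun _ => none

/-- Each signed sum sets parents in its own block only, and within that block. A summand that
factors over the two blocks therefore gives a product of signed sums. -/
theorem permSum_permSum_eq_mul {m₁ m₂ : ℕ} (r₁ : Fin m₁ ↪o Fin n) (r₂ : Fin m₂ ↪o Fin n)
    {l₁ : List (Fin m₁)} {l₂ : List (Fin m₂)} (h₁ : l₁.Nodup) (h₂ : l₂.Nodup)
    (hdisj : ∀ i j, r₁ i ≠ r₂ j) (f : (Fin n → Option (Fin n)) → ℂ)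
    (g₁ : (Fin m₁ → Option (Fin m₁)) → ℂ) (g₂ : (Fin m₂ → Option (Fin m₂)) → ℂ)
    (p : Fin n → Option (Fin n)) (q₁ : Fin m₁ → Option (Fin m₁)) (q₂ : Fin m₂ → Option (Fin m₂))
    (h : ∀ p q₁ q₂, (∀ i ∈ l₁, p (r₁ i) = (q₁ i).map r₁) → (∀ i ∈ l₂, p (r₂ i) = (q₂ i).map r₂) →
      f p = g₁ q₁ * g₂ q₂) :
    permSum (l₁.map r₁) (permSum (l₂.map r₂) f) p = permSum l₁ g₁ q₁ * permSum l₂ g₂ q₂ := by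
  rw [← permSum_mul_const]
  refine permSum_map r₁ l₁ h₁ _ _ _ _ fun p' q' hp' _ => ?_
  rw [← permSum_const_mul]
  refine permSum_map r₂ l₂ h₂ _ _ _ _ fun p'' q'' hp'' hp3 => ?_
  refine h p'' q' q'' (fun i hi => ?_) hp''
  rw [hp3, hp' i hi]
  intro hmem
  obtain ⟨j, -, hj⟩ := List.mem_map.1 hmem
  exact hdisj i j hj.symm

variable {m₁ m₂ : ℕ} (r₁ : Fin m₁ ↪o Fin n) (r₂ : Fin m₂ ↪o Fin n)

theorem wordIntegral_mul_wordIntegral {l₁ : List (Fin m₁)} {l₂ : List (Fin m₂)}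
    (h₁ : l₁.Nodup) (h₂ : l₂.Nodup) (hl₁ : ∀ i, i ∈ l₁) (hl₂ : ∀ i, i ∈ l₂)
    (hdisj : ∀ i j, r₁ i ≠ r₂ j) (hcover : ∀ v, v ∈ Set.range r₁ ∨ v ∈ Set.range r₂)
    (ℓ : Fin n → Fin d) (κ k : Fin n → ℤ) (t s : ℝ) :
    ((shuffles (l₁.map r₁) (l₂.map r₂)).map fun L => wordIntegral P Z Γ L ℓ κ k t s).sum =
      wordIntegral P Z Γ l₁ (fun v => ℓ (r₁ v)) (fun v => κ (r₁ v)) (fun v => k (r₁ v)) t s *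
        wordIntegral P Z Γ l₂ (fun v => ℓ (r₂ v)) (fun v => κ (r₂ v)) (fun v => k (r₂ v)) t s := by
  have hnd : (l₁.map r₁ ++ l₂.map r₂).Nodup := by
    rw [List.nodup_append]
    refine ⟨h₁.map r₁.injective, h₂.map r₂.injective, fun a ha b hb => ?_⟩
    obtain ⟨i, -, rfl⟩ := List.mem_map.1 ha
    obtain ⟨j, -, rfl⟩ := List.mem_map.1 hb
    exact hdisj i j
  unfold wordIntegral
  rw [sum_shuffles_permSum _ _ hnd]
  refine permSum_permSum_eq_mul r₁ r₂ h₁ h₂ hdisj _ _ _ _ _ _ fun p q₁ q₂ hq₁ hq₂ => ?_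
  have hsep : (Forest.ofParent p).Separated (Finset.univ.map r₁.toEmbedding)
      (Finset.univ.map r₂.toEmbedding) := by
    refine ⟨?_, ?_⟩
    · rw [Finset.disjoint_left]
      simp only [Finset.mem_map, Finset.mem_univ, true_and, RelEmbedding.coe_toEmbedding]
      rintro _ ⟨i, rfl⟩ ⟨j, hj⟩
      exact hdisj i j hj.symm
    · simp only [Finset.mem_map, Finset.mem_univ, true_and, RelEmbedding.coe_toEmbedding, ne_eq,
        Forest.ofParent_parent_eq_some]
      rintro _ ⟨i, rfl⟩ _ ⟨j, rfl⟩
      rw [hq₁ i (hl₁ i), hq₂ j (hl₂ j)]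
      simp only [Option.map_eq_some_iff]
      exact ⟨fun ⟨⟨a, _, ha⟩, _⟩ => hdisj a j ha, fun ⟨⟨a, _, ha⟩, _⟩ => hdisj i a ha.symm⟩
  have huniv : (Finset.univ : Finset (Fin n)) =
      Finset.univ.map r₁.toEmbedding ∪ Finset.univ.map r₂.toEmbedding := by
    ext v
    have := hcover v
    simpa using this
  rw [regForestIntegral_eq, huniv, regSubforestIntegral_union P Z Γ ℓ κ k t s hsep,
    regSubforestIntegral_map_univ, regSubforestIntegral_map_univ,
    Forest.ofParent_pullback r₁ (fun i => hq₁ i (hl₁ i)),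
    Forest.ofParent_pullback r₂ (fun i => hq₂ i (hl₂ i))]

/-- One term of the deconcatenation. -/
theorem wordIntegral_split {l₁ : List (Fin m₁)} {l₂ : List (Fin m₂)}
    (h₁ : l₁.Nodup) (h₂ : l₂.Nodup) (hl₁ : ∀ i, i ∈ l₁) (hl₂ : ∀ i, i ∈ l₂)
    (hdisj : ∀ i j, r₁ i ≠ r₂ j) (hcover : ∀ v, v ∈ Set.range r₁ ∨ v ∈ Set.range r₂)
    (ℓ : Fin n → Fin d) (κ k : Fin n → ℤ) (t u s : ℝ) :
    permSum (l₁.map r₁) (permSum (l₂.map r₂) fun q =>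
        regSubforestIntegral P Z Γ (Forest.ofParent q) ℓ κ k t u (l₁.map r₁).toFinset *
          regSubforestIntegral P Z Γ (Forest.ofParent q) ℓ κ k u s
            (Finset.univ \ (l₁.map r₁).toFinset)) (fun _ => none) =
      wordIntegral P Z Γ l₁ (fun v => ℓ (r₁ v)) (fun v => κ (r₁ v)) (fun v => k (r₁ v)) t u *
        wordIntegral P Z Γ l₂ (fun v => ℓ (r₂ v)) (fun v => κ (r₂ v)) (fun v => k (r₂ v)) u s := by
  unfold wordIntegral
  refine permSum_permSum_eq_mul r₁ r₂ h₁ h₂ hdisj _ _ _ _ _ _ fun p q₁ q₂ hq₁ hq₂ => ?_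
  have e1 : (l₁.map r₁).toFinset = Finset.univ.map r₁.toEmbedding := by
    ext v
    simp [hl₁]
  have e2 : Finset.univ \ Finset.univ.map r₁.toEmbedding = Finset.univ.map r₂.toEmbedding := by
    ext v
    simp only [Finset.mem_sdiff, Finset.mem_univ, Finset.mem_map, true_and,
      RelEmbedding.coe_toEmbedding]
    constructor
    · exact fun h => (hcover v).resolve_left h
    · rintro ⟨j, rfl⟩ ⟨i, hi⟩
      exact hdisj i j hi
  rw [e1, e2, regSubforestIntegral_map_univ, regSubforestIntegral_map_univ,
    Forest.ofParent_pullback r₁ (fun i => hq₁ i (hl₁ i)),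
    Forest.ofParent_pullback r₂ (fun i => hq₂ i (hl₂ i))]

/-- The Chen property for the signed sum of the regularized integrals over the forests attached to
a word. -/
theorem wordIntegral_chen (L : List (Fin n)) (hnd : L.Nodup) (hL : ∀ i, i ∈ L)
    (ℓ : Fin n → Fin d) (κ k : Fin n → ℤ) (t u s : ℝ) :
    wordIntegral P Z Γ L ℓ κ k t s = ∑ j ∈ Finset.range (L.length + 1),
      permSum (L.take j) (permSum (L.drop j) fun q =>
        regSubforestIntegral P Z Γ (Forest.ofParent q) ℓ κ k t u (L.take j).toFinset *
          regSubforestIntegral P Z Γ (Forest.ofParent q) ℓ κ k u s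
            (Finset.univ \ (L.take j).toFinset)) fun _ => none := by
  rw [wordIntegral]
  refine Eq.trans (permSum_congr fun c => ?_) (permSum_sum_lowerSets L hnd fun R q =>
    regSubforestIntegral P Z Γ (Forest.ofParent q) ℓ κ k t u R *
      regSubforestIntegral P Z Γ (Forest.ofParent q) ℓ κ k u s (Finset.univ \ R))
  have huniv : L.toFinset = Finset.univ := by
    ext v; simp [hL]
  generalize hp : wordParent L c (fun _ => none) = p
  -- In a word containing all vertices every parent is a smaller letter, so `ofParent` removes no
  -- edge.
  have hpar : (Forest.ofParent p).parent = p := by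
    funext v
    refine Option.ext fun w => ?_
    rw [Forest.ofParent_parent_eq_some]
    refine ⟨fun h => h.1, fun h => ⟨h, ?_⟩⟩
    rw [← hp] at h
    exact (wordParent_spec (hL v) h).2
  rw [regForestIntegral_eq, regSubforestIntegral_chen P Z Γ _ ℓ κ k t u s, conv, hpar, huniv]
  refine Finset.sum_congr rfl fun R _ => ?_
  congr 1
  · refine regSubforestIntegral_congr P Z Γ ℓ κ k t u fun v hv w hw => ?_
    simp [Forest.ofParent_parent_eq_some, cutParent, hv]
  · refine regSubforestIntegral_congr P Z Γ ℓ κ k u s fun v hv w hw => ?_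
    have hv' := (Finset.mem_sdiff.1 hv).2
    have hw' := (Finset.mem_sdiff.1 hw).2
    simp [Forest.ofParent_parent_eq_some, cutParent, hv', Option.filter_eq_some_iff, hw']

end Integrals

/-! ### Words and permutation graphs -/

section Perm

variable {n : ℕ}

theorem leftParent_append_cons {V : Type*} [LinearOrder V] {A B : List V} {v : V} (h : v ∉ A) :
    leftParent (A ++ v :: B) v = A.reverse.find? fun x => decide (x < v) := by
  unfold leftParent
  have h1 : ∀ a ∈ A, decide (a ≠ v) = true := by
    intro a ha
    simp only [decide_eq_true_eq]
    rintro rfl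
    exact h ha
  rw [List.takeWhile_append_of_pos h1, List.takeWhile_cons_of_neg (by simp), List.append_nil]

theorem rightParent_append_cons {V : Type*} [LinearOrder V] {A B : List V} {v : V} (h : v ∉ A) :
    rightParent (A ++ v :: B) v = B.find? fun x => decide (x < v) := by
  unfold rightParent
  have h1 : ∀ a ∈ A, decide (a ≠ v) = true := by
    intro a ha
    simp only [decide_eq_true_eq]
    rintro rfl
    exact h ha
  rw [List.dropWhile_append_of_pos h1, List.dropWhile_cons_of_neg (by simp),
    List.find?_cons_of_neg (by simp)]

theorem pairwise_ofFn_symm (σ : Equiv.Perm (Fin n)) :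
    (List.ofFn σ.symm).Pairwise fun a b => σ a < σ b := by
  rw [List.pairwise_ofFn]
  intro i j hij
  simpa using hij

theorem mem_ofFn_symm (σ : Equiv.Perm (Fin n)) (j : Fin n) : j ∈ List.ofFn σ.symm :=
  List.mem_ofFn.2 ⟨σ j, by simp⟩

theorem nodup_ofFn_symm (σ : Equiv.Perm (Fin n)) : (List.ofFn σ.symm).Nodup :=
  List.nodup_ofFn.2 σ.symm.injective

theorem upperBound_spec (σ : Equiv.Perm (Fin n)) (j : Fin n) :
    (upperBound σ j = none ∧ ∀ k, k < j → ¬ σ k < σ j) ∨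
      ∃ i, upperBound σ j = some i ∧ i < j ∧ σ i < σ j ∧ ∀ k, k < j → σ k < σ j → σ k ≤ σ i := by
  have hmem : ∀ k, k ∈ leftRanks σ j ↔ k < j ∧ σ k < σ j := fun k => by simp [leftRanks]
  by_cases h : ((leftRanks σ j).image σ).Nonempty
  · right
    obtain ⟨i, hi, hi'⟩ := Finset.mem_image.1 (Finset.max'_mem _ h)
    refine ⟨i, ?_, ((hmem i).1 hi).1, ((hmem i).1 hi).2, fun k h1 h2 => ?_⟩
    · rw [upperBound, dif_pos h, ← hi', Equiv.symm_apply_apply]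
    · rw [hi']
      exact Finset.le_max' _ _ (Finset.mem_image_of_mem _ ((hmem k).2 ⟨h1, h2⟩))
  · left
    refine ⟨dif_neg h, fun k h1 h2 => h ?_⟩
    exact ⟨_, Finset.mem_image_of_mem _ ((hmem k).2 ⟨h1, h2⟩)⟩

theorem lowerBound_spec (σ : Equiv.Perm (Fin n)) (j : Fin n) :
    (lowerBound σ j = none ∧ ∀ k, k < j → ¬ σ j < σ k) ∨
      ∃ i, lowerBound σ j = some i ∧ i < j ∧ σ j < σ i ∧ ∀ k, k < j → σ j < σ k → σ i ≤ σ k := by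
  have hmem : ∀ k, k ∈ rightRanks σ j ↔ k < j ∧ σ j < σ k := fun k => by simp [rightRanks]
  by_cases h : ((rightRanks σ j).image σ).Nonempty
  · right
    obtain ⟨i, hi, hi'⟩ := Finset.mem_image.1 (Finset.min'_mem _ h)
    refine ⟨i, ?_, ((hmem i).1 hi).1, ((hmem i).1 hi).2, fun k h1 h2 => ?_⟩
    · rw [lowerBound, dif_pos h, ← hi', Equiv.symm_apply_apply]
    · rw [hi']
      exact Finset.min'_le _ _ (Finset.mem_image_of_mem _ ((hmem k).2 ⟨h1, h2⟩))
  · left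
    refine ⟨dif_neg h, fun k h1 h2 => h ?_⟩
    exact ⟨_, Finset.mem_image_of_mem _ ((hmem k).2 ⟨h1, h2⟩)⟩

/-- The word lists ranks by position, so the letters to the left of `j` are the `k` with `σ k < σ
j`. Among those with `k < j`, the nearest has the largest `σ k`. -/
theorem leftParent_ofFn_symm (σ : Equiv.Perm (Fin n)) (j : Fin n) :
    leftParent (List.ofFn σ.symm) j = upperBound σ j := by
  have hpw := pairwise_ofFn_symm σ
  have hall := mem_ofFn_symm σ
  obtain ⟨A, B, hAB⟩ := List.append_of_mem (hall j)
  rw [hAB] at hpw hall ⊢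
  rw [List.pairwise_append, List.pairwise_cons] at hpw
  obtain ⟨hA, ⟨hjB, -⟩, hAj⟩ := hpw
  have hmemA : ∀ k, k ∈ A ↔ σ k < σ j := by
    intro k
    refine ⟨fun h => hAj k h j (by simp), fun h => ?_⟩
    rcases List.mem_append.1 (hall k) with h' | h'
    · exact h'
    · rcases List.mem_cons.1 h' with rfl | h'
      · exact absurd h (lt_irrefl _)
      · exact absurd (hjB k h') h.asymm
  rw [leftParent_append_cons fun h => lt_irrefl _ ((hmemA j).1 h)]
  rcases hf : A.reverse.find? (fun x => decide (x < j)) with _ | i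
  · rw [List.find?_eq_none] at hf
    rcases upperBound_spec σ j with ⟨h, -⟩ | ⟨i, -, h1, h2, -⟩
    · exact h.symm
    · exact absurd h1 (by simpa using hf i (List.mem_reverse.2 ((hmemA i).2 h2)))
  · obtain ⟨hij, X, Y, hXY, hX⟩ := List.find?_eq_some_iff_append.1 hf
    have hA' : A = Y.reverse ++ i :: X.reverse := by
      rw [← List.reverse_reverse A, hXY]; simp
    have hij' : i < j := by simpa using hij
    have hiA : i ∈ A := by simp [hA']
    rcases upperBound_spec σ j with ⟨-, h⟩ | ⟨i', h, h1, h2, h3⟩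
    · exact absurd ((hmemA i).1 hiA) (h i hij')
    · rw [h]
      have hle := h3 i hij' ((hmemA i).1 hiA)
      have hi'A := (hmemA i').2 h2
      rw [hA'] at hi'A hA
      rw [List.pairwise_append] at hA
      rcases List.mem_append.1 hi'A with h' | h'
      · exact absurd (hA.2.2 i' h' i (by simp)) (not_lt.2 hle)
      · rcases List.mem_cons.1 h' with rfl | h'
        · rfl
        · have := hX i' (List.mem_reverse.1 h')
          simp only [Bool.not_eq_eq_eq_not, Bool.not_true, decide_eq_false_iff_not] at this
          exact absurd h1 this

theorem rightParent_ofFn_symm (σ : Equiv.Perm (Fin n)) (j : Fin n) :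
    rightParent (List.ofFn σ.symm) j = lowerBound σ j := by
  have hpw := pairwise_ofFn_symm σ
  have hall := mem_ofFn_symm σ
  obtain ⟨A, B, hAB⟩ := List.append_of_mem (hall j)
  rw [hAB] at hpw hall ⊢
  rw [List.pairwise_append, List.pairwise_cons] at hpw
  obtain ⟨-, ⟨hjB, hB⟩, hAj⟩ := hpw
  have hmemA : ∀ k, k ∈ A → σ k < σ j := fun k h => hAj k h j (by simp)
  have hmemB : ∀ k, k ∈ B ↔ σ j < σ k := by
    intro k
    refine ⟨fun h => hjB k h, fun h => ?_⟩
    rcases List.mem_append.1 (hall k) with h' | h'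
    · exact absurd (hmemA k h') h.asymm
    · rcases List.mem_cons.1 h' with rfl | h'
      · exact absurd h (lt_irrefl _)
      · exact h'
  rw [rightParent_append_cons fun h => lt_irrefl _ (hmemA j h)]
  rcases hf : B.find? (fun x => decide (x < j)) with _ | i
  · rw [List.find?_eq_none] at hf
    rcases lowerBound_spec σ j with ⟨h, -⟩ | ⟨i, -, h1, h2, -⟩
    · exact h.symm
    · exact absurd h1 (by simpa using hf i ((hmemB i).2 h2))
  · obtain ⟨hij, X, Y, hXY, hX⟩ := List.find?_eq_some_iff_append.1 hf
    have hij' : i < j := by simpa using hij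
    have hiB : i ∈ B := by simp [hXY]
    rcases lowerBound_spec σ j with ⟨-, h⟩ | ⟨i', h, h1, h2, h3⟩
    · exact absurd ((hmemB i).1 hiB) (h i hij')
    · rw [h]
      have hle := h3 i hij' ((hmemB i).1 hiB)
      have hi'B := (hmemB i').2 h2
      rw [hXY] at hi'B hB
      rw [List.pairwise_append, List.pairwise_cons] at hB
      rcases List.mem_append.1 hi'B with h' | h'
      · have := hX i' h'
        simp only [Bool.not_eq_eq_eq_not, Bool.not_true, decide_eq_false_iff_not] at this
        exact absurd h1 this
      · rcases List.mem_cons.1 h' with rfl | h'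
        · rfl
        · exact absurd (hB.2.1.1 i' h') (not_lt.2 hle)

/-- The permutation graph of `σ` is the signed sum of forests attached to the word of the ranks. -/
theorem sum_permForest (σ : Equiv.Perm (Fin n)) (G : Forest n → ℂ) :
    ∑ c ∈ (splitRanks σ).powerset, (-1) ^ c.card * G (permForest σ c) =
      permSum (List.ofFn σ.symm) (fun p => G (Forest.ofParent p)) fun _ => none := by
  have h1 : splitLetters (List.ofFn σ.symm) = splitRanks σ := by
    ext j
    simp only [splitLetters, splitRanks, Finset.mem_filter, List.mem_toFinset, mem_ofFn_symm,
      Finset.mem_univ, rightParent_ofFn_symm]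
  have h2 : ∀ c, wordParent (List.ofFn σ.symm) c (fun _ => none) = (permForest σ c).parent := by
    intro c
    funext j
    simp only [wordParent, mem_ofFn_symm, if_true, rightParent_ofFn_symm, leftParent_ofFn_symm,
      permForest]
  unfold permSum
  rw [h1]
  exact Finset.sum_congr rfl fun c _ => by
    rw [h2]
    simp only [Forest.ofParent_parent]

end Perm

/-! ### Averages over the orderings compatible with `κ` -/

section Average

variable {n m₁ m₂ : ℕ}

open Classical in
/-- The permutations which order `κ`. -/
noncomputable def orderings (κ : Fin n → ℤ) : Finset (Equiv.Perm (Fin n)) :=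
  Finset.univ.filter fun σ => FourierOrdered fun v => κ (σ v)

open Classical in
/-- The permutations which leave `|κ|` invariant. -/
noncomputable def symmetries (κ : Fin n → ℤ) : Finset (Equiv.Perm (Fin n)) :=
  Finset.univ.filter fun τ => ∀ j, |κ (τ j)| = |κ j|

/-- The average of `f` over the permutations which order `κ`. -/
noncomputable def average (κ : Fin n → ℤ) (f : Equiv.Perm (Fin n) → ℂ) : ℂ :=
  ((symCount κ : ℕ) : ℂ)⁻¹ * ∑ σ ∈ orderings κ, f σ

theorem mem_orderings {κ : Fin n → ℤ} {σ : Equiv.Perm (Fin n)} :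
    σ ∈ orderings κ ↔ FourierOrdered fun v => κ (σ v) := by
  simp [orderings]

theorem mem_symmetries {κ : Fin n → ℤ} {τ : Equiv.Perm (Fin n)} :
    τ ∈ symmetries κ ↔ ∀ j, |κ (τ j)| = |κ j| := by
  simp [symmetries]

theorem fourierOrdered_iff_monotone {κ : Fin n → ℤ} :
    FourierOrdered κ ↔ Monotone fun v => |κ v| := by
  constructor
  · intro h v w hvw
    rcases hvw.eq_or_lt with rfl | hlt
    · exact le_rfl
    · exact h v w hlt
  · exact fun h v w hvw => h hvw.le

theorem symCount_eq_card (κ : Fin n → ℤ) : symCount κ = (symmetries κ).card := by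
  classical
  rw [symCount, Nat.card_eq_fintype_card, Fintype.card_subtype, symmetries]

theorem symCount_ne_zero (κ : Fin n → ℤ) : ((symCount κ : ℕ) : ℂ) ≠ 0 := by
  rw [symCount_eq_card, Nat.cast_ne_zero]
  exact Finset.card_ne_zero_of_mem
    (mem_symmetries.2 fun j => rfl : (1 : Equiv.Perm (Fin n)) ∈ symmetries κ)

/-- The two symmetry groups are conjugate by `σ`. -/
theorem symCount_comp (κ : Fin n → ℤ) (σ : Equiv.Perm (Fin n)) :
    symCount (fun v => κ (σ v)) = symCount κ := by
  unfold symCount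
  refine Nat.card_congr ((σ.permCongr).subtypeEquiv fun τ => ?_)
  constructor
  · intro h j
    simpa using h (σ.symm j)
  · intro h j
    simpa using h (σ j)

theorem mul_mem_orderings {κ : Fin n → ℤ} {τ σ : Equiv.Perm (Fin n)} (hτ : τ ∈ symmetries κ) :
    τ * σ ∈ orderings κ ↔ σ ∈ orderings κ := by
  rw [mem_symmetries] at hτ
  simp only [mem_orderings, FourierOrdered, Equiv.Perm.mul_apply, hτ]

/-- The orderings form one coset of the symmetry group: the monotone rearrangement of `|κ|` is
unique, so two orderings differ by a permutation preserving `|κ|`. -/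
theorem sum_orderings {κ : Fin n → ℤ} {σ : Equiv.Perm (Fin n)} (hσ : σ ∈ orderings κ)
    (f : Equiv.Perm (Fin n) → ℂ) :
    ∑ σ' ∈ orderings κ, f σ' = ∑ τ ∈ symmetries κ, f (τ * σ) := by
  symm
  refine Finset.sum_bij' (fun τ _ => τ * σ) (fun σ' _ => σ' * σ⁻¹) ?_ ?_ ?_ ?_ ?_
  · exact fun τ hτ => (mul_mem_orderings hτ).2 hσ
  · intro σ' hσ'
    rw [mem_orderings, fourierOrdered_iff_monotone] at hσ hσ'
    have h := Tuple.unique_monotone (f := fun v => |κ v|) (σ := σ') (τ := σ) hσ' hσ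
    refine mem_symmetries.2 fun j => ?_
    have := congrFun h (σ⁻¹ j)
    simpa using this
  · intro τ _
    simp
  · intro σ' _
    simp
  · intro τ _
    rfl

theorem orderings_nonempty (κ : Fin n → ℤ) : (orderings κ).Nonempty :=
  ⟨Tuple.sort fun v => |κ v|, mem_orderings.2
    (fourierOrdered_iff_monotone.2 (Tuple.monotone_sort fun v => |κ v|))⟩

theorem card_orderings (κ : Fin n → ℤ) : (orderings κ).card = symCount κ := by
  obtain ⟨σ, hσ⟩ := orderings_nonempty κ
  have := sum_orderings hσ fun _ => 1
  simp only [Finset.sum_const, nsmul_eq_mul, mul_one, Nat.cast_inj] at this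
  rw [this, symCount_eq_card]

theorem average_comp (κ : Fin n → ℤ) (π : Equiv.Perm (Fin n)) (f : Equiv.Perm (Fin n) → ℂ) :
    average (fun v => κ (π v)) f = average κ fun σ => f (π⁻¹ * σ) := by
  unfold average
  rw [symCount_comp]
  congr 1
  refine Finset.sum_bij' (fun σ _ => π * σ) (fun σ _ => π⁻¹ * σ) ?_ ?_ ?_ ?_ ?_
  · intro σ hσ
    simpa [mem_orderings] using hσ
  · intro σ hσ
    simpa [mem_orderings] using hσ
  · intro σ _
    simp
  · intro σ _
    simp
  · intro σ _
    simp

/-- The permutation induced by `σ` on the positions in the range of `ι`. -/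
def inducedPerm {m : ℕ} (σ : Equiv.Perm (Fin n)) (ι : Fin m → Fin n) : Equiv.Perm (Fin m) :=
  Tuple.sort fun i => σ.symm (ι i)

theorem eq_sort_of_monotone {m : ℕ} {f : Fin m → Fin n} (hf : Function.Injective f)
    {τ : Equiv.Perm (Fin m)} (h : Monotone (f ∘ τ)) : Tuple.sort f = τ := by
  have := Tuple.unique_monotone (Tuple.monotone_sort f) h
  exact Equiv.ext fun i => hf (congrFun this i)

theorem monotone_inducedPerm {m : ℕ} (σ : Equiv.Perm (Fin n)) (ι : Fin m → Fin n) :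
    Monotone fun i => σ.symm (ι (inducedPerm σ ι i)) :=
  Tuple.monotone_sort fun i => σ.symm (ι i)

/-- The increasing enumeration of the ranks of the positions in the range of `ι`. -/
def inducedRank {m : ℕ} (σ : Equiv.Perm (Fin n)) (ι : Fin m ↪ Fin n) : Fin m ↪o Fin n :=
  OrderEmbedding.ofStrictMono (fun i => σ.symm (ι (inducedPerm σ ι i)))
    ((monotone_inducedPerm σ ι).strictMono_of_injective
      (σ.symm.injective.comp (ι.injective.comp (inducedPerm σ ι).injective)))

theorem apply_inducedRank {m : ℕ} (σ : Equiv.Perm (Fin n)) (ι : Fin m ↪ Fin n) (i : Fin m) :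
    σ (inducedRank σ ι i) = ι (inducedPerm σ ι i) := by
  simp [inducedRank]

theorem map_inducedRank {m : ℕ} (σ : Equiv.Perm (Fin n)) (ι : Fin m ↪ Fin n) :
    (List.ofFn (inducedPerm σ ι).symm).map (inducedRank σ ι) =
      List.ofFn fun i => σ.symm (ι i) := by
  rw [List.map_ofFn]
  congr 1
  funext i
  simp [inducedRank]

theorem inducedPerm_mem_orderings {m : ℕ} {κ : Fin n → ℤ} {σ : Equiv.Perm (Fin n)}
    (hσ : σ ∈ orderings κ) (ι : Fin m ↪ Fin n) :
    inducedPerm σ ι ∈ orderings fun v => κ (ι v) := by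
  rw [mem_orderings, fourierOrdered_iff_monotone] at hσ ⊢
  intro i j hij
  have := hσ (monotone_inducedPerm σ ι hij)
  simpa using this

/-- The first embedding given by a splitting of the positions. -/
def embInl (c : Fin m₁ ⊕ Fin m₂ ≃ Fin n) : Fin m₁ ↪ Fin n :=
  Function.Embedding.inl.trans c.toEmbedding

/-- The second embedding given by a splitting of the positions. -/
def embInr (c : Fin m₁ ⊕ Fin m₂ ≃ Fin n) : Fin m₂ ↪ Fin n :=
  Function.Embedding.inr.trans c.toEmbedding

/-- The rank of `ι (ρ' i)` under `ρ * σ` is the rank of `ι i` under `σ`, so the sorted list of ranks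
is unchanged. -/
theorem inducedPerm_mul {m : ℕ} {ρ : Equiv.Perm (Fin n)} {ρ' : Equiv.Perm (Fin m)}
    {ι : Fin m ↪ Fin n} (h : ∀ i, ρ (ι i) = ι (ρ' i)) (σ : Equiv.Perm (Fin n)) :
    inducedPerm (ρ * σ) ι = ρ' * inducedPerm σ ι := by
  refine eq_sort_of_monotone ((ρ * σ).symm.injective.comp ι.injective) ?_
  have : (fun i => (ρ * σ).symm (ι i)) ∘ (ρ' * inducedPerm σ ι : Equiv.Perm (Fin m)) =
      fun i => σ.symm (ι (inducedPerm σ ι i)) := by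
    funext i
    simp only [Function.comp_apply, Equiv.Perm.mul_apply]
    rw [Equiv.symm_apply_eq, Equiv.Perm.mul_apply, Equiv.apply_symm_apply, h]
  have key := monotone_inducedPerm σ ι
  rw [← this] at key
  exact key

/-- The orderings induced on two complementary sets of positions are independent. -/
theorem average_mul (c : Fin m₁ ⊕ Fin m₂ ≃ Fin n) (κ : Fin n → ℤ)
    (f₁ : Equiv.Perm (Fin m₁) → ℂ) (f₂ : Equiv.Perm (Fin m₂) → ℂ) :
    average κ (fun σ => f₁ (inducedPerm σ (embInl c)) * f₂ (inducedPerm σ (embInr c))) =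
      average (fun v => κ (embInl c v)) f₁ * average (fun v => κ (embInr c v)) f₂ := by
  set κ₁ : Fin m₁ → ℤ := fun v => κ (embInl c v)
  set κ₂ : Fin m₂ → ℤ := fun v => κ (embInr c v)
  set A : ℂ := ∑ σ ∈ orderings κ, f₁ (inducedPerm σ (embInl c)) * f₂ (inducedPerm σ (embInr c))
  have h1 : ∀ ρ₁ ∈ symmetries κ₁, ∀ ρ₂ ∈ symmetries κ₂,
      ∑ σ ∈ orderings κ, f₁ (ρ₁ * inducedPerm σ (embInl c)) *
        f₂ (ρ₂ * inducedPerm σ (embInr c)) = A := by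
    intro ρ₁ h₁ ρ₂ h₂
    -- Symmetries of the two blocks glue to a symmetry of `κ`, and left multiplication by it
    -- permutes the orderings.
    let ρ : Equiv.Perm (Fin n) := c.permCongr (Equiv.sumCongr ρ₁ ρ₂)
    have e1 : ∀ i, ρ (embInl c i) = embInl c (ρ₁ i) := fun i => by
      simp [ρ, embInl, Equiv.permCongr_apply]
    have e2 : ∀ i, ρ (embInr c i) = embInr c (ρ₂ i) := fun i => by
      simp [ρ, embInr, Equiv.permCongr_apply]
    have hρ : ρ ∈ symmetries κ := by
      rw [mem_symmetries] at h₁ h₂ ⊢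
      intro j
      obtain ⟨x, rfl⟩ := c.surjective j
      rcases x with i | i
      · have := h₁ i
        simp only [κ₁, ← e1] at this
        exact this
      · have := h₂ i
        simp only [κ₂, ← e2] at this
        exact this
    refine Finset.sum_bij' (fun σ _ => ρ * σ) (fun σ _ => ρ⁻¹ * σ) ?_ ?_ ?_ ?_ ?_
    · exact fun σ hσ => (mul_mem_orderings hρ).2 hσ
    · intro σ hσ
      rw [← mul_mem_orderings hρ]
      simpa using hσ
    · intro σ _
      simp
    · intro σ _
      simp
    · intro σ _
      rw [inducedPerm_mul e1, inducedPerm_mul e2]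
  -- Sum the invariance over all pairs of symmetries. For each `σ` the inner sums then run over all
  -- orderings of the blocks and no longer depend on `σ`, which leaves a factor equal to the number
  -- of orderings of `κ`.
  have h2 : ((symCount κ₁ : ℕ) : ℂ) * ((symCount κ₂ : ℕ) : ℂ) * A =
      ((symCount κ : ℕ) : ℂ) *
        ((∑ σ ∈ orderings κ₁, f₁ σ) * ∑ σ ∈ orderings κ₂, f₂ σ) := by
    calc ((symCount κ₁ : ℕ) : ℂ) * ((symCount κ₂ : ℕ) : ℂ) * A
        = ∑ ρ₁ ∈ symmetries κ₁, ∑ ρ₂ ∈ symmetries κ₂, A := by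
          simp only [Finset.sum_const, nsmul_eq_mul, symCount_eq_card]
          ring
      _ = ∑ ρ₁ ∈ symmetries κ₁, ∑ ρ₂ ∈ symmetries κ₂,
            ∑ σ ∈ orderings κ, f₁ (ρ₁ * inducedPerm σ (embInl c)) *
              f₂ (ρ₂ * inducedPerm σ (embInr c)) :=
          Finset.sum_congr rfl fun ρ₁ h₁ => Finset.sum_congr rfl fun ρ₂ h₂ =>
            (h1 ρ₁ h₁ ρ₂ h₂).symm
      _ = ∑ σ ∈ orderings κ, (∑ ρ₁ ∈ symmetries κ₁, f₁ (ρ₁ * inducedPerm σ (embInl c))) *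
            ∑ ρ₂ ∈ symmetries κ₂, f₂ (ρ₂ * inducedPerm σ (embInr c)) := by
          simp only [Finset.sum_mul_sum]
          rw [Finset.sum_comm' (s := orderings κ) (t := fun _ => symmetries κ₁)
            (s' := fun _ => orderings κ) (t' := symmetries κ₁) (by simp)]
          refine Finset.sum_congr rfl fun ρ₁ _ => ?_
          rw [Finset.sum_comm]
      _ = ∑ σ ∈ orderings κ, (∑ σ ∈ orderings κ₁, f₁ σ) * ∑ σ ∈ orderings κ₂, f₂ σ := by
          refine Finset.sum_congr rfl fun σ hσ => ?_
          rw [← sum_orderings (inducedPerm_mem_orderings hσ (embInl c)),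
            ← sum_orderings (inducedPerm_mem_orderings hσ (embInr c))]
      _ = _ := by
          rw [Finset.sum_const, nsmul_eq_mul, card_orderings]
  have n0 := symCount_ne_zero κ
  have n1 := symCount_ne_zero κ₁
  have n2 := symCount_ne_zero κ₂
  unfold average
  change ((symCount κ : ℕ) : ℂ)⁻¹ * A = _
  field_simp
  linear_combination h2

theorem average_sum {ι : Type*} (κ : Fin n → ℤ) (s : Finset ι)
    (f : ι → Equiv.Perm (Fin n) → ℂ) :
    average κ (fun σ => ∑ i ∈ s, f i σ) = ∑ i ∈ s, average κ (f i) := by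
  unfold average
  rw [Finset.sum_comm, Finset.mul_sum]

theorem average_list_sum {ι : Type*} (κ : Fin n → ℤ) (l : List ι)
    (f : ι → Equiv.Perm (Fin n) → ℂ) :
    average κ (fun σ => (l.map fun i => f i σ).sum) = (l.map fun i => average κ (f i)).sum := by
  induction l with
  | nil => simp [average]
  | cons a l ih =>
    simp only [List.map_cons, List.sum_cons, ← ih]
    unfold average
    rw [Finset.sum_add_distrib, mul_add]

end Average

/-! ### Summability -/

section Summability

variable {n m₁ m₂ : ℕ}

/-- Restriction of a multi-index to two complementary sets of positions. -/
def splitIndices (c : Fin m₁ ⊕ Fin m₂ ≃ Fin n) :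
    ((Fin n → ℤ) × (Fin n → ℤ)) ≃
      ((Fin m₁ → ℤ) × (Fin m₁ → ℤ)) × ((Fin m₂ → ℤ) × (Fin m₂ → ℤ)) where
  toFun p := ((fun v => p.1 (embInl c v), fun v => p.2 (embInl c v)),
    (fun v => p.1 (embInr c v), fun v => p.2 (embInr c v)))
  invFun q := (fun v => Sum.elim q.1.1 q.2.1 (c.symm v), fun v => Sum.elim q.1.2 q.2.2 (c.symm v))
  left_inv p := by
    refine Prod.ext (funext fun v => ?_) (funext fun v => ?_) <;>
    · obtain ⟨x, rfl⟩ := c.surjective v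
      rcases x with i | i <;> simp [embInl, embInr]
  right_inv q := by
    simp [embInl, embInr]

theorem hasSum_mul_split (c : Fin m₁ ⊕ Fin m₂ ≃ Fin n)
    {f₁ : (Fin m₁ → ℤ) × (Fin m₁ → ℤ) → ℂ} {f₂ : (Fin m₂ → ℤ) × (Fin m₂ → ℤ) → ℂ} {a₁ a₂ : ℂ}
    (h₁ : HasSum f₁ a₁) (h₂ : HasSum f₂ a₂) :
    HasSum (fun p : (Fin n → ℤ) × (Fin n → ℤ) =>
      f₁ (fun v => p.1 (embInl c v), fun v => p.2 (embInl c v)) *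
        f₂ (fun v => p.1 (embInr c v), fun v => p.2 (embInr c v))) (a₁ * a₂) := by
  have hs := summable_mul_of_summable_norm h₁.summable.norm h₂.summable.norm
  exact (splitIndices c).hasSum_iff.2 (h₁.mul h₂ hs)

open Classical in
/-- Restriction of a function of multi-indices to the ordered ones. -/
noncomputable def orderedPart (f : (Fin n → ℤ) × (Fin n → ℤ) → ℂ)
    (p : (Fin n → ℤ) × (Fin n → ℤ)) : ℂ :=
  if FourierOrdered p.1 then f p else 0

/-- Restriction along increasing embeddings keeps multi-indices ordered, so the series is dominated
by the product of the two ordered series. -/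
theorem summable_orderedPart_mul (S : Finset (Fin n))
    {f₁ : (Fin S.card → ℤ) × (Fin S.card → ℤ) → ℂ}
    {f₂ : (Fin Sᶜ.card → ℤ) × (Fin Sᶜ.card → ℤ) → ℂ}
    (h₁ : Summable (orderedPart f₁)) (h₂ : Summable (orderedPart f₂)) :
    Summable (orderedPart fun p =>
      f₁ (fun v => p.1 (S.orderEmbOfFin rfl v), fun v => p.2 (S.orderEmbOfFin rfl v)) *
        f₂ (fun v => p.1 (Sᶜ.orderEmbOfFin rfl v), fun v => p.2 (Sᶜ.orderEmbOfFin rfl v))) := by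
  let c := finSumEquivOfFinset (s := S) rfl rfl
  have e1 : ∀ v, embInl c v = S.orderEmbOfFin rfl v := fun v => finSumEquivOfFinset_inl rfl rfl v
  have e2 : ∀ v, embInr c v = Sᶜ.orderEmbOfFin rfl v := fun v => finSumEquivOfFinset_inr rfl rfl v
  have h := (hasSum_mul_split c h₁.hasSum h₂.hasSum).summable
  refine Summable.of_norm_bounded h.norm fun p => ?_
  simp only [e1, e2]
  unfold orderedPart
  by_cases hp : FourierOrdered p.1
  · have o1 : FourierOrdered fun v => p.1 (S.orderEmbOfFin rfl v) := fun v w hvw =>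
      hp _ _ ((S.orderEmbOfFin rfl).lt_iff_lt.2 hvw)
    have o2 : FourierOrdered fun v => p.1 (Sᶜ.orderEmbOfFin rfl v) := fun v w hvw =>
      hp _ _ ((Sᶜ.orderEmbOfFin rfl).lt_iff_lt.2 hvw)
    simp only [hp, o1, o2, if_true, le_refl]
  · rw [if_neg hp, norm_zero]
    exact norm_nonneg _

variable {d : ℕ} {P : DyadicPartition} {Z : RegDomains d} {Γ : Fin d → ℝ → ℝ}

open Forest

/-! ### Absolute convergence, from trees to forests and to regularized integrals. -/

theorem regSkeletonForest_eq_univ (F : Forest n) (ℓ : Fin n → Fin d) (κ k : Fin n → ℤ)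
    (S : Finset (Fin n)) (t : ℝ) :
    regSkeletonForest P Z Γ F ℓ κ k S t =
      regSkeletonForest P Z Γ (F.pullback (S.orderEmbOfFin rfl))
        (fun v => ℓ (S.orderEmbOfFin rfl v)) (fun v => κ (S.orderEmbOfFin rfl v))
        (fun v => k (S.orderEmbOfFin rfl v)) Finset.univ t := by
  rw [← regSkeletonForest_map]
  simp

theorem regSubforestIntegral_eq_regForestIntegral (F : Forest n) (ℓ : Fin n → Fin d)
    (κ k : Fin n → ℤ) (S : Finset (Fin n)) (t s : ℝ) :
    regSubforestIntegral P Z Γ F ℓ κ k t s S =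
      regForestIntegral P Z Γ (F.pullback (S.orderEmbOfFin rfl))
        (fun v => ℓ (S.orderEmbOfFin rfl v)) (fun v => κ (S.orderEmbOfFin rfl v))
        (fun v => k (S.orderEmbOfFin rfl v)) t s := by
  rw [← regSubforestIntegral_map_univ]
  simp

theorem summable_regSkeletonForest (hZ : AbsConvergence P Z Γ) (F : Forest n)
    (ℓ : Fin n → Fin d) (t : ℝ) :
    Summable (orderedPart fun p => regSkeletonForest P Z Γ F ℓ p.1 p.2 Finset.univ t) := by
  induction n using Nat.strong_induction_on with
  | _ n ih =>
    by_cases htree : ∃ r, F.roots Finset.univ = {r}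
    · obtain ⟨r, hr⟩ := htree
      have hT : F.IsTree := by
        have hiff : ∀ v, v ∈ F.roots Finset.univ ↔ F.parent v = none := by
          intro v
          rw [F.mem_roots, Option.eq_none_iff_forall_ne_some]
          simp
        refine ⟨r, (hiff r).1 (by simp [hr]), fun v hv => ?_⟩
        have := (hiff v).2 hv
        rwa [hr, Finset.mem_singleton] at this
      have h := (hZ n F ℓ t hT).2
      have heq : ∀ κ k, regSkeletonForest P Z Γ F ℓ κ k Finset.univ t =
          regSkeleton P Z Γ F ℓ κ k t := by
        intro κ k
        rw [← regSkeletonTree_univ]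
        exact multExt_tree (fun S => regSkeletonTree P Z Γ F ℓ κ k S t) hr
      simp only [heq]
      exact h
    · rcases Nat.eq_zero_or_pos n with rfl | hn
      · exact (hasSum_fintype _).summable
      -- A non-empty forest that is not a tree splits into one component and its complement, both
      -- with fewer vertices.
      · obtain ⟨r, hr, -⟩ := F.exists_root (Finset.mem_univ (⟨0, hn⟩ : Fin n))
        have hsep := separated_comp hr
        set S := F.comp Finset.univ r with hS
        rw [← Finset.compl_eq_univ_sdiff] at hsep
        have hne : S ≠ Finset.univ := fun h =>
          htree ⟨r, by rw [← h, hS]; exact F.roots_comp hr⟩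
        have h1 : S.card < n := by
          have := Finset.card_lt_card (Finset.ssubset_univ_iff.2 hne)
          simpa using this
        have hrS : r ∈ S := (F.mem_comp).2 ⟨Finset.mem_univ _, Relation.ReflTransGen.refl⟩
        have h2 : Sᶜ.card < n := by
          have := Finset.card_lt_univ_of_notMem (s := Sᶜ) (x := r) (by simpa using hrS)
          simpa using this
        have heq : ∀ κ k, regSkeletonForest P Z Γ F ℓ κ k Finset.univ t =
            regSkeletonForest P Z Γ F ℓ κ k S t * regSkeletonForest P Z Γ F ℓ κ k Sᶜ t := by
          intro κ k
          rw [← regSkeletonForest_union P Z Γ ℓ κ k t hsep, Finset.union_compl]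
        simp only [heq]
        simp only [regSkeletonForest_eq_univ F ℓ _ _ S, regSkeletonForest_eq_univ F ℓ _ _ Sᶜ]
        exact summable_orderedPart_mul S
          (f₁ := fun q => regSkeletonForest P Z Γ (F.pullback (S.orderEmbOfFin rfl))
            (fun v => ℓ (S.orderEmbOfFin rfl v)) q.1 q.2 Finset.univ t)
          (f₂ := fun q => regSkeletonForest P Z Γ (F.pullback (Sᶜ.orderEmbOfFin rfl))
            (fun v => ℓ (Sᶜ.orderEmbOfFin rfl v)) q.1 q.2 Finset.univ t)
          (ih _ h1 (F.pullback (S.orderEmbOfFin rfl)) _)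
          (ih _ h2 (F.pullback (Sᶜ.orderEmbOfFin rfl)) _)

theorem orderedPart_sub (f g : (Fin n → ℤ) × (Fin n → ℤ) → ℂ) :
    orderedPart (fun p => f p - g p) = fun p => orderedPart f p - orderedPart g p := by
  funext p
  unfold orderedPart
  split_ifs <;> simp

theorem orderedPart_sum {ι : Type*} (s : Finset ι) (f : ι → (Fin n → ℤ) × (Fin n → ℤ) → ℂ) :
    orderedPart (fun p => ∑ i ∈ s, f i p) = fun p => ∑ i ∈ s, orderedPart (f i) p := by
  funext p
  unfold orderedPart
  split_ifs <;> simp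

/-- The convolution identity, solved for its top term, expresses the integral through skeleton
integrals and integrals over fewer vertices. -/
theorem summable_regForestIntegral (hZ : AbsConvergence P Z Γ) (F : Forest n)
    (ℓ : Fin n → Fin d) (t s : ℝ) :
    Summable (orderedPart fun p => regForestIntegral P Z Γ F ℓ p.1 p.2 t s) := by
  induction n using Nat.strong_induction_on with
  | _ n ih =>
    have heq : ∀ κ k, regForestIntegral P Z Γ F ℓ κ k t s =
        regSkeletonForest P Z Γ F ℓ κ k Finset.univ t -
          ∑ R ∈ (lowerSets F.parent Finset.univ).erase Finset.univ,
            regSubforestIntegral P Z Γ F ℓ κ k t s R *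
              regSkeletonForest P Z Γ F ℓ κ k Rᶜ s := by
      intro κ k
      rw [← conv_regSubforestIntegral P Z Γ F ℓ κ k t s,
        conv_eq_add _ _ (regSkeletonForest_empty P Z Γ F ℓ κ k s), regForestIntegral_eq]
      simp only [Finset.compl_eq_univ_sdiff]
      ring
    simp only [heq]
    rw [orderedPart_sub fun p => regSkeletonForest P Z Γ F ℓ p.1 p.2 Finset.univ t]
    refine (summable_regSkeletonForest hZ F ℓ t).sub ?_
    rw [orderedPart_sum _ fun R p => regSubforestIntegral P Z Γ F ℓ p.1 p.2 t s R *
      regSkeletonForest P Z Γ F ℓ p.1 p.2 Rᶜ s]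
    refine summable_sum fun R hR => ?_
    have hcard : R.card < n := by
      have := Finset.card_lt_card (Finset.ssubset_univ_iff.2 (Finset.ne_of_mem_erase hR))
      simpa using this
    simp only [regSubforestIntegral_eq_regForestIntegral F ℓ _ _ R,
      regSkeletonForest_eq_univ F ℓ _ _ Rᶜ]
    exact summable_orderedPart_mul R
      (f₁ := fun q => regForestIntegral P Z Γ (F.pullback (R.orderEmbOfFin rfl))
        (fun v => ℓ (R.orderEmbOfFin rfl v)) q.1 q.2 t s)
      (f₂ := fun q => regSkeletonForest P Z Γ (F.pullback (Rᶜ.orderEmbOfFin rfl))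
        (fun v => ℓ (Rᶜ.orderEmbOfFin rfl v)) q.1 q.2 Finset.univ s)
      (ih _ hcard (F.pullback (R.orderEmbOfFin rfl)) _)
      (summable_regSkeletonForest hZ (F.pullback (Rᶜ.orderEmbOfFin rfl)) _ s)

theorem summable_regIntegralTerm (hZ : AbsConvergence P Z Γ) (F : Forest n)
    (ℓ : Fin n → Fin d) (t s : ℝ) : Summable (regIntegralTerm P Z Γ F ℓ t s) := by
  refine Summable.of_norm_bounded (summable_regForestIntegral hZ F ℓ t s).norm fun p => ?_
  unfold regIntegralTerm orderedPart
  split_ifs with hp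
  · rw [norm_mul, norm_inv, Complex.norm_natCast]
    refine mul_le_of_le_one_left (norm_nonneg _) (inv_le_one_of_one_le₀ ?_)
    have := symCount_ne_zero p.1
    rw [Nat.cast_ne_zero] at this
    exact_mod_cast Nat.one_le_iff_ne_zero.2 this
  · exact le_rfl

/-! ### The regularized rough path as a sum of averages -/

variable (P Z Γ) in
/-- The regularized rough path of the word `ℓ`, indexed by `Fin n`. -/
noncomputable def roughPathFin (ℓ : Fin n → Fin d) (t s : ℝ) : ℂ :=
  ∑ σ : Equiv.Perm (Fin n), ∑ c ∈ (splitRanks σ).powerset,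
    (-1) ^ c.card * regIntegral P Z Γ (permForest σ c) (fun j => ℓ (σ j)) t s

variable (P Z Γ) in
/-- The contribution of one multi-index to the regularized rough path. -/
noncomputable def roughPathTerm (ℓ : Fin n → Fin d) (t s : ℝ)
    (p : (Fin n → ℤ) × (Fin n → ℤ)) : ℂ :=
  average p.1 fun σ => wordIntegral P Z Γ (List.ofFn σ.symm) (fun j => ℓ (σ j))
    (fun j => p.1 (σ j)) (fun j => p.2 (σ j)) t s

/-- Permutation of the positions of a multi-index. -/
def permIndices (σ : Equiv.Perm (Fin n)) :
    ((Fin n → ℤ) × (Fin n → ℤ)) ≃ ((Fin n → ℤ) × (Fin n → ℤ)) where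
  toFun p := (fun v => p.1 (σ v), fun v => p.2 (σ v))
  invFun p := (fun v => p.1 (σ.symm v), fun v => p.2 (σ.symm v))
  left_inv p := by simp
  right_inv p := by simp

/-- Reindexing the series of each `σ` by `σ` moves the frequencies from ranks back to positions. The
index `p` then receives exactly the `σ` that order `p.1`, all with the weight of `p.1` itself. -/
theorem hasSum_roughPathTerm (hZ : AbsConvergence P Z Γ) (ℓ : Fin n → Fin d) (t s : ℝ) :
    HasSum (roughPathTerm P Z Γ ℓ t s) (roughPathFin P Z Γ ℓ t s) := by
  have h : HasSum (fun p => ∑ σ : Equiv.Perm (Fin n), ∑ c ∈ (splitRanks σ).powerset,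
      (-1) ^ c.card * regIntegralTerm P Z Γ (permForest σ c) (fun j => ℓ (σ j)) t s
        (permIndices σ p)) (roughPathFin P Z Γ ℓ t s) := by
    refine hasSum_sum fun σ _ => hasSum_sum fun c _ => HasSum.mul_left _ ?_
    exact (permIndices σ).hasSum_iff.2
      (summable_regIntegralTerm hZ (permForest σ c) (fun j => ℓ (σ j)) t s).hasSum
  convert h using 1
  funext p
  unfold roughPathTerm average orderings
  rw [Finset.sum_filter, Finset.mul_sum]
  refine Finset.sum_congr rfl fun σ _ => ?_
  unfold regIntegralTerm
  by_cases hp : FourierOrdered fun v => p.1 (σ v)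
  · have hp' : FourierOrdered (permIndices σ p).1 := hp
    rw [if_pos hp, wordIntegral, ← sum_permForest σ fun F =>
      regForestIntegral P Z Γ F (fun j => ℓ (σ j)) (fun j => p.1 (σ j)) (fun j => p.2 (σ j)) t s,
      Finset.mul_sum]
    refine Finset.sum_congr rfl fun c _ => ?_
    have hsym : symCount (permIndices σ p).1 = symCount p.1 := symCount_comp p.1 σ
    rw [if_pos hp', hsym]
    simp only [permIndices, Equiv.coe_fn_mk]
    ring
  · have hp' : ¬ FourierOrdered (permIndices σ p).1 := hp
    simp only [hp, hp', if_false, mul_zero, Finset.sum_const_zero]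

theorem regRoughPath_eq_roughPathFin {w : List (Fin d)} (hw : w.length = n) (ℓ : Fin n → Fin d)
    (hℓ : w = List.ofFn ℓ) (t s : ℝ) :
    regRoughPath P Z Γ w t s = roughPathFin P Z Γ ℓ t s := by
  subst hw
  have : ℓ = w.get := by
    apply List.ofFn_injective
    rw [← hℓ]
    exact (List.ofFn_get w).symm
  rw [this]
  rfl

end Summability

/-! ### The Chen and shuffle properties -/

section RoughPath

variable {d n m₁ m₂ : ℕ} {P : DyadicPartition} {Z : RegDomains d} {Γ : Fin d → ℝ → ℝ}

theorem roughPathFin_zero (hZ : AbsConvergence P Z Γ) (ℓ : Fin 0 → Fin d) (t s : ℝ) :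
    roughPathFin P Z Γ ℓ t s = 1 := by
  refine (hasSum_roughPathTerm hZ ℓ t s).unique ?_
  have h1 : ∀ p, roughPathTerm P Z Γ ℓ t s p = 1 := by
    intro p
    have hsum : ∀ σ : Equiv.Perm (Fin 0), wordIntegral P Z Γ (List.ofFn σ.symm)
        (fun j => ℓ (σ j)) (fun j => p.1 (σ j)) (fun j => p.2 (σ j)) t s = 1 := by
      intro σ
      rw [List.ofFn_zero, wordIntegral, permSum_nil, regForestIntegral_eq]
      exact regSubforestIntegral_empty P Z Γ _ _ _ _ t s
    unfold roughPathTerm average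
    rw [Finset.sum_congr rfl fun σ _ => hsum σ, Finset.sum_const, nsmul_one, card_orderings]
    exact inv_mul_cancel₀ (symCount_ne_zero p.1)
  have h2 := hasSum_fintype (roughPathTerm P Z Γ ℓ t s)
  simpa [h1] using h2

/-- Independence of the induced orderings merges two separate averages into one average over
orderings of all positions. The two time intervals may differ: Chen and shuffle both use this. -/
theorem hasSum_roughPathTerm_mul (hZ : AbsConvergence P Z Γ) (c : Fin m₁ ⊕ Fin m₂ ≃ Fin n)
    (ℓ : Fin n → Fin d) (t u v s : ℝ) :
    HasSum (fun p : (Fin n → ℤ) × (Fin n → ℤ) => average p.1 fun σ =>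
      wordIntegral P Z Γ (List.ofFn (inducedPerm σ (embInl c)).symm)
        (fun j => ℓ (embInl c (inducedPerm σ (embInl c) j)))
        (fun j => p.1 (embInl c (inducedPerm σ (embInl c) j)))
        (fun j => p.2 (embInl c (inducedPerm σ (embInl c) j))) t u *
      wordIntegral P Z Γ (List.ofFn (inducedPerm σ (embInr c)).symm)
        (fun j => ℓ (embInr c (inducedPerm σ (embInr c) j)))
        (fun j => p.1 (embInr c (inducedPerm σ (embInr c) j)))
        (fun j => p.2 (embInr c (inducedPerm σ (embInr c) j))) v s)
      (roughPathFin P Z Γ (fun i => ℓ (embInl c i)) t u *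
        roughPathFin P Z Γ (fun i => ℓ (embInr c i)) v s) := by
  have h := hasSum_mul_split c (hasSum_roughPathTerm hZ (fun i => ℓ (embInl c i)) t u)
    (hasSum_roughPathTerm hZ (fun i => ℓ (embInr c i)) v s)
  convert h using 1
  funext p
  exact average_mul c p.1
    (fun σ => wordIntegral P Z Γ (List.ofFn σ.symm) (fun j => ℓ (embInl c (σ j)))
      (fun j => p.1 (embInl c (σ j))) (fun j => p.2 (embInl c (σ j))) t u)
    (fun σ => wordIntegral P Z Γ (List.ofFn σ.symm) (fun j => ℓ (embInr c (σ j)))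
      (fun j => p.1 (embInr c (σ j))) (fun j => p.2 (embInr c (σ j))) v s)

theorem inducedRank_ne (c : Fin m₁ ⊕ Fin m₂ ≃ Fin n) (σ : Equiv.Perm (Fin n)) (i : Fin m₁)
    (j : Fin m₂) : inducedRank σ (embInl c) i ≠ inducedRank σ (embInr c) j := by
  intro h
  have := congrArg σ h
  rw [apply_inducedRank, apply_inducedRank] at this
  simp [embInl, embInr] at this

theorem inducedRank_cover (c : Fin m₁ ⊕ Fin m₂ ≃ Fin n) (σ : Equiv.Perm (Fin n)) (v : Fin n) :
    v ∈ Set.range (inducedRank σ (embInl c)) ∨ v ∈ Set.range (inducedRank σ (embInr c)) := by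
  obtain ⟨x, hx⟩ := c.surjective (σ v)
  rcases x with i | i
  · refine Or.inl ⟨(inducedPerm σ (embInl c)).symm i, σ.injective ?_⟩
    rw [apply_inducedRank, Equiv.apply_symm_apply]
    exact hx
  · refine Or.inr ⟨(inducedPerm σ (embInr c)).symm i, σ.injective ?_⟩
    rw [apply_inducedRank, Equiv.apply_symm_apply]
    exact hx

/-- The splitting of `n` positions into the first `m₁` and the last `m₂`. -/
def initialSplit (h : m₁ + m₂ = n) : Fin m₁ ⊕ Fin m₂ ≃ Fin n :=
  finSumFinEquiv.trans (finCongr h)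

theorem take_ofFn_initialSplit {A : Type*} (h : m₁ + m₂ = n) (f : Fin n → A) :
    (List.ofFn f).take m₁ = List.ofFn fun i => f (embInl (initialSplit h) i) := by
  subst h
  apply List.ext_getElem
  · simp
  · intro i h1 h2
    simp [embInl, initialSplit]

theorem drop_ofFn_initialSplit {A : Type*} (h : m₁ + m₂ = n) (f : Fin n → A) :
    (List.ofFn f).drop m₁ = List.ofFn fun i => f (embInr (initialSplit h) i) := by
  subst h
  apply List.ext_getElem
  · simp
  · intro i h1 h2
    simp [embInr, initialSplit]

theorem hasSum_split (hZ : AbsConvergence P Z Γ) (h : m₁ + m₂ = n) (ℓ : Fin n → Fin d)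
    (t u s : ℝ) :
    HasSum (fun p : (Fin n → ℤ) × (Fin n → ℤ) => average p.1 fun σ =>
      permSum ((List.ofFn σ.symm).take m₁) (permSum ((List.ofFn σ.symm).drop m₁) fun q =>
        regSubforestIntegral P Z Γ (Forest.ofParent q) (fun j => ℓ (σ j)) (fun j => p.1 (σ j))
            (fun j => p.2 (σ j)) t u ((List.ofFn σ.symm).take m₁).toFinset *
          regSubforestIntegral P Z Γ (Forest.ofParent q) (fun j => ℓ (σ j)) (fun j => p.1 (σ j))
            (fun j => p.2 (σ j)) u s
            (Finset.univ \ ((List.ofFn σ.symm).take m₁).toFinset)) fun _ => none)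
      (regRoughPath P Z Γ ((List.ofFn ℓ).take m₁) t u *
        regRoughPath P Z Γ ((List.ofFn ℓ).drop m₁) u s) := by
  set c := initialSplit h with hc
  have h1 : (List.ofFn ℓ).take m₁ = List.ofFn fun i => ℓ (embInl c i) :=
    take_ofFn_initialSplit h ℓ
  have h2 : (List.ofFn ℓ).drop m₁ = List.ofFn fun i => ℓ (embInr c i) :=
    drop_ofFn_initialSplit h ℓ
  rw [regRoughPath_eq_roughPathFin (by rw [h1, List.length_ofFn]) _ h1,
    regRoughPath_eq_roughPathFin (by rw [h2, List.length_ofFn]) _ h2]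
  convert hasSum_roughPathTerm_mul hZ c ℓ t u u s using 1
  funext p
  congr 1
  funext σ
  rw [take_ofFn_initialSplit h, drop_ofFn_initialSplit h, ← hc,
    ← map_inducedRank σ (embInl c), ← map_inducedRank σ (embInr c),
    wordIntegral_split P Z Γ (inducedRank σ (embInl c)) (inducedRank σ (embInr c))
      (nodup_ofFn_symm _) (nodup_ofFn_symm _) (mem_ofFn_symm _) (mem_ofFn_symm _)
      (inducedRank_ne c σ) (inducedRank_cover c σ)]
  simp only [apply_inducedRank]

/-- Chen's identity with both end terms included; for fixed multi-index and `σ` it is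
`wordIntegral_chen`. -/
theorem regRoughPath_eq_sum (hZ : AbsConvergence P Z Γ) (w : List (Fin d)) (t u s : ℝ) :
    regRoughPath P Z Γ w t s = ∑ j ∈ Finset.range (w.length + 1),
      regRoughPath P Z Γ (w.take j) t u * regRoughPath P Z Γ (w.drop j) u s := by
  have hw : w = List.ofFn w.get := (List.ofFn_get w).symm
  rw [regRoughPath_eq_roughPathFin rfl w.get hw]
  refine (hasSum_roughPathTerm hZ w.get t s).unique ?_
  have h : HasSum (fun p : (Fin w.length → ℤ) × (Fin w.length → ℤ) =>
      ∑ j ∈ Finset.range (w.length + 1), average p.1 fun σ =>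
      permSum ((List.ofFn σ.symm).take j) (permSum ((List.ofFn σ.symm).drop j) fun q =>
        regSubforestIntegral P Z Γ (Forest.ofParent q) (fun j => w.get (σ j))
            (fun j => p.1 (σ j)) (fun j => p.2 (σ j)) t u
            ((List.ofFn σ.symm).take j).toFinset *
          regSubforestIntegral P Z Γ (Forest.ofParent q) (fun j => w.get (σ j))
            (fun j => p.1 (σ j)) (fun j => p.2 (σ j)) u s
            (Finset.univ \ ((List.ofFn σ.symm).take j).toFinset)) fun _ => none)
      (∑ j ∈ Finset.range (w.length + 1),
        regRoughPath P Z Γ (w.take j) t u * regRoughPath P Z Γ (w.drop j) u s) := by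
    refine hasSum_sum fun j hj => ?_
    have hj' : j + (w.length - j) = w.length := by
      rw [Finset.mem_range] at hj
      omega
    have := hasSum_split hZ hj' w.get t u s
    rwa [List.ofFn_get] at this
  convert h using 1
  funext p
  rw [← average_sum]
  unfold roughPathTerm
  congr 1
  funext σ
  have := wordIntegral_chen P Z Γ (List.ofFn σ.symm) (nodup_ofFn_symm σ) (mem_ofFn_symm σ)
    (fun j => w.get (σ j)) (fun j => p.1 (σ j)) (fun j => p.2 (σ j)) t u s
  rw [List.length_ofFn] at this
  exact this

theorem regRoughPath_nil (hZ : AbsConvergence P Z Γ) (t s : ℝ) :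
    regRoughPath P Z Γ [] t s = 1 :=
  roughPathFin_zero hZ _ t s

theorem regRoughPath_chen (hZ : AbsConvergence P Z Γ) (w : List (Fin d)) (t u s : ℝ)
    (hw : w ≠ []) :
    regRoughPath P Z Γ w t s - regRoughPath P Z Γ w t u - regRoughPath P Z Γ w u s =
      ∑ j ∈ Finset.Ioo 0 w.length,
        regRoughPath P Z Γ (w.take j) t u * regRoughPath P Z Γ (w.drop j) u s := by
  have hpos : 0 < w.length := List.length_pos_iff.2 hw
  have hIoo : Finset.Ioo 0 w.length = Finset.Ico 1 w.length := by
    ext j; simp [Nat.succ_le_iff]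
  rw [regRoughPath_eq_sum hZ w t u s, Finset.sum_range_succ, Finset.range_eq_Ico,
    Finset.sum_eq_sum_Ico_succ_bot hpos, List.take_length, List.drop_length, List.take_zero,
    List.drop_zero, regRoughPath_nil hZ, regRoughPath_nil hZ, hIoo]
  ring

theorem hasSum_list_sum {ι β : Type*} (l : List ι) (f : ι → β → ℂ) (a : ι → ℂ)
    (h : ∀ i ∈ l, HasSum (f i) (a i)) :
    HasSum (fun b => (l.map fun i => f i b).sum) (l.map a).sum := by
  induction l with
  | nil => simp
  | cons i l ih =>
    simp only [List.map_cons, List.sum_cons]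
    exact (h i (by simp)).add (ih fun j hj => h j (by simp [hj]))

/-- The regularized rough path of a permuted word, as a sum over the multi-indices of the
unpermuted word. -/
theorem hasSum_regRoughPath_map (hZ : AbsConvergence P Z Γ) (X : List (Fin n)) (hnd : X.Nodup)
    (hX : X.length = n) (ℓ : Fin n → Fin d) (t s : ℝ) :
    HasSum (fun p : (Fin n → ℤ) × (Fin n → ℤ) => average p.1 fun σ =>
      wordIntegral P Z Γ (X.map σ.symm) (fun j => ℓ (σ j)) (fun j => p.1 (σ j))
        (fun j => p.2 (σ j)) t s) (regRoughPath P Z Γ (X.map ℓ) t s) := by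
  have hbij : Function.Bijective fun i : Fin n => X.get (i.cast hX.symm) := by
    refine (Fintype.bijective_iff_injective_and_card _).2 ⟨fun i j hij => ?_, rfl⟩
    have := (List.Nodup.get_inj_iff hnd).1 hij
    simpa using this
  let π : Equiv.Perm (Fin n) := Equiv.ofBijective _ hbij
  have hπ : X = List.ofFn π := by
    apply List.ext_getElem
    · simp [hX]
    · intro i h1 h2
      simp [π]
  have hmap : X.map ℓ = List.ofFn fun i => ℓ (π i) := by
    rw [hπ, List.map_ofFn]; rfl
  rw [regRoughPath_eq_roughPathFin (by rw [List.length_map, hX]) _ hmap]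
  have h := (permIndices π).hasSum_iff.2 (hasSum_roughPathTerm hZ (fun i => ℓ (π i)) t s)
  convert h using 1
  funext p
  simp only [Function.comp_apply, roughPathTerm, permIndices, Equiv.coe_fn_mk]
  rw [average_comp p.1 π]
  congr 1
  funext σ
  have h1 : List.ofFn (π⁻¹ * σ).symm = X.map σ.symm := by
    rw [hπ, List.map_ofFn]
    rfl
  have h2 : ∀ j, π ((π⁻¹ * σ) j) = σ j := fun j => by simp
  simp only [h1, h2]

theorem regRoughPath_shuffle (hZ : AbsConvergence P Z Γ) (v w : List (Fin d)) (t s : ℝ) :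
    regRoughPath P Z Γ v t s * regRoughPath P Z Γ w t s =
      ((shuffles v w).map fun x => regRoughPath P Z Γ x t s).sum := by
  let c : Fin v.length ⊕ Fin w.length ≃ Fin (v.length + w.length) := finSumFinEquiv
  let ℓ : Fin (v.length + w.length) → Fin d := fun i => Sum.elim v.get w.get (c.symm i)
  have hℓ₁ : (fun i => ℓ (embInl c i)) = v.get := by
    funext i; simp only [ℓ, embInl, Function.Embedding.trans_apply, Equiv.coe_toEmbedding,
      Equiv.symm_apply_apply, Function.Embedding.inl_apply, Sum.elim_inl]
  have hℓ₂ : (fun i => ℓ (embInr c i)) = w.get := by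
    funext i; simp only [ℓ, embInr, Function.Embedding.trans_apply, Equiv.coe_toEmbedding,
      Equiv.symm_apply_apply, Function.Embedding.inr_apply, Sum.elim_inr]
  -- Shuffling the distinct positions first, and decorating by `ℓ` afterwards, counts shuffles with
  -- the right multiplicity even when letters repeat.
  set X₁ := List.ofFn (embInl c) with hX₁
  set X₂ := List.ofFn (embInr c) with hX₂
  have hv : v = X₁.map ℓ := by
    rw [hX₁, List.map_ofFn]
    exact ((congrArg List.ofFn hℓ₁).trans (List.ofFn_get v)).symm
  have hw : w = X₂.map ℓ := by
    rw [hX₂, List.map_ofFn]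
    exact ((congrArg List.ofFn hℓ₂).trans (List.ofFn_get w)).symm
  have hnd : (X₁ ++ X₂).Nodup := by
    rw [List.nodup_append]
    refine ⟨List.nodup_ofFn.2 (embInl c).injective, List.nodup_ofFn.2 (embInr c).injective,
      fun a ha b hb => ?_⟩
    obtain ⟨i, rfl⟩ := List.mem_ofFn.1 ha
    obtain ⟨j, rfl⟩ := List.mem_ofFn.1 hb
    simp [embInl, embInr]
  have hlen : (X₁ ++ X₂).length = v.length + w.length := by
    rw [hX₁, hX₂, List.length_append, List.length_ofFn, List.length_ofFn]
  have hsum := hasSum_list_sum (shuffles X₁ X₂) _ _ fun X hX =>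
    hasSum_regRoughPath_map hZ X ((perm_of_mem_shuffles hX).nodup_iff.2 hnd)
      ((perm_of_mem_shuffles hX).length_eq.trans hlen) ℓ t s
  have hmul := hasSum_roughPathTerm_mul hZ c ℓ t s t s
  rw [hℓ₁, hℓ₂] at hmul
  have hshuffle : shuffles v w = (shuffles X₁ X₂).map (List.map ℓ) := by
    rw [← map_shuffles, ← hv, ← hw]
  rw [hshuffle, List.map_map]
  -- All shuffled words are now summed over the same multi-indices and the same orderings, so the
  -- terms can be compared for each `p` and `σ`.
  refine hmul.unique (Eq.subst (motive := fun f => HasSum f _) (funext fun p => ?_) hsum)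
  rw [← average_list_sum]
  congr 1
  funext σ
  have e1 : (List.ofFn (inducedPerm σ (embInl c)).symm).map (inducedRank σ (embInl c)) =
      X₁.map σ.symm := by
    rw [map_inducedRank, hX₁, List.map_ofFn]; rfl
  have e2 : (List.ofFn (inducedPerm σ (embInr c)).symm).map (inducedRank σ (embInr c)) =
      X₂.map σ.symm := by
    rw [map_inducedRank, hX₂, List.map_ofFn]; rfl
  have h := wordIntegral_mul_wordIntegral P Z Γ (inducedRank σ (embInl c))
    (inducedRank σ (embInr c)) (nodup_ofFn_symm (inducedPerm σ (embInl c)))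
    (nodup_ofFn_symm (inducedPerm σ (embInr c))) (mem_ofFn_symm _) (mem_ofFn_symm _) (inducedRank_ne c σ) (inducedRank_cover c σ) (fun j => ℓ (σ j))
    (fun j => p.1 (σ j)) (fun j => p.2 (σ j)) t s
  rw [e1, e2, map_shuffles, List.map_map] at h
  simp only [apply_inducedRank] at h
  exact h

end RoughPath

end FourierNormalOrdering

theorem theorem3p1 {d : ℕ} (α : NNReal) (hα0 : 0 < α) (hα1 : α < 1)
    (Γ : Fin d → ℝ → ℝ) (hΓ : ∀ i, ∃ C : NNReal, HolderWith C α (Γ i))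
    (hΓc : ∀ i, HasCompactSupport (Γ i))
    (P : DyadicPartition) (Z : RegDomains d) (hZ : AbsConvergence P Z Γ) :
    -- the series that define the regularized rough path converge absolutely
    (∀ (n : ℕ) (F : Forest n) (ℓ : Fin n → Fin d) (t s : ℝ),
      Summable (regIntegralTerm P Z Γ F ℓ t s)) ∧
    -- the multiplicative (Chen) property
    (∀ (w : List (Fin d)) (t u s : ℝ), w ≠ [] →
      regRoughPath P Z Γ w t s - regRoughPath P Z Γ w t u - regRoughPath P Z Γ w u s =
        ∑ j ∈ Finset.Ioo 0 w.length,
          regRoughPath P Z Γ (w.take j) t u * regRoughPath P Z Γ (w.drop j) u s) ∧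
    -- the geometric (shuffle) property
    (∀ (v w : List (Fin d)) (t s : ℝ), v ≠ [] → w ≠ [] →
      regRoughPath P Z Γ v t s * regRoughPath P Z Γ w t s =
        ((shuffles v w).map fun x => regRoughPath P Z Γ x t s).sum) :=
  ⟨fun _ F ℓ t s => summable_regIntegralTerm hZ F ℓ t s,
    fun w t u s hw => regRoughPath_chen hZ w t u s hw,
    fun v w t s _ _ => regRoughPath_shuffle hZ v w t s⟩
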